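/- **Setting.** For $\beta\in\mathbb N$ let $\varepsilon=2^{-\beta}$ and let $\mathbb F_\beta$ consist of $0$ and the numbers $\frac{m}{2^{\beta}}2^{e}$ with $m,e\in\mathbb Z$, $\frac12\le|m|/2^\beta\le 1$; let $\mathtt{rnd}$ be any rounding to a nearest element of $\mathbb F_\beta$, and $x\circledast y=\mathtt{rnd}(\mathtt{rnd}(x)\ast\mathtt{rnd}(y))$ for $\ast\in\{+,-,\times\}$. *Logarithm.* For $x=w2^e>0$ with $\frac12\le w<1$, put $m=\lceil(\beta+3)/2\rceil-e$, $s=x2^m$ and $\mathsf{Log}(x)=\frac{\pi}{2\,\mathrm{AGM}(1,4/s)}-m\log 2$. *Factorials.* For $t\in\mathbb N$ and real $g>-\frac12$ let $\mathsf{Fact}(k)=\sqrt{2\pi}\,(k+g+\frac12)^{k+1/2}e^{-(k+g+1/2)}A_{t,g}(k)$, where $A_{t,g}(x)$ is the Lanczos series $\frac12p_0(g)+p_1(g)\frac{x}{x+1}+p_2(g)\frac{x(x-1)}{(x+1)(x+2)}+\cdots$ truncated to $t$ terms. Here $p_i(g)=\frac{\sqrt2}{\pi}\sum_{l=0}^{i}C_{i,l}\,\Gamma(l+\frac12)(l+g+\frac12)^{-(l+1/2)}e^{l+g+1/2}$,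 with $C_{i,l}$ the coefficient of $x^{2l}$ in the Chebyshev polynomial $T_{2i}$. Let $\zeta$ be a uniform relative error bound: $|k!-\mathsf{Fact}(k)|\le\zeta\,k!$ for all $k\in\mathbb N$. Let $\mathsf{LogFactorial}(k)=\frac12\mathsf{Log}(2\pi)+(k+\frac12)\mathsf{Log}(k+g+\frac12)-(k+g+\frac12)+\mathsf{Log}(A_{t,g}(k))$. *Hat.* Let $n\ge1$, $0<p<1$, and $\mathsf b_{n,p}(k)=\binom nk p^k(1-p)^{n-k}$. A hat distribution with rejection rate $\alpha$ is a probability density $\mathsf h$ on $\mathbb R$ with $\mathsf b_{n,p}(k)\le\alpha\,\mathsf h(x)$ for $0\le k\le n$ and $x\in[k,k+1)$. For $-\frac12<u<\frac12$ let $\mathcal H^{-1}(u)$ be its quantile of order $u+\frac12$ and $\mathsf h^{-1}(u)=1/\mathsf h(\mathcal H^{-1}(u))$. Assume that these two functions are given by arithmetic expressions in $u$ and real constants, built with $+,-,\times,/,\sqrt{\ },|\cdot|$. Their computed values, marked by a hat, are obtained by rounding the constants and the result of every operation ($|\cdot|$ is exact). Let $c$ be a rounding constant of this pair: for every precision $\beta\ge1$,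 every such rounding and every $u\in(-\frac12,\frac12)$, $|\widehat{\mathcal H^{-1}}(u)-\mathcal H^{-1}(u)|\le c\,\varepsilon\max(1,|\mathcal H^{-1}(u)|)$ and $|\widehat{\mathsf h^{-1}}(u)-\mathsf h^{-1}(u)|\le c\,\varepsilon\,|\mathsf h^{-1}(u)|$. *Sampler.* $\mathsf{BinSamp}(n,p)$ repeats independent rounds. In each round it draws $u$ uniformly from $[-\frac12,\frac12]$ and $v$ uniformly from $[0,1]$, and sets $k=\lfloor\widehat{\mathcal H^{-1}}(u)\rfloor$. It rejects if $k\notin\{0,\dots,n\}$. Otherwise it computes, from left to right, $l_v=l_n\ominus l_k\ominus l_{n-k}\oplus k\otimes\mathsf{Log}(p)\oplus(n-k)\otimes\mathsf{Log}(1-p)\oplus\mathsf{Log}(\widehat{\mathsf h^{-1}}(u))\ominus\mathsf{Log}(\alpha)$, where $l_j=\mathsf{LogFactorial}(j)$, and returns $k$ if $\mathsf{Log}(v)\le l_v$. Let $\mathsf b^{\mathsf{BinSamp}}_{n,p}$ be its output distribution, and $\mathsf{d_{TV}}(P,Q)=\frac12\sum_{k=0}^n|P(k)-Q(k)|$. **Theorem.**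 There is a function $r(\beta)=o(2^{-\beta})$ $(\beta\to\infty)$ such that, for all $n,p,\alpha,\mathsf h$, expression pairs, $c,t,g,\zeta$ and roundings as above and every integer $\beta\ge\max(2\lceil\log_2 n\rceil,\lceil-\log_2 p\rceil)$, $$\mathsf{d_{TV}}\bigl(\mathsf b_{n,p},\mathsf b^{\mathsf{BinSamp}}_{n,p}\bigr)\le(1110\beta+3cp+c+\alpha c)\,n\,\varepsilon+15\zeta+r(\beta),\qquad \varepsilon=2^{-\beta}.$$ -/

import Mathlib

open Filter Asymptotics MeasureTheory

/-! ### Distributions on a finite set -/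

/-- Statistical (total variation) distance of two mass functions on a finite set. -/
noncomputable def statDist {Ω : Type*} [Fintype Ω] (P Q : Ω → ℝ) : ℝ :=
  (1 / 2) * ∑ x, |P x - Q x|

/-- The Binomial mass function `b_{n,p}` on `{0, …, n}`. -/
noncomputable def binomialMass (n : ℕ) (p : ℝ) (k : ℕ) : ℝ :=
  (n.choose k : ℝ) * p ^ k * (1 - p) ^ (n - k)

/-! ### Multiple-precision arithmetic -/

/-- Numbers with a `β`-bit significand and unbounded exponent: zero, and all `w * 2 ^ e` with
`1/2 ≤ |w| ≤ 1`, where `w = m / 2 ^ β` for an integer `m`. -/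
def machineNumbers (β : ℕ) : Set ℝ :=
  {x | x = 0 ∨ ∃ m e : ℤ, (2 : ℤ) ^ β ≤ 2 * |m| ∧ |m| ≤ (2 : ℤ) ^ β ∧
    x = (m : ℝ) / (2 : ℝ) ^ β * (2 : ℝ) ^ e}

/-- `rnd` rounds every real number to a nearest machine number (ties are broken in any way). -/
def IsRoundToNearest (β : ℕ) (rnd : ℝ → ℝ) : Prop :=
  ∀ x, rnd x ∈ machineNumbers β ∧ ∀ y ∈ machineNumbers β, |rnd x - x| ≤ |y - x|

/-- Correctly rounded addition of the rounded operands. -/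
def flAdd (rnd : ℝ → ℝ) (x y : ℝ) : ℝ := rnd (rnd x + rnd y)

/-- Correctly rounded subtraction of the rounded operands. -/
def flSub (rnd : ℝ → ℝ) (x y : ℝ) : ℝ := rnd (rnd x - rnd y)

/-- Correctly rounded multiplication of the rounded operands. -/
def flMul (rnd : ℝ → ℝ) (x y : ℝ) : ℝ := rnd (rnd x * rnd y)

/-! ### Logarithms by the arithmetic-geometric mean -/

/-- The exponent `e` of `x = w * 2 ^ e` with `1/2 ≤ w < 1` (for `x > 0`). -/
noncomputable def binExponent (x : ℝ) : ℤ := Int.log 2 x + 1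

/-- The AGM logarithm at precision `β`: with `m = ⌈(β + 3) / 2⌉ - exponent x` and `s = x * 2 ^ m`,
it is `π / (2 * AGM(1, 4 / s)) - m * log 2`. -/
noncomputable def agmLog (β : ℕ) (x : ℝ) : ℝ :=
  let m : ℤ := ⌈((β : ℝ) + 3) / 2⌉ - binExponent x
  let s : ℝ := x * (2 : ℝ) ^ m
  Real.pi / (2 * (NNReal.agm 1 (Real.toNNReal (4 / s)) : ℝ)) - m * Real.log 2

/-! ### The Lanczos approximation of factorials -/

/-- The Lanczos coefficient
`p_i(g) = (√2 / π) ∑_{l ≤ i} C_{i,l} (l - 1/2)! (l + g + 1/2) ^ (-(l + 1/2)) e ^ (l + g + 1/2)`,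
where `C_{i,l}` is the coefficient of `x ^ (2 l)` in the Chebyshev polynomial `T_{2 i}`. -/
noncomputable def lanczosCoeff (g : ℝ) (i : ℕ) : ℝ :=
  Real.sqrt 2 / Real.pi * ∑ l ∈ Finset.range (i + 1),
    (Polynomial.Chebyshev.T ℝ (2 * (i : ℤ))).coeff (2 * l) * Real.Gamma ((l : ℝ) + 1 / 2) *
      ((l : ℝ) + g + 1 / 2) ^ (-((l : ℝ) + 1 / 2)) * Real.exp ((l : ℝ) + g + 1 / 2)

/-- The Lanczos series truncated to `t` terms,
`A_{t,g}(x) = p_0 / 2 + p_1 x / (x+1) + p_2 x (x-1) / ((x+1) (x+2)) + ⋯`. -/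
noncomputable def lanczosSeries (t : ℕ) (g x : ℝ) : ℝ :=
  ∑ i ∈ Finset.range t, (if i = 0 then (1 / 2 : ℝ) else 1) * lanczosCoeff g i *
    ∏ j ∈ Finset.range i, (x - j) / (x + j + 1)

/-- The Lanczos approximation of `k!`. -/
noncomputable def lanczosFactorial (t : ℕ) (g : ℝ) (k : ℕ) : ℝ :=
  Real.sqrt (2 * Real.pi) * ((k : ℝ) + g + 1 / 2) ^ ((k : ℝ) + 1 / 2) *
    Real.exp (-((k : ℝ) + g + 1 / 2)) * lanczosSeries t g k

/-- `ζ` is a uniform bound on the relative error of the Lanczos approximation. -/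
def IsLanczosErrorBound (t : ℕ) (g ζ : ℝ) : Prop :=
  ∀ k : ℕ, |(k.factorial : ℝ) - lanczosFactorial t g k| / (k.factorial : ℝ) ≤ ζ

/-- `LogFactorial`: the logarithm of the Lanczos approximation, computed with AGM logarithms. -/
noncomputable def logFactorial (β t : ℕ) (g : ℝ) (k : ℕ) : ℝ :=
  (1 / 2) * agmLog β (2 * Real.pi) + ((k : ℝ) + 1 / 2) * agmLog β ((k : ℝ) + g + 1 / 2) -
    ((k : ℝ) + g + 1 / 2) + agmLog β (lanczosSeries t g k)

/-! ### Arithmetic programs for the inverse function and the hat function -/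

/-- Straight-line arithmetic programs in one variable, over the basic operations
(and the absolute value, which is exact in binary arithmetic). -/
inductive ArithExpr where
  | var : ArithExpr
  | const : ℝ → ArithExpr
  | add : ArithExpr → ArithExpr → ArithExpr
  | sub : ArithExpr → ArithExpr → ArithExpr
  | mul : ArithExpr → ArithExpr → ArithExpr
  | div : ArithExpr → ArithExpr → ArithExpr
  | sqrt : ArithExpr → ArithExpr
  | abs : ArithExpr → ArithExpr

/-- The value of a program in exact real arithmetic. -/
noncomputable def ArithExpr.exact : ArithExpr → ℝ → ℝ
  | .var, u => u
  | .const a, _ => a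
  | .add e f, u => e.exact u + f.exact u
  | .sub e f, u => e.exact u - f.exact u
  | .mul e f, u => e.exact u * f.exact u
  | .div e f, u => e.exact u / f.exact u
  | .sqrt e, u => Real.sqrt (e.exact u)
  | .abs e, u => |e.exact u|

/-- The value of a program computed with rounding: constants are rounded and every basic operation
is correctly rounded; the variable holds the random sample itself. -/
noncomputable def ArithExpr.computed (rnd : ℝ → ℝ) : ArithExpr → ℝ → ℝ
  | .var, u => u
  | .const a, _ => rnd a
  | .add e f, u => rnd (e.computed rnd u + f.computed rnd u)
  | .sub e f, u => rnd (e.computed rnd u - f.computed rnd u)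
  | .mul e f, u => rnd (e.computed rnd u * f.computed rnd u)
  | .div e f, u => rnd (e.computed rnd u / f.computed rnd u)
  | .sqrt e, u => rnd (Real.sqrt (e.computed rnd u))
  | .abs e, u => |e.computed rnd u|

/-! ### Hat distributions -/

/-- `h` is (the density of) a hat distribution for `b_{n,p}` with rejection rate `α`: a probability
density on the line with `b_{n,p}(k) ≤ α h(x)` whenever `k = ⌊x⌋ ∈ {0, …, n}`. -/
structure IsHat (n : ℕ) (p α : ℝ) (h : ℝ → ℝ) : Prop where
  measurable : Measurable h
  nonneg : ∀ x, 0 ≤ h x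
  integral_eq_one : ∫ x, h x = 1
  dominates : ∀ k : ℕ, k ≤ n → ∀ x ∈ Set.Ico (k : ℝ) (k + 1), binomialMass n p k ≤ α * h x

/-- The inverse `H⁻¹(u)`, `-1/2 < u < 1/2`, of the cumulative distribution of `h`: the quantile
of order `u + 1/2`. -/
noncomputable def hatInverse (h : ℝ → ℝ) (u : ℝ) : ℝ :=
  sInf {x : ℝ | u + 1 / 2 ≤ ∫ y in Set.Iic x, h y}

/-- The programs `invE` and `hatE` evaluate `H⁻¹(u)` and `h⁻¹(u) = 1 / h(H⁻¹(u))`. -/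
def ComputesHat (h : ℝ → ℝ) (invE hatE : ArithExpr) : Prop :=
  ∀ u ∈ Set.Ioo (-(1 / 2) : ℝ) (1 / 2),
    invE.exact u = hatInverse h u ∧ hatE.exact u = 1 / h (hatInverse h u)

/-- `c` is a rounding constant of the pair of programs: at every precision `β`, with `ε = 2 ^ (-β)`,
the computed `H⁻¹(u)` is within `c ε max(1, |H⁻¹(u)|)` of its exact value and the computed `h⁻¹(u)`
has relative error at most `c ε`. (A purely relative bound for `H⁻¹(u)` near its zero would be
violated by hat functions used in practice.) -/
def IsRoundingConstant (invE hatE : ArithExpr) (c : ℝ) : Prop :=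
  ∀ β : ℕ, 1 ≤ β → ∀ rnd : ℝ → ℝ, IsRoundToNearest β rnd →
    ∀ u ∈ Set.Ioo (-(1 / 2) : ℝ) (1 / 2),
      |invE.computed rnd u - invE.exact u| ≤ c * (1 / 2 ^ β) * max 1 |invE.exact u| ∧
      |hatE.computed rnd u - hatE.exact u| ≤ c * (1 / 2 ^ β) * |hatE.exact u|

/-! ### The sampler -/

/-- The computed logarithm `l_v` of the rejection ratio, for the candidate `k` and the computed
value `y` of `h⁻¹(u)`:
`l_n ⊖ l_k ⊖ l_{n-k} ⊕ k ⊗ Log p ⊕ (n-k) ⊗ Log (1-p) ⊕ Log y ⊖ Log α`, from left to right. -/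
noncomputable def logRatio (β : ℕ) (rnd : ℝ → ℝ) (t : ℕ) (g : ℝ) (n : ℕ) (p α : ℝ)
    (k : ℕ) (y : ℝ) : ℝ :=
  let s₁ := flSub rnd (logFactorial β t g n) (logFactorial β t g k)
  let s₂ := flSub rnd s₁ (logFactorial β t g (n - k))
  let s₃ := flAdd rnd s₂ (flMul rnd (k : ℝ) (agmLog β p))
  let s₄ := flAdd rnd s₃ (flMul rnd ((n - k : ℕ) : ℝ) (agmLog β (1 - p)))
  let s₅ := flAdd rnd s₄ (agmLog β y)
  flSub rnd s₅ (agmLog β α)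

/-- The pairs `(u, v)` of random numbers, `u` in `[-1/2, 1/2]` and `v` in `[0, 1]`, for which one
iteration of the loop returns `k`. Candidates outside `{0, …, n}` are never returned. -/
def returnSet (β : ℕ) (rnd : ℝ → ℝ) (t : ℕ) (g : ℝ) (n : ℕ) (p α : ℝ)
    (invE hatE : ArithExpr) (k : Fin (n + 1)) : Set (ℝ × ℝ) :=
  {w | w.1 ∈ Set.Icc (-(1 / 2) : ℝ) (1 / 2) ∧ w.2 ∈ Set.Icc (0 : ℝ) 1 ∧
    ⌊invE.computed rnd w.1⌋ = ((k : ℕ) : ℤ) ∧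
    agmLog β w.2 ≤ logRatio β rnd t g n p α k (hatE.computed rnd w.1)}

/-- The probability that one iteration returns `k`, for `u` and `v` uniform and independent
(the rectangle of all `(u, v)` has area one). -/
noncomputable def returnProb (β : ℕ) (rnd : ℝ → ℝ) (t : ℕ) (g : ℝ) (n : ℕ) (p α : ℝ)
    (invE hatE : ArithExpr) (k : Fin (n + 1)) : ℝ :=
  (volume (returnSet β rnd t g n p α invE hatE k)).toReal

/-- The output distribution of `BinSamp(n, p)`: the probability that, for some `i`, the first `i`
independent iterations of the loop reject and the next one returns `k`. -/
noncomputable def binSamp (β : ℕ) (rnd : ℝ → ℝ) (t : ℕ) (g : ℝ) (n : ℕ) (p α : ℝ)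
    (invE hatE : ArithExpr) (k : Fin (n + 1)) : ℝ :=
  ∑' i : ℕ, (1 - ∑ j, returnProb β rnd t g n p α invE hatE j) ^ i *
    returnProb β rnd t g n p α invE hatE k

/-!
The estimate holds without any lower-order term, that is, with `r = 0`. Write `ε = 2 ^ (-β)`,
`w = n β ε` and `q = c ε`.

*Logarithms.* Gauss's integral `∫ dt / √((a² + t²) (b² + t²))` over the line is invariant under
`(a, b) ↦ (√(a b), (a + b) / 2)` by the substitution `t = (x - a b / x) / 2`, hence equals
`π / AGM(a, b)`. Splitting `∫ dt / √((1 + t²) (k² + t²))` at the fixed point `√k` of the inversion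
`t ↦ k / t` gives `π / (2 AGM(1, k)) = log (4 / k) + O(k² log (4 / k))` with explicit constants. So
the AGM logarithm has absolute error at most `2 β ε` on all of `(0, ∞)` (`abs_agmLog_sub_log_le`).

*One candidate.* Rounding errors propagate through the sum `l_v`, whose terms are bounded by
`O(n β)`, by `(n - k) (-log (1 - p))`, or by the logarithm of the hat density. The computed ratio is
therefore the exact one up to factors `1 ± q` and `exp (± E)`, where `E` is
`210 w + 3.22 ζ + 125 ε (n - k) (-log (1 - p))` plus `125 ε log⁺ h` (`abs_logRatio_sub_le`).

*One iteration.* The quantile function transports the uniform distribution to the hat distribution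
(`IsHat.map_quantile`), so the probability of returning `k` is the integral of the acceptance ratio
against `h`. There `h` cancels, leaving `b_{n,p}(k) / α` times the length of an interval that differs
from `[k, k + 1)` by `O(q max(1, k))` at its ends; the factor `h ^ (125 ε)` costs only `125 ε`, since
`h` has integral one (`returnProb_le`, `le_returnProb`).

*All candidates.* The output distribution consists of the return probabilities, normalized by their
sum. By `statDist_normalize_le` its distance from `b_{n,p}` is at most the larger of the total gain
and the total loss of the weights. Averaging with `∑ k b_{n,p}(k) = n p` turns the widths `q k` into
`q n p`, and the terms in `log (1 - p)` are harmless because `z ^ (1 - η) ≤ z + η (1 - z)` and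
`-z log z ≤ 1` for `z = 1 - p`. A single trial does not leave enough room for the terms in `q` alone
and is settled by comparing its two outcomes (`single_trial_zero_excess`,
`single_trial_one_excess`).

The bound may be assumed to be below one, which makes `β ≥ 14` and all error terms small. It must also
dominate `log α`, and this uses that `c` cannot be small: the quantile function takes the value
`1 + ε`, the midpoint of two adjacent machine numbers, so `c ≥ 2 / 3`
(`two_thirds_le_roundingConstant`).
-/

/-! ### Gauss's elliptic integral and the arithmetic-geometric mean -/

/-- The integrand `1 / √((a² + t²) (b² + t²))` of Gauss's elliptic integral. -/
noncomputable def gaussKernel (a b t : ℝ) : ℝ := (√((a ^ 2 + t ^ 2) * (b ^ 2 + t ^ 2)))⁻¹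

/-- Gauss's elliptic integral over the whole line. -/
noncomputable def gaussIntegral (a b : ℝ) : ℝ := ∫ t, gaussKernel a b t

lemma gaussKernel_nonneg (a b t : ℝ) : 0 ≤ gaussKernel a b t := by
  unfold gaussKernel; positivity

lemma gaussKernel_abs (a b t : ℝ) : gaussKernel a b |t| = gaussKernel a b t := by
  simp [gaussKernel]

lemma gaussKernel_le {a b m : ℝ} (hm : 0 < m) (ha : m ≤ a) (hb : m ≤ b) (t : ℝ) :
    gaussKernel a b t ≤ (m ^ 2 + t ^ 2)⁻¹ := by
  unfold gaussKernel
  have h0 : 0 < m ^ 2 + t ^ 2 := by positivity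
  refine inv_anti₀ h0 (Real.le_sqrt_of_sq_le ?_)
  rw [sq (m ^ 2 + t ^ 2)]
  gcongr

lemma le_gaussKernel {a b m : ℝ} (ha0 : 0 < a) (hb0 : 0 < b) (ha : a ≤ m) (hb : b ≤ m) (t : ℝ) :
    (m ^ 2 + t ^ 2)⁻¹ ≤ gaussKernel a b t := by
  unfold gaussKernel
  have h0 : 0 < (a ^ 2 + t ^ 2) * (b ^ 2 + t ^ 2) := by positivity
  refine inv_anti₀ (Real.sqrt_pos.2 h0) ?_
  rw [Real.sqrt_le_left (by positivity), sq (m ^ 2 + t ^ 2)]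
  gcongr

lemma continuous_gaussKernel {a b : ℝ} (ha : 0 < a) (hb : 0 < b) :
    Continuous (gaussKernel a b) := by
  unfold gaussKernel
  refine Continuous.inv₀ (by fun_prop) fun t => ?_
  positivity

lemma inv_sq_add_sq_eq {m : ℝ} (hm : 0 < m) (t : ℝ) :
    (m ^ 2 + t ^ 2)⁻¹ = (m ^ 2)⁻¹ * (1 + (m⁻¹ * t) ^ 2)⁻¹ := by
  field_simp

lemma integrable_inv_sq_add_sq {m : ℝ} (hm : 0 < m) :
    Integrable fun t : ℝ => (m ^ 2 + t ^ 2)⁻¹ := by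
  simp_rw [inv_sq_add_sq_eq hm]
  exact (integrable_inv_one_add_sq.comp_mul_left' (inv_ne_zero hm.ne')).const_mul _

lemma integral_inv_sq_add_sq_of_pos {m : ℝ} (hm : 0 < m) :
    ∫ t : ℝ, (m ^ 2 + t ^ 2)⁻¹ = Real.pi / m := by
  simp_rw [inv_sq_add_sq_eq hm]
  rw [integral_const_mul, Measure.integral_comp_mul_left (fun t => (1 + t ^ 2)⁻¹) m⁻¹,
    integral_univ_inv_one_add_sq, inv_inv, abs_of_pos hm, smul_eq_mul]
  field_simp

lemma integrable_gaussKernel {a b : ℝ} (ha : 0 < a) (hb : 0 < b) :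
    Integrable (gaussKernel a b) := by
  refine (integrable_inv_sq_add_sq (lt_min ha hb)).mono'
    (continuous_gaussKernel ha hb).aestronglyMeasurable (Eventually.of_forall fun t => ?_)
  rw [Real.norm_of_nonneg (gaussKernel_nonneg a b t)]
  exact gaussKernel_le (lt_min ha hb) (min_le_left _ _) (min_le_right _ _) t

lemma gaussIntegral_le {a b m : ℝ} (hm : 0 < m) (ha : m ≤ a) (hb : m ≤ b) :
    gaussIntegral a b ≤ Real.pi / m := by
  rw [← integral_inv_sq_add_sq_of_pos hm]
  exact integral_mono (integrable_gaussKernel (hm.trans_le ha) (hm.trans_le hb))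
    (integrable_inv_sq_add_sq hm) (gaussKernel_le hm ha hb)

lemma le_gaussIntegral {a b m : ℝ} (ha0 : 0 < a) (hb0 : 0 < b) (ha : a ≤ m) (hb : b ≤ m) :
    Real.pi / m ≤ gaussIntegral a b := by
  rw [← integral_inv_sq_add_sq_of_pos (ha0.trans_le ha)]
  exact integral_mono (integrable_inv_sq_add_sq (ha0.trans_le ha)) (integrable_gaussKernel ha0 hb0)
    (le_gaussKernel ha0 hb0 ha hb)

lemma gaussIntegral_eq_two_mul (a b : ℝ) :
    gaussIntegral a b = 2 * ∫ t in Set.Ioi 0, gaussKernel a b t := by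
  rw [gaussIntegral, ← integral_comp_abs]
  simp_rw [gaussKernel_abs]

/-- The substitution behind Gauss's invariance maps the positive half-line onto the line. -/
lemma image_gauss_substitution {a b : ℝ} (ha : 0 < a) (hb : 0 < b) :
    (fun x : ℝ => (x - a * b / x) / 2) '' Set.Ioi 0 = Set.univ := by
  refine Set.eq_univ_of_forall fun t => ?_
  have hab : 0 < a * b := mul_pos ha hb
  have h1 : |t| < √(t ^ 2 + a * b) := by
    rw [← Real.sqrt_sq_eq_abs]; exact Real.sqrt_lt_sqrt (sq_nonneg _) (by linarith)
  have h2 : 0 < t + √(t ^ 2 + a * b) := by linarith [neg_abs_le t]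
  refine ⟨t + √(t ^ 2 + a * b), h2, ?_⟩
  have h3 : √(t ^ 2 + a * b) ^ 2 = t ^ 2 + a * b := Real.sq_sqrt (by positivity)
  simp only
  field_simp
  nlinarith

lemma injOn_gauss_substitution {a b : ℝ} (ha : 0 < a) (hb : 0 < b) :
    Set.InjOn (fun x : ℝ => (x - a * b / x) / 2) (Set.Ioi 0) := by
  intro x hx y hy hxy
  simp only [Set.mem_Ioi] at hx hy
  have hab : 0 < a * b := mul_pos ha hb
  simp only at hxy
  field_simp at hxy
  have : (x - y) * (x * y + a * b) = 0 := by linarith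
  rcases mul_eq_zero.1 this with h | h
  · linarith
  · nlinarith [mul_pos hx hy]

/-- Gauss's invariance of the elliptic integral under one step of the arithmetic-geometric mean. -/
lemma gaussIntegral_am_gm {a b : ℝ} (ha : 0 < a) (hb : 0 < b) :
    gaussIntegral (√(a * b)) ((a + b) / 2) = gaussIntegral a b := by
  have hab : 0 < a * b := mul_pos ha hb
  rw [gaussIntegral_eq_two_mul a b]
  have hd : ∀ x ∈ Set.Ioi (0 : ℝ), HasDerivWithinAt (fun x : ℝ => (x - a * b / x) / 2)
      ((1 + a * b / x ^ 2) / 2) (Set.Ioi 0) x := by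
    intro x hx
    have hx' : x ≠ 0 := ne_of_gt hx
    have h1 : HasDerivAt (fun x : ℝ => (x - a * b / x) / 2)
        ((1 - (0 * x - a * b * 1) / x ^ 2) / 2) x :=
      ((hasDerivAt_id' x).sub
        ((hasDerivAt_const x (a * b)).div (hasDerivAt_id' x) hx')).div_const 2
    have h2 : (1 - (0 * x - a * b * 1) / x ^ 2) / 2 = (1 + a * b / x ^ 2) / 2 := by ring
    rw [h2] at h1
    exact h1.hasDerivWithinAt
  have key := integral_image_eq_integral_abs_deriv_smul measurableSet_Ioi hd
    (injOn_gauss_substitution ha hb) (gaussKernel (√(a * b)) ((a + b) / 2))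
  rw [image_gauss_substitution ha hb, setIntegral_univ] at key
  rw [gaussIntegral, key, ← integral_const_mul]
  refine setIntegral_congr_fun measurableSet_Ioi fun x hx => ?_
  have hx' : (0 : ℝ) < x := hx
  -- with `t = (x - a b / x) / 2` both factors `a b + t²` and `((a + b) / 2)² + t²` simplify
  have e1 : (√(a * b) ^ 2 + ((x - a * b / x) / 2) ^ 2) *
      (((a + b) / 2) ^ 2 + ((x - a * b / x) / 2) ^ 2) =
      ((x ^ 2 + a * b) / (4 * x ^ 2)) ^ 2 * ((a ^ 2 + x ^ 2) * (b ^ 2 + x ^ 2)) := by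
    rw [Real.sq_sqrt hab.le]
    field_simp
    ring
  simp only [gaussKernel, smul_eq_mul]
  rw [e1, Real.sqrt_mul (by positivity), Real.sqrt_sq (by positivity),
    abs_of_pos (by positivity)]
  have : 0 < √((a ^ 2 + x ^ 2) * (b ^ 2 + x ^ 2)) := by positivity
  field_simp
  ring

/-- Every step of the arithmetic-geometric mean preserves the elliptic integral. Both sequences
start with the means of `x` and `y`. -/
lemma gaussIntegral_agmSequences {x y : NNReal} (hx : 0 < x) (hy : 0 < y) (n : ℕ) :
    0 < (NNReal.agmSequences x y n).1 ∧ 0 < (NNReal.agmSequences x y n).2 ∧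
    gaussIntegral (NNReal.agmSequences x y n).1 (NNReal.agmSequences x y n).2 =
      gaussIntegral x y := by
  induction n with
  | zero =>
    refine ⟨?_, ?_, ?_⟩
    · simp only [NNReal.agmSequences_zero]; exact NNReal.sqrt_pos.2 (mul_pos hx hy)
    · simp only [NNReal.agmSequences_zero]; positivity
    · have := gaussIntegral_am_gm (a := x) (b := y) (by exact_mod_cast hx) (by exact_mod_cast hy)
      simpa [NNReal.agmSequences_zero] using this
  | succ n ih =>
    obtain ⟨h1, h2, h3⟩ := ih
    rw [NNReal.agmSequences_succ']
    have h4 := gaussIntegral_am_gm (a := (NNReal.agmSequences x y n).1)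
      (b := (NNReal.agmSequences x y n).2) (by exact_mod_cast h1) (by exact_mod_cast h2)
    refine ⟨NNReal.sqrt_pos.2 (mul_pos h1 h2), by positivity, ?_⟩
    rw [← h3, ← h4]
    simp

/-- Gauss: the elliptic integral is `π` divided by the arithmetic-geometric mean. -/
theorem gaussIntegral_eq_pi_div_agm {x y : NNReal} (hx : 0 < x) (hy : 0 < y) :
    gaussIntegral x y = Real.pi / NNReal.agm x y := by
  have hM : (0 : ℝ) < NNReal.agm x y := by exact_mod_cast NNReal.agm_pos hx hy
  have t1 : Tendsto (fun n => Real.pi / ((NNReal.agmSequences x y n).1 : ℝ)) atTop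
      (nhds (Real.pi / NNReal.agm x y)) :=
    tendsto_const_nhds.div (NNReal.tendsto_coe.2 NNReal.tendsto_agmSequences_fst_agm) hM.ne'
  have t2 : Tendsto (fun n => Real.pi / ((NNReal.agmSequences x y n).2 : ℝ)) atTop
      (nhds (Real.pi / NNReal.agm x y)) :=
    tendsto_const_nhds.div (NNReal.tendsto_coe.2 NNReal.tendsto_agmSequences_snd_agm) hM.ne'
  -- the integral is squeezed between `π / b` and `π / a` for the means `a ≤ b` of every step
  refine le_antisymm (ge_of_tendsto' t1 fun n => ?_) (le_of_tendsto' t2 fun n => ?_)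
  · obtain ⟨h1, h2, h3⟩ := gaussIntegral_agmSequences hx hy n
    rw [← h3]
    exact gaussIntegral_le (by exact_mod_cast h1) le_rfl
      (by exact_mod_cast NNReal.agmSequences_fst_le_snd n n)
  · obtain ⟨h1, h2, h3⟩ := gaussIntegral_agmSequences hx hy n
    rw [← h3]
    exact le_gaussIntegral (by exact_mod_cast h1) (by exact_mod_cast h2)
      (by exact_mod_cast NNReal.agmSequences_fst_le_snd n n) le_rfl

/-! ### Accuracy of the AGM logarithm -/

lemma gaussKernel_one_eq_mul (k t : ℝ) :
    gaussKernel 1 k t = (√(1 + t ^ 2))⁻¹ * (√(k ^ 2 + t ^ 2))⁻¹ := by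
  rw [gaussKernel, one_pow, Real.sqrt_mul (by positivity), mul_inv]

lemma image_const_div_Ioo {k : ℝ} (hk : 0 < k) :
    (fun t : ℝ => k / t) '' Set.Ioo 0 (√k) = Set.Ioi (√k) := by
  have hs : 0 < √k := Real.sqrt_pos.2 hk
  have hss : √k * √k = k := Real.mul_self_sqrt hk.le
  ext y
  constructor
  · rintro ⟨t, ⟨h0, h1⟩, rfl⟩
    change √k < k / t
    rw [lt_div_iff₀ h0]
    nlinarith
  · intro hy
    have hy' : √k < y := hy
    have hy0 : 0 < y := hs.trans hy'
    refine ⟨k / y, ⟨by positivity, ?_⟩, by field_simp⟩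
    rw [div_lt_iff₀ hy0]
    nlinarith

/-- The inversion `t ↦ k / t` preserves Gauss's kernel, so both sides of `√k` contribute equally. -/
lemma setIntegral_gaussKernel_Ioi_sqrt {k : ℝ} (hk : 0 < k) :
    ∫ t in Set.Ioi (√k), gaussKernel 1 k t = ∫ t in Set.Ioo 0 (√k), gaussKernel 1 k t := by
  have hd : ∀ t ∈ Set.Ioo 0 (√k), HasDerivWithinAt (fun t : ℝ => k / t)
      (-(k / t ^ 2)) (Set.Ioo 0 (√k)) t := by
    intro t ht
    have h1 : HasDerivAt (fun t : ℝ => k / t) ((0 * t - k * 1) / t ^ 2) t :=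
      (hasDerivAt_const t k).div (hasDerivAt_id' t) ht.1.ne'
    have h2 : (0 * t - k * 1) / t ^ 2 = -(k / t ^ 2) := by ring
    rw [h2] at h1
    exact h1.hasDerivWithinAt
  have hinj : Set.InjOn (fun t : ℝ => k / t) (Set.Ioo 0 (√k)) := by
    intro x hx y hy hxy
    have hx0 := hx.1
    have hy0 := hy.1
    simp only at hxy
    field_simp at hxy
    exact hxy.symm
  have key := integral_image_eq_integral_abs_deriv_smul measurableSet_Ioo hd hinj (gaussKernel 1 k)
  rw [image_const_div_Ioo hk] at key
  rw [key]
  refine setIntegral_congr_fun measurableSet_Ioo fun t ht => ?_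
  have ht0 : 0 < t := ht.1
  have e1 : ((1 : ℝ) ^ 2 + (k / t) ^ 2) * (k ^ 2 + (k / t) ^ 2) =
      (k / t ^ 2) ^ 2 * ((1 ^ 2 + t ^ 2) * (k ^ 2 + t ^ 2)) := by
    field_simp
    ring
  simp only [gaussKernel, smul_eq_mul]
  rw [e1, Real.sqrt_mul (by positivity), Real.sqrt_sq (by positivity), abs_neg,
    abs_of_pos (by positivity)]
  have : 0 < √((1 ^ 2 + t ^ 2) * (k ^ 2 + t ^ 2)) := by positivity
  field_simp

lemma gaussIntegral_one_eq {k : ℝ} (hk : 0 < k) :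
    gaussIntegral 1 k = 4 * ∫ t in (0 : ℝ)..√k, gaussKernel 1 k t := by
  have hi := integrable_gaussKernel one_pos hk
  rw [gaussIntegral_eq_two_mul, ← Set.Ioc_union_Ioi_eq_Ioi (Real.sqrt_nonneg k),
    setIntegral_union (Set.Ioc_disjoint_Ioi le_rfl) measurableSet_Ioi hi.integrableOn
      hi.integrableOn, setIntegral_gaussKernel_Ioi_sqrt hk, ← integral_Ioc_eq_integral_Ioo,
    intervalIntegral.integral_of_le (Real.sqrt_nonneg k)]
  ring

/-- Together with `inv_sqrt_le_quartic`, a polynomial enclosure of `1 / √(1 + t²)`, which makes the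
integral of Gauss's kernel over `[0, √k]` elementary. -/
lemma one_sub_half_sq_le_inv_sqrt (t : ℝ) : 1 - t ^ 2 / 2 ≤ (√(1 + t ^ 2))⁻¹ := by
  have h1 : √(1 + t ^ 2) ≤ 1 + t ^ 2 / 2 := by
    rw [Real.sqrt_le_left (by positivity)]; nlinarith [sq_nonneg (t ^ 2)]
  have h2 : 0 < √(1 + t ^ 2) := by positivity
  refine le_trans ?_ (inv_anti₀ h2 h1)
  rw [← one_div, le_div_iff₀ (by positivity)]
  nlinarith [sq_nonneg (t ^ 2)]

lemma inv_sqrt_le_quartic (t : ℝ) :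
    (√(1 + t ^ 2))⁻¹ ≤ 1 - t ^ 2 / 2 + 3 * t ^ 4 / 8 := by
  have h2 : 0 < √(1 + t ^ 2) := by positivity
  have hp : 0 < 1 - t ^ 2 / 2 + 3 * t ^ 4 / 8 := by nlinarith [sq_nonneg (t ^ 2 - 1)]
  rw [inv_le_comm₀ h2 hp]
  apply Real.le_sqrt_of_sq_le
  rw [← one_div, div_pow, one_pow, div_le_iff₀ (by positivity)]
  obtain ⟨x, hx⟩ : ∃ x, x = t ^ 2 := ⟨_, rfl⟩
  have hx0 : 0 ≤ x := by rw [hx]; positivity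
  have h4 : t ^ 4 = x ^ 2 := by rw [hx]; ring
  rw [h4, ← hx]
  have : (1 + x) * (1 - x / 2 + 3 * x ^ 2 / 8) ^ 2 - 1
      = x ^ 3 * (40 - 15 * x + 9 * x ^ 2) / 64 := by ring
  have h5 : 0 ≤ x ^ 3 * (40 - 15 * x + 9 * x ^ 2) / 64 := by
    have : 0 ≤ 40 - 15 * x + 9 * x ^ 2 := by nlinarith [sq_nonneg (x - 1)]
    positivity
  linarith

/-- Antiderivative of `(1 - t² / 2) / √(k² + t²)`. -/
lemma hasDerivAt_arsinh_primitive {k : ℝ} (hk : 0 < k) (t : ℝ) :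
    HasDerivAt (fun t => (1 + k ^ 2 / 4) * Real.arsinh (t / k) - t * √(k ^ 2 + t ^ 2) / 4)
      ((1 - t ^ 2 / 2) * (√(k ^ 2 + t ^ 2))⁻¹) t := by
  have h0 : 0 < k ^ 2 + t ^ 2 := by positivity
  have h1 : HasDerivAt (fun t => Real.arsinh (t / k)) ((√(1 + (t / k) ^ 2))⁻¹ • (1 / k)) t :=
    ((hasDerivAt_id' t).div_const k).arsinh
  have h2 : HasDerivAt (fun t => √(k ^ 2 + t ^ 2)) ((2 * t) / (2 * √(k ^ 2 + t ^ 2))) t := by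
    have : HasDerivAt (fun t : ℝ => k ^ 2 + t ^ 2) (2 * t) t := by
      simpa using (hasDerivAt_pow 2 t).const_add (k ^ 2)
    exact this.sqrt h0.ne'
  have h3 := (h1.const_mul (1 + k ^ 2 / 4)).sub (((hasDerivAt_id' t).mul h2).div_const 4)
  have e1 : √(1 + (t / k) ^ 2) = √(k ^ 2 + t ^ 2) / k := by
    have : 1 + (t / k) ^ 2 = (k ^ 2 + t ^ 2) / k ^ 2 := by field_simp
    rw [this, Real.sqrt_div h0.le, Real.sqrt_sq hk.le]
  refine h3.congr_deriv ?_
  rw [e1, smul_eq_mul]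
  have hs : 0 < √(k ^ 2 + t ^ 2) := Real.sqrt_pos.2 h0
  have hss : √(k ^ 2 + t ^ 2) ^ 2 = k ^ 2 + t ^ 2 := Real.sq_sqrt h0.le
  field_simp
  rw [hss]
  ring

lemma gaussKernel_integral_bounds {k : ℝ} (hk : 0 < k) :
    (1 + k ^ 2 / 4) * Real.arsinh (√k / k) - √k * √(k ^ 2 + √k ^ 2) / 4
        ≤ ∫ t in (0 : ℝ)..√k, gaussKernel 1 k t ∧
    ∫ t in (0 : ℝ)..√k, gaussKernel 1 k t ≤
      (1 + k ^ 2 / 4) * Real.arsinh (√k / k) - √k * √(k ^ 2 + √k ^ 2) / 4 + 3 * k ^ 2 / 32 := by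
  have hs : 0 ≤ √k := Real.sqrt_nonneg k
  have hcont : Continuous fun t : ℝ => (1 - t ^ 2 / 2) * (√(k ^ 2 + t ^ 2))⁻¹ := by
    refine Continuous.mul (by fun_prop) (Continuous.inv₀ (by fun_prop) fun t => ?_)
    positivity
  have hcont2 : Continuous fun t : ℝ => (1 - t ^ 2 / 2) * (√(k ^ 2 + t ^ 2))⁻¹ + 3 * t ^ 3 / 8 :=
    hcont.add (by fun_prop)
  have hk1 := (continuous_gaussKernel one_pos hk).intervalIntegrable (μ := volume) 0 (√k)
  have I1 := intervalIntegral.integral_eq_sub_of_hasDerivAt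
    (fun t _ => hasDerivAt_arsinh_primitive hk t) (hcont.intervalIntegrable 0 (√k))
  have hd2 : ∀ t : ℝ, HasDerivAt (fun t => (1 + k ^ 2 / 4) * Real.arsinh (t / k)
      - t * √(k ^ 2 + t ^ 2) / 4 + 3 * t ^ 4 / 32)
      ((1 - t ^ 2 / 2) * (√(k ^ 2 + t ^ 2))⁻¹ + 3 * t ^ 3 / 8) t := by
    intro t
    have h4 : HasDerivAt (fun t : ℝ => 3 * t ^ 4 / 32) (3 * t ^ 3 / 8) t := by
      have := ((hasDerivAt_pow 4 t).const_mul 3).div_const 32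
      refine this.congr_deriv ?_
      push_cast
      ring
    exact (hasDerivAt_arsinh_primitive hk t).add h4
  have I2 := intervalIntegral.integral_eq_sub_of_hasDerivAt
    (fun t _ => hd2 t) (hcont2.intervalIntegrable 0 (√k))
  constructor
  · have := intervalIntegral.integral_mono_on hs (hcont.intervalIntegrable 0 (√k)) hk1
      (fun t _ => by
        rw [gaussKernel_one_eq_mul]
        exact mul_le_mul_of_nonneg_right (one_sub_half_sq_le_inv_sqrt t) (by positivity))
    rw [I1] at this
    simpa using this
  · have := intervalIntegral.integral_mono_on hs hk1 (hcont2.intervalIntegrable 0 (√k))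
      (fun t ht => by
        rw [gaussKernel_one_eq_mul]
        have ht0 : 0 ≤ t := ht.1
        have h0 : 0 < √(k ^ 2 + t ^ 2) := by positivity
        have h1 : t ≤ √(k ^ 2 + t ^ 2) := Real.le_sqrt_of_sq_le (by nlinarith [sq_nonneg k])
        refine (mul_le_mul_of_nonneg_right (inv_sqrt_le_quartic t) (by positivity)).trans ?_
        rw [add_mul]
        gcongr
        rw [← div_eq_mul_inv, div_le_iff₀ h0]
        nlinarith [pow_nonneg ht0 3, mul_le_mul_of_nonneg_left h1 (pow_nonneg ht0 3)])
    rw [I2] at this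
    have h4 : √k ^ 4 = k ^ 2 := by
      rw [show √k ^ 4 = (√k ^ 2) ^ 2 by ring, Real.sq_sqrt hk.le]
    simpa [h4] using this

/-- The asymptotic expansion `π / (2 AGM(1, k)) = log (4 / k) + O(k² log (4 / k))`. -/
theorem abs_pi_div_agm_sub_log_le {k : ℝ} (hk : 0 < k) (hk1 : k ≤ 1) :
    |Real.pi / (2 * (NNReal.agm 1 (Real.toNNReal k) : ℝ)) - Real.log (4 / k)|
      ≤ k ^ 2 * (Real.log (4 / k) / 4 + 1 / 2) := by
  have hsk : 0 < √k := Real.sqrt_pos.2 hk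
  have hsk2 : √k ^ 2 = k := Real.sq_sqrt hk.le
  have e0 : Real.pi / (2 * (NNReal.agm 1 (Real.toNNReal k) : ℝ)) =
      2 * ∫ t in (0 : ℝ)..√k, gaussKernel 1 k t := by
    have h1 := gaussIntegral_eq_pi_div_agm (x := 1) (y := Real.toNNReal k) one_pos
      (Real.toNNReal_pos.2 hk)
    rw [Real.coe_toNNReal k hk.le, NNReal.coe_one, gaussIntegral_one_eq hk] at h1
    rw [mul_comm 2, ← div_div, ← h1]
    ring
  obtain ⟨hl, hu⟩ := gaussKernel_integral_bounds hk
  rw [e0]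
  set J := ∫ t in (0 : ℝ)..√k, gaussKernel 1 k t
  -- `arsinh (1 / √k) = log (4 / k) / 2 + log ((1 + r) / 2)`, and the second term cancels `k r / 4`
  -- up to `O(k²)`
  obtain ⟨r, hr⟩ : ∃ r, r = √(1 + k) := ⟨_, rfl⟩
  have hr2 : r ^ 2 = 1 + k := by rw [hr]; exact Real.sq_sqrt (by positivity)
  have hr1 : 1 ≤ r := by rw [hr]; exact Real.one_le_sqrt.2 (by linarith)
  have e1 : √k * √(k ^ 2 + √k ^ 2) = k * r := by
    have : k ^ 2 + √k ^ 2 = k * (1 + k) := by rw [hsk2]; ring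
    rw [this, Real.sqrt_mul hk.le, ← hr, ← mul_assoc, Real.mul_self_sqrt hk.le]
  have e2 : Real.arsinh (√k / k) = Real.log (4 / k) / 2 + Real.log ((1 + r) / 2) := by
    have h1 : √k / k = 1 / √k := by
      rw [div_eq_div_iff hk.ne' hsk.ne', ← sq, hsk2]; ring
    have h2 : √(1 + (1 / √k) ^ 2) = r / √k := by
      rw [div_pow, hsk2, one_pow, show 1 + 1 / k = (1 + k) / k by field_simp; ring, Real.sqrt_div
        (by positivity), ← hr]
    rw [h1, Real.arsinh, h2, ← add_div, Real.log_div (by positivity) hsk.ne',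
      Real.log_sqrt hk.le, Real.log_div (by norm_num) hk.ne',
      Real.log_div (by positivity) (by norm_num),
      show (4 : ℝ) = 2 ^ 2 by norm_num, Real.log_pow]
    push_cast
    ring
  rw [e1, e2] at hl hu
  set ℓ := Real.log ((1 + r) / 2)
  have hℓ1 : ℓ ≤ (r - 1) / 2 := by
    have := Real.log_le_sub_one_of_pos (x := (1 + r) / 2) (by positivity)
    linarith
  have hℓ2 : (r - 1) / (r + 1) ≤ ℓ := by
    have := Real.one_sub_inv_le_log_of_pos (x := (1 + r) / 2) (by positivity)
    refine le_trans (le_of_eq ?_) this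
    field_simp
    ring
  have hk' : k = r ^ 2 - 1 := by linarith
  have hℓ0 : 0 ≤ ℓ := le_trans (div_nonneg (by linarith) (by linarith)) hℓ2
  have hlow : -(k ^ 2 / 2) ≤ 2 * ℓ - k * r / 2 := by
    have h1 : -(k ^ 2 / 2) ≤ 2 * ((r - 1) / (r + 1)) - k * r / 2 := by
      rw [hk']
      have h3 : 2 * ((r - 1) / (r + 1)) - (r ^ 2 - 1) * r / 2 + (r ^ 2 - 1) ^ 2 / 2
          = (r - 1) ^ 3 * (r ^ 2 + 3 * r + 3) / (2 * (r + 1)) := by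
        field_simp
        ring
      have h4 : 0 ≤ (r - 1) ^ 3 * (r ^ 2 + 3 * r + 3) / (2 * (r + 1)) := by
        have : 0 ≤ r - 1 := by linarith
        positivity
      linarith
    linarith
  have hup : 2 * ℓ - k * r / 2 ≤ 0 := by
    rw [hk']; nlinarith [mul_nonneg (sub_nonneg.2 hr1) (sub_nonneg.2 hr1)]
  have hℓ3 : ℓ ≤ 1 / 4 := by nlinarith
  have hk2 : 0 ≤ k ^ 2 := sq_nonneg k
  have hmul : k ^ 2 * ℓ ≤ k ^ 2 * (1 / 4) := mul_le_mul_of_nonneg_left hℓ3 hk2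
  have hmul0 : 0 ≤ k ^ 2 * ℓ := mul_nonneg hk2 hℓ0
  have hlog : 0 ≤ k ^ 2 * Real.log (4 / k) := mul_nonneg hk2 (Real.log_nonneg (by
    rw [le_div_iff₀ hk]; linarith))
  rw [abs_le]
  constructor <;> nlinarith

/-- The AGM logarithm at precision `β` has absolute error at most `2 β ε` on all of `(0, ∞)`: here
`s ≥ 2 ^ ((β + 1) / 2)`, so the modulus `k = 4 / s` satisfies `k² ≤ 8 ε`. -/
theorem abs_agmLog_sub_log_le {β : ℕ} (hβ : 6 ≤ β) {x : ℝ} (hx : 0 < x) :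
    |agmLog β x - Real.log x| ≤ 2 * β * (1 / 2 ^ β) := by
  obtain ⟨M, hM⟩ : ∃ M : ℤ, M = ⌈((β : ℝ) + 3) / 2⌉ := ⟨_, rfl⟩
  have hM1 : ((β : ℝ) + 3) / 2 ≤ M := by rw [hM]; exact Int.le_ceil _
  have hM2 : (M : ℝ) ≤ ((β : ℝ) + 5) / 2 := by
    rw [hM]; have := Int.ceil_lt_add_one (((β : ℝ) + 3) / 2); linarith
  have hMβ : (β : ℤ) + 3 ≤ 2 * M := by
    have : (β : ℝ) + 3 ≤ 2 * M := by linarith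
    exact_mod_cast this
  have hdef : agmLog β x = Real.pi / (2 * (NNReal.agm 1 (Real.toNNReal
      (4 / (x * (2 : ℝ) ^ (M - binExponent x)))) : ℝ)) - (M - binExponent x : ℤ) * Real.log 2 := by
    rw [hM]; rfl
  rw [hdef]
  set m := M - binExponent x with hm
  set s := x * (2 : ℝ) ^ m with hs
  have h1 : (2 : ℝ) ^ (Int.log 2 x) ≤ x := by
    simpa using Int.zpow_log_le_self (b := 2) (by norm_num) hx
  have h2 : x < (2 : ℝ) ^ (Int.log 2 x + 1) := by
    simpa using Int.lt_zpow_succ_log_self (b := 2) (by norm_num) x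
  have hp : (0 : ℝ) < 2 ^ m := by positivity
  have hs1 : (2 : ℝ) ^ (M - 1) ≤ s := by
    have : (2 : ℝ) ^ (M - 1) = 2 ^ (Int.log 2 x) * 2 ^ m := by
      rw [← zpow_add₀ (by norm_num), hm, binExponent]; congr 1; ring
    rw [this]; exact mul_le_mul_of_nonneg_right h1 hp.le
  have hs2 : s ≤ (2 : ℝ) ^ M := by
    have : (2 : ℝ) ^ M = 2 ^ (Int.log 2 x + 1) * 2 ^ m := by
      rw [← zpow_add₀ (by norm_num), hm, binExponent]; congr 1; ring
    rw [this]; exact mul_le_mul_of_nonneg_right h2.le hp.le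
  have hs0 : 0 < s := by positivity
  have hM5 : 5 ≤ M := by omega
  have hs4 : 4 ≤ s := by
    refine le_trans ?_ hs1
    calc (4 : ℝ) = 2 ^ (2 : ℤ) := by norm_num
      _ ≤ 2 ^ (M - 1) := zpow_le_zpow_right₀ (by norm_num) (by omega)
  have hsq : (2 : ℝ) ^ (β + 1) ≤ s ^ 2 := by
    calc (2 : ℝ) ^ (β + 1) = 2 ^ ((β + 1 : ℕ) : ℤ) := by rw [zpow_natCast]
      _ ≤ 2 ^ ((M - 1) + (M - 1)) := zpow_le_zpow_right₀ (by norm_num) (by push_cast; omega)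
      _ = (2 ^ (M - 1)) ^ 2 := by rw [zpow_add₀ (by norm_num)]; ring
      _ ≤ s ^ 2 := by gcongr
  have hlogs : Real.log s ≤ M * Real.log 2 := by
    rw [← Real.log_zpow]; exact Real.log_le_log hs0 hs2
  have hlogx : Real.log x = Real.log s - m * Real.log 2 := by
    rw [hs, Real.log_mul hx.ne' hp.ne', Real.log_zpow]; ring
  have hk0 : 0 < 4 / s := by positivity
  have hmain := abs_pi_div_agm_sub_log_le hk0 ((div_le_one hs0).2 hs4)
  rw [show 4 / (4 / s) = s by field_simp] at hmain
  rw [hlogx]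
  rw [show ∀ a b c : ℝ, a - b - (c - b) = a - c by intros; ring]
  refine hmain.trans ?_
  have hlog2 := Real.log_two_lt_d9
  have hlog2' := Real.log_two_gt_d9
  have hβ' : (6 : ℝ) ≤ β := by exact_mod_cast hβ
  have hlogs2 : Real.log s ≤ ((β : ℝ) + 5) / 2 * 0.694 :=
    hlogs.trans (mul_le_mul hM2 (by linarith) (by linarith) (by linarith))
  have hinv : (4 / s) ^ 2 ≤ 16 * (1 / 2 ^ (β + 1)) := by
    rw [div_pow, div_eq_mul_one_div]
    norm_num only
    gcongr
  calc (4 / s) ^ 2 * (Real.log s / 4 + 1 / 2)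
      ≤ 16 * (1 / 2 ^ (β + 1)) * (((β : ℝ) + 5) / 2 * 0.694 / 4 + 1 / 2) := by
        have : 0 ≤ Real.log s := Real.log_nonneg (by linarith)
        gcongr
    _ = (8 * (((β : ℝ) + 5) / 2 * 0.694 / 4 + 1 / 2)) * (1 / 2 ^ β) := by
        rw [pow_succ]; field_simp; ring
    _ ≤ 2 * β * (1 / 2 ^ β) := by
        refine mul_le_mul_of_nonneg_right ?_ (by positivity)
        linarith

/-! ### Rounding to nearest -/

lemma zero_mem_machineNumbers (β : ℕ) : (0 : ℝ) ∈ machineNumbers β := Or.inl rfl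

lemma neg_mem_machineNumbers {β : ℕ} {x : ℝ} (hx : x ∈ machineNumbers β) :
    -x ∈ machineNumbers β := by
  rcases hx with rfl | ⟨m, e, h1, h2, rfl⟩
  · left; simp
  · exact Or.inr ⟨-m, e, by rwa [abs_neg], by rwa [abs_neg], by push_cast; ring⟩

lemma abs_mem_machineNumbers {β : ℕ} {x : ℝ} (hx : x ∈ machineNumbers β) :
    |x| ∈ machineNumbers β := by
  rcases abs_choice x with h | h <;> rw [h]
  · exact hx
  · exact neg_mem_machineNumbers hx

/-- Every positive real has a machine number within relative distance `2 ^ (-β)`. -/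
lemma exists_machineNumber_near_of_pos {β : ℕ} (hβ : 1 ≤ β) {x : ℝ} (hx : 0 < x) :
    ∃ y ∈ machineNumbers β, |y - x| ≤ 1 / 2 ^ β * |x| := by
  have h1 : (2 : ℝ) ^ (Int.log 2 x) ≤ x := by
    simpa using Int.zpow_log_le_self (b := 2) (by norm_num) hx
  have h2 : x < (2 : ℝ) ^ (Int.log 2 x + 1) := by
    simpa using Int.lt_zpow_succ_log_self (b := 2) (by norm_num) x
  set e := Int.log 2 x
  have hE : (0 : ℝ) < 2 ^ (e + 1) := by positivity
  have hE' : (2 : ℝ) ^ (e + 1) = 2 * 2 ^ e := by rw [zpow_add₀ (by norm_num)]; ring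
  have hB : (0 : ℝ) < 2 ^ β := by positivity
  set w := x / 2 ^ (e + 1) * 2 ^ β with hw
  have hxw : x = w / 2 ^ β * 2 ^ (e + 1) := by rw [hw]; field_simp
  have hw1 : (2 : ℝ) ^ β ≤ 2 * w := by
    have : 1 ≤ 2 * (x / 2 ^ (e + 1)) := by
      rw [hE', ← mul_div_assoc, le_div_iff₀ (by positivity)]; linarith
    rw [hw]; nlinarith
  have hw2 : w ≤ 2 ^ β := by
    have : x / 2 ^ (e + 1) ≤ 1 := (div_le_one hE).2 h2.le
    rw [hw]; nlinarith
  have hr := abs_sub_round w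
  have hr' := abs_le.1 hr
  obtain ⟨b, rfl⟩ : ∃ b, β = b + 1 := ⟨β - 1, by omega⟩
  have hm1 : (2 : ℤ) ^ b ≤ round w := by
    have h3 : ((2 : ℤ) ^ b : ℝ) - 1 < round w := by
      push_cast
      rw [pow_succ] at hw1
      linarith
    have : (2 : ℤ) ^ b - 1 < round w := by exact_mod_cast h3
    omega
  have hm2 : round w ≤ (2 : ℤ) ^ (b + 1) := by
    have h3 : (round w : ℝ) < ((2 : ℤ) ^ (b + 1) : ℝ) + 1 := by
      push_cast
      linarith
    have : round w < (2 : ℤ) ^ (b + 1) + 1 := by exact_mod_cast h3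
    omega
  have hm0 : 0 ≤ round w := le_trans (by positivity) hm1
  refine ⟨(round w : ℝ) / 2 ^ (b + 1) * 2 ^ (e + 1), Or.inr ⟨round w, e + 1, ?_, ?_, rfl⟩, ?_⟩
  · rw [abs_of_nonneg hm0, pow_succ]; omega
  · rw [abs_of_nonneg hm0]; exact hm2
  · have e1 : (round w : ℝ) / 2 ^ (b + 1) * 2 ^ (e + 1) - x
        = ((round w : ℝ) - w) / 2 ^ (b + 1) * 2 ^ (e + 1) := by
      conv_lhs => rw [hxw]
      ring
    rw [e1, abs_mul, abs_div, abs_of_pos hE, abs_of_pos hB, abs_of_pos hx, abs_sub_comm, hE']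
    calc |w - round w| / 2 ^ (b + 1) * (2 * 2 ^ e) ≤ (1 / 2) / 2 ^ (b + 1) * (2 * 2 ^ e) := by
          gcongr
      _ = 1 / 2 ^ (b + 1) * 2 ^ e := by ring
      _ ≤ 1 / 2 ^ (b + 1) * x := by gcongr

lemma exists_machineNumber_near {β : ℕ} (hβ : 1 ≤ β) (x : ℝ) :
    ∃ y ∈ machineNumbers β, |y - x| ≤ 1 / 2 ^ β * |x| := by
  rcases lt_trichotomy x 0 with h | rfl | h
  · obtain ⟨y, hy, hyx⟩ := exists_machineNumber_near_of_pos hβ (neg_pos.2 h)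
    refine ⟨-y, neg_mem_machineNumbers hy, ?_⟩
    rw [abs_neg] at hyx
    rwa [show -y - x = -(y - -x) by ring, abs_neg]
  · exact ⟨0, zero_mem_machineNumbers β, by simp⟩
  · exact exists_machineNumber_near_of_pos hβ h

section Rounding
variable {β : ℕ} {rnd : ℝ → ℝ}

lemma IsRoundToNearest.abs_sub_le (hr : IsRoundToNearest β rnd) (hβ : 1 ≤ β) (x : ℝ) :
    |rnd x - x| ≤ 1 / 2 ^ β * |x| := by
  obtain ⟨y, hy, hyx⟩ := exists_machineNumber_near hβ x
  exact ((hr x).2 y hy).trans hyx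

lemma IsRoundToNearest.monotone (hr : IsRoundToNearest β rnd) : Monotone rnd := by
  intro x y hxy
  by_contra! h
  have h1 := (hr x).2 _ (hr y).1
  have h2 := (hr y).2 _ (hr x).1
  rcases hxy.eq_or_lt with rfl | hlt
  · exact lt_irrefl _ h
  · have h3 := sq_le_sq.2 h1
    have h4 := sq_le_sq.2 h2
    nlinarith [mul_pos (sub_pos.2 h) (sub_pos.2 hlt)]

lemma measurable_exact (E : ArithExpr) : Measurable E.exact := by
  induction E with
  | var => exact measurable_id
  | const a => exact measurable_const
  | add e f he hf => exact he.add hf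
  | sub e f he hf => exact he.sub hf
  | mul e f he hf => exact he.mul hf
  | div e f he hf => exact he.div hf
  | sqrt e he => exact he.sqrt
  | abs e he => exact (continuous_abs.measurable).comp he

lemma measurable_computed (hr : IsRoundToNearest β rnd) (E : ArithExpr) :
    Measurable (E.computed rnd) := by
  have hm := hr.monotone.measurable
  induction E with
  | var => exact measurable_id
  | const a => exact measurable_const
  | add e f he hf => exact hm.comp (he.add hf)
  | sub e f he hf => exact hm.comp (he.sub hf)
  | mul e f he hf => exact hm.comp (he.mul hf)
  | div e f he hf => exact hm.comp (he.div hf)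
  | sqrt e he => exact hm.comp he.sqrt
  | abs e he => exact (continuous_abs.measurable).comp he

/-- A program either returns a machine number, or is the variable up to absolute values. In the second
case the exact value has size at most `1/2` on the range of the random sample. -/
lemma computed_mem_or_abs_exact_eq (hr : IsRoundToNearest β rnd) (E : ArithExpr) (u : ℝ) :
    E.computed rnd u ∈ machineNumbers β ∨ |E.exact u| = |u| := by
  induction E with
  | var => exact Or.inr rfl
  | const a => exact Or.inl (hr _).1
  | add e f _ _ => exact Or.inl (hr _).1
  | sub e f _ _ => exact Or.inl (hr _).1
  | mul e f _ _ => exact Or.inl (hr _).1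
  | div e f _ _ => exact Or.inl (hr _).1
  | sqrt e _ => exact Or.inl (hr _).1
  | abs e he =>
    rcases he with h | h
    · exact Or.inl (abs_mem_machineNumbers h)
    · exact Or.inr ((abs_abs _).trans h)

/-- There is no machine number strictly between `1` and `1 + 2 ε`. -/
lemma machineNumber_gap (hβ : 1 ≤ β) {y : ℝ} (hy : y ∈ machineNumbers β) :
    1 / 2 ^ β ≤ |y - (1 + 1 / 2 ^ β)| := by
  by_contra! hlt
  rw [abs_lt] at hlt
  have hB : (0 : ℝ) < 2 ^ β := by positivity
  have hε : (0 : ℝ) < 1 / 2 ^ β := by positivity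
  have hy1 : 1 < y := by linarith
  have hy2 : y < 1 + 2 * (1 / 2 ^ β) := by linarith
  rcases hy with rfl | ⟨m, e, _, h2, rfl⟩
  · linarith
  have hm2 : (m : ℝ) ≤ 2 ^ β := by
    have := (le_abs_self m).trans h2
    exact_mod_cast this
  have he : 1 ≤ e := by
    by_contra! he
    have h3 : (2 : ℝ) ^ e ≤ 1 := zpow_le_one_of_nonpos₀ (by norm_num) (by omega)
    have h4 : (m : ℝ) / 2 ^ β ≤ 1 := (div_le_one hB).2 hm2
    have h5 : (0 : ℝ) < 2 ^ e := by positivity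
    nlinarith
  obtain ⟨j, hj⟩ : ∃ j : ℕ, e = j + 1 := ⟨(e - 1).toNat, by omega⟩
  obtain ⟨b, rfl⟩ : ∃ b, β = b + 1 := ⟨β - 1, by omega⟩
  have h6 : (m : ℝ) / 2 ^ (b + 1) * 2 ^ e = ((m * 2 ^ j : ℤ) : ℝ) / 2 ^ b := by
    rw [hj, zpow_add₀ (by norm_num), zpow_natCast, pow_succ]
    push_cast
    field_simp
  rw [h6] at hy1 hy2
  have hb : (0 : ℝ) < 2 ^ b := by positivity
  rw [lt_div_iff₀ hb, one_mul] at hy1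
  have h7 : 1 + 2 * (1 / (2 : ℝ) ^ (b + 1)) = (2 ^ b + 1) / 2 ^ b := by
    rw [pow_succ]; field_simp
  rw [h7, div_lt_div_iff_of_pos_right hb] at hy2
  have h8 : (2 : ℤ) ^ b < m * 2 ^ j := by exact_mod_cast hy1
  have h9 : m * 2 ^ j < (2 : ℤ) ^ b + 1 := by exact_mod_cast hy2
  omega

/-- Error propagation through a rounded sum of two rounded operands of size at most `M`. -/
lemma abs_rnd_add_sub_le (hr : IsRoundToNearest β rnd) (hβ : 1 ≤ β) {X Y x y x' y' a b M : ℝ}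
    (hX : |X - x| ≤ 1 / 2 ^ β * |x|) (hY : |Y - y| ≤ 1 / 2 ^ β * |y|)
    (hx : |x - x'| ≤ a) (hy : |y - y'| ≤ b) (hx' : |x'| ≤ M) (hy' : |y'| ≤ M) (ha : a ≤ M)
    (hb : b ≤ M) : |rnd (X + Y) - (x' + y')| ≤ a + b + 10 * (1 / 2 ^ β) * M := by
  have hε : (0 : ℝ) < 1 / 2 ^ β := by positivity
  have hε1 : (1 : ℝ) / 2 ^ β ≤ 1 / 2 := by
    apply one_div_le_one_div_of_le (by norm_num)
    calc (2 : ℝ) = 2 ^ 1 := by norm_num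
      _ ≤ 2 ^ β := pow_le_pow_right₀ (by norm_num) hβ
  have r3 := hr.abs_sub_le hβ (X + Y)
  set ε := (1 : ℝ) / 2 ^ β
  have hM : 0 ≤ M := (abs_nonneg _).trans hx'
  have hxM : |x| ≤ 2 * M := by
    have := abs_sub_abs_le_abs_sub x x'; linarith
  have hyM : |y| ≤ 2 * M := by
    have := abs_sub_abs_le_abs_sub y y'; linarith
  have r1' : |X - x| ≤ ε * (2 * M) := hX.trans (by gcongr)
  have r2' : |Y - y| ≤ ε * (2 * M) := hY.trans (by gcongr)
  have hs : |X + Y| ≤ 6 * M := by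
    have h1 := abs_sub_abs_le_abs_sub X x
    have h2 := abs_sub_abs_le_abs_sub Y y
    have h3 := abs_add_le X Y
    nlinarith
  have r3' : |rnd (X + Y) - (X + Y)| ≤ ε * (6 * M) := r3.trans (by gcongr)
  rw [abs_le] at *
  constructor <;> nlinarith

lemma abs_flAdd_sub_le (hr : IsRoundToNearest β rnd) (hβ : 1 ≤ β) {x y x' y' a b M : ℝ}
    (hx : |x - x'| ≤ a) (hy : |y - y'| ≤ b) (hx' : |x'| ≤ M) (hy' : |y'| ≤ M) (ha : a ≤ M)
    (hb : b ≤ M) : |flAdd rnd x y - (x' + y')| ≤ a + b + 10 * (1 / 2 ^ β) * M :=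
  abs_rnd_add_sub_le hr hβ (hr.abs_sub_le hβ x) (hr.abs_sub_le hβ y) hx hy hx' hy' ha hb

lemma abs_flSub_sub_le (hr : IsRoundToNearest β rnd) (hβ : 1 ≤ β) {x y x' y' a b M : ℝ}
    (hx : |x - x'| ≤ a) (hy : |y - y'| ≤ b) (hx' : |x'| ≤ M) (hy' : |y'| ≤ M) (ha : a ≤ M)
    (hb : b ≤ M) : |flSub rnd x y - (x' - y')| ≤ a + b + 10 * (1 / 2 ^ β) * M := by
  have h := abs_rnd_add_sub_le hr hβ (Y := -rnd y) (y := -y) (y' := -y') (hr.abs_sub_le hβ x)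
    (by rw [abs_neg, neg_sub_neg, abs_sub_comm]; exact hr.abs_sub_le hβ y) hx
    (by rw [neg_sub_neg, abs_sub_comm]; exact hy) hx' (by rwa [abs_neg]) ha hb
  simpa [flSub, sub_eq_add_neg] using h

/-- Error propagation through a rounded product, whose first factor is known exactly. -/
lemma abs_flMul_sub_le (hr : IsRoundToNearest β rnd) (hβ : 1 ≤ β) {k y y' b : ℝ}
    (hk : 0 ≤ k) (hy : |y - y'| ≤ b) :
    |flMul rnd k y - k * y'| ≤ k * b + 5 * (1 / 2 ^ β) * (k * (|y'| + b)) := by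
  have hε : (0 : ℝ) < 1 / 2 ^ β := by positivity
  have hε1 : (1 : ℝ) / 2 ^ β ≤ 1 / 2 := by
    apply one_div_le_one_div_of_le (by norm_num)
    calc (2 : ℝ) = 2 ^ 1 := by norm_num
      _ ≤ 2 ^ β := pow_le_pow_right₀ (by norm_num) hβ
  have r1 := hr.abs_sub_le hβ k
  have r2 := hr.abs_sub_le hβ y
  have r3 := hr.abs_sub_le hβ (rnd k * rnd y)
  set ε := (1 : ℝ) / 2 ^ β
  have hyM : |y| ≤ |y'| + b := by
    have := abs_sub_abs_le_abs_sub y y'; linarith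
  have hyb : 0 ≤ |y'| + b := (abs_nonneg _).trans hyM
  rw [abs_of_nonneg hk] at r1
  have hk2 : |rnd k| ≤ (1 + ε) * k := by
    have := abs_sub_abs_le_abs_sub (rnd k) k
    rw [abs_of_nonneg hk] at this; linarith
  have hy2 : |rnd y| ≤ (1 + ε) * |y| := by
    have := abs_sub_abs_le_abs_sub (rnd y) y; linarith
  have h1 : |rnd k * rnd y| ≤ (1 + ε) ^ 2 * (k * |y|) := by
    rw [abs_mul]
    calc |rnd k| * |rnd y| ≤ ((1 + ε) * k) * ((1 + ε) * |y|) := by gcongr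
      _ = _ := by ring
  have h2 : |rnd k * rnd y - k * y| ≤ (2 * ε + ε ^ 2) * (k * |y|) := by
    have : rnd k * rnd y - k * y = (rnd k - k) * rnd y + k * (rnd y - y) := by ring
    rw [this]
    calc |(rnd k - k) * rnd y + k * (rnd y - y)|
        ≤ |(rnd k - k)| * |rnd y| + k * |rnd y - y| := by
          refine (abs_add_le _ _).trans ?_
          rw [abs_mul, abs_mul, abs_of_nonneg hk]
      _ ≤ (ε * k) * ((1 + ε) * |y|) + k * (ε * |y|) := by gcongr
      _ = _ := by ring
  have h3 : |k * y - k * y'| ≤ k * b := by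
    rw [← mul_sub, abs_mul, abs_of_nonneg hk]; gcongr
  have h4 : |flMul rnd k y - k * y'| ≤
      |rnd (rnd k * rnd y) - rnd k * rnd y| + |rnd k * rnd y - k * y| + |k * y - k * y'| := by
    have : flMul rnd k y - k * y' = (rnd (rnd k * rnd y) - rnd k * rnd y) +
      (rnd k * rnd y - k * y) + (k * y - k * y') := by unfold flMul; ring
    rw [this]
    exact abs_add_three _ _ _
  have h5 : k * |y| ≤ k * (|y'| + b) := by gcongr
  have h6 : 0 ≤ k * |y| := by positivity
  have h7 : ε * ((1 + ε) ^ 2 * (k * |y|)) + (2 * ε + ε ^ 2) * (k * |y|) ≤ 5 * ε * (k * |y|) := by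
    have : ε * (1 + ε) ^ 2 + (2 * ε + ε ^ 2) ≤ 5 * ε := by nlinarith [mul_pos hε hε]
    nlinarith
  have h8 : ε * |rnd k * rnd y| ≤ ε * ((1 + ε) ^ 2 * (k * |y|)) := by gcongr
  have h9 : 5 * ε * (k * |y|) ≤ 5 * ε * (k * (|y'| + b)) := by gcongr
  linarith

/-- Error propagation through the left-to-right sum that the sampler computes. Every summand and
every partial sum has size at most `M`. -/
lemma abs_flSum_sub_le (hr : IsRoundToNearest β rnd) (hβ : 1 ≤ β)
    {x₁ x₂ x₃ x₄ x₅ x₆ x₇ t₁ t₂ t₃ t₄ t₅ t₆ t₇ e₁ e₂ e₃ e₄ e₅ e₆ e₇ M : ℝ}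
    (h₁ : |x₁ - t₁| ≤ e₁) (h₂ : |x₂ - t₂| ≤ e₂) (h₃ : |x₃ - t₃| ≤ e₃) (h₄ : |x₄ - t₄| ≤ e₄)
    (h₅ : |x₅ - t₅| ≤ e₅) (h₆ : |x₆ - t₆| ≤ e₆) (h₇ : |x₇ - t₇| ≤ e₇)
    (b₁ : |t₁| ≤ M) (b₂ : |t₂| ≤ M) (b₃ : |t₃| ≤ M) (b₄ : |t₄| ≤ M) (b₅ : |t₅| ≤ M)
    (b₆ : |t₆| ≤ M) (b₇ : |t₇| ≤ M) (c₂ : |t₁ - t₂| ≤ M) (c₃ : |t₁ - t₂ - t₃| ≤ M)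
    (c₄ : |t₁ - t₂ - t₃ + t₄| ≤ M) (c₅ : |t₁ - t₂ - t₃ + t₄ + t₅| ≤ M)
    (c₆ : |t₁ - t₂ - t₃ + t₄ + t₅ + t₆| ≤ M)
    (hM : e₁ + e₂ + e₃ + e₄ + e₅ + e₆ + e₇ + 60 * (1 / 2 ^ β * M) ≤ M) :
    |flSub rnd (flAdd rnd (flAdd rnd (flAdd rnd (flSub rnd (flSub rnd x₁ x₂) x₃) x₄) x₅) x₆) x₇ -
      (t₁ - t₂ - t₃ + t₄ + t₅ + t₆ - t₇)| ≤
      e₁ + e₂ + e₃ + e₄ + e₅ + e₆ + e₇ + 60 * (1 / 2 ^ β * M) := by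
  have n₁ := (abs_nonneg _).trans h₁
  have n₂ := (abs_nonneg _).trans h₂
  have n₃ := (abs_nonneg _).trans h₃
  have n₄ := (abs_nonneg _).trans h₄
  have n₅ := (abs_nonneg _).trans h₅
  have n₆ := (abs_nonneg _).trans h₆
  have n₇ := (abs_nonneg _).trans h₇
  have n₀ : 0 ≤ 1 / 2 ^ β * M := mul_nonneg (by positivity) ((abs_nonneg _).trans b₁)
  have s₂ := abs_flSub_sub_le hr hβ h₁ h₂ b₁ b₂ (by linarith) (by linarith)
  have s₃ := abs_flSub_sub_le hr hβ s₂ h₃ c₂ b₃ (by linarith) (by linarith)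
  have s₄ := abs_flAdd_sub_le hr hβ s₃ h₄ c₃ b₄ (by linarith) (by linarith)
  have s₅ := abs_flAdd_sub_le hr hβ s₄ h₅ c₄ b₅ (by linarith) (by linarith)
  have s₆ := abs_flAdd_sub_le hr hβ s₅ h₆ c₅ b₆ (by linarith) (by linarith)
  have s₇ := abs_flSub_sub_le hr hβ s₆ h₇ c₆ b₇ (by linarith) (by linarith)
  exact s₇.trans (by linarith)
end Rounding

/-! ### The error of the computed acceptance ratio -/

lemma abs_log_le_of_abs_sub_one_le {x ζ : ℝ} (hζ : ζ ≤ 1 / 15) (hx : |x - 1| ≤ ζ) :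
    |Real.log x| ≤ 15 / 14 * ζ := by
  have hζ0 : 0 ≤ ζ := (abs_nonneg _).trans hx
  rw [abs_le] at hx
  have hx0 : 0 < x := by linarith
  have h1 := Real.log_le_sub_one_of_pos hx0
  have h2 := Real.one_sub_inv_le_log_of_pos hx0
  have h3 : -(15 / 14 * ζ) ≤ 1 - x⁻¹ := by
    have : x⁻¹ ≤ 1 + 15 / 14 * ζ := by
      rw [inv_le_iff_one_le_mul₀ hx0]
      nlinarith
    linarith
  rw [abs_le]
  constructor <;> linarith

/-- The errors of the three AGM logarithms have total weight `j + 2`; the remaining error is that of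
the Lanczos approximation. -/
lemma abs_logFactorial_sub_log_factorial_le {β t : ℕ} {g ζ : ℝ} (hβ : 6 ≤ β) (hg : 0 < g + 1 / 2)
    (hζ : IsLanczosErrorBound t g ζ) (hζ1 : ζ ≤ 1 / 15) (j : ℕ) :
    |logFactorial β t g j - Real.log j.factorial| ≤
      (j + 2) * (2 * β * (1 / 2 ^ β)) + 15 / 14 * ζ := by
  have hj : (0 : ℝ) < j.factorial := by exact_mod_cast j.factorial_pos
  have h1 := hζ j
  have h2 : |lanczosFactorial t g j / j.factorial - 1| ≤ ζ := by
    rw [div_sub_one hj.ne', abs_div, abs_of_pos hj, abs_sub_comm]; exact h1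
  have h3 := abs_log_le_of_abs_sub_one_le hζ1 h2
  have hζ0 : 0 ≤ ζ := (abs_nonneg _).trans h2
  have hF : 0 < lanczosFactorial t g j := by
    have := (abs_le.1 h2).1
    have h5 : 0 < lanczosFactorial t g j / j.factorial := by linarith
    exact (div_pos_iff_of_pos_right hj).1 h5
  have hG : 0 < (j : ℝ) + g + 1 / 2 := by
    have : (0 : ℝ) ≤ j := by positivity
    linarith
  have hA : 0 < lanczosSeries t g j := by
    unfold lanczosFactorial at hF
    exact pos_of_mul_pos_right hF (by positivity)
  have h4 : Real.log (lanczosFactorial t g j) = 1 / 2 * Real.log (2 * Real.pi) +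
      ((j : ℝ) + 1 / 2) * Real.log ((j : ℝ) + g + 1 / 2) - ((j : ℝ) + g + 1 / 2) +
      Real.log (lanczosSeries t g j) := by
    have hpi := Real.pi_pos
    rw [lanczosFactorial, Real.log_mul (by positivity) hA.ne', Real.log_mul (by positivity)
      (by positivity), Real.log_mul (by positivity) (by positivity), Real.log_sqrt (by positivity),
      Real.log_rpow hG, Real.log_exp]
    ring
  rw [Real.log_div hF.ne' hj.ne', h4] at h3
  have e1 := abs_agmLog_sub_log_le hβ (x := 2 * Real.pi) (by positivity)
  have e2 := abs_agmLog_sub_log_le hβ hG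
  have e3 := abs_agmLog_sub_log_le hβ hA
  set lam := 2 * (β : ℝ) * (1 / 2 ^ β)
  have e2' : |((j : ℝ) + 1 / 2) * (agmLog β ((j : ℝ) + g + 1 / 2) -
      Real.log ((j : ℝ) + g + 1 / 2))| ≤ ((j : ℝ) + 1 / 2) * lam := by
    rw [abs_mul, abs_of_nonneg (by positivity)]; gcongr
  unfold logFactorial
  rw [abs_le] at *
  constructor <;> linarith

/-- Bounds on the parameters of the sampler, valid whenever the claimed bound is below one. The
constants `0.35` and `0.7` are upper estimates of `(log 2) / 2` and `log 2`, which come from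
`β ≥ 2 log₂ n` and `β ≥ -log₂ p`. -/
structure SmallParams (β n : ℕ) (p α ζ : ℝ) : Prop where
  β_ge : 14 ≤ β
  n_pos : 1 ≤ n
  p_pos : 0 < p
  p_lt_one : p < 1
  log_n_le : Real.log n ≤ 0.35 * β
  neg_log_p_le : -Real.log p ≤ 0.7 * β
  α_pos : 0 < α
  log_α_nonneg : 0 ≤ Real.log α
  log_α_le : Real.log α ≤ β
  ζ_le : ζ ≤ 1 / 15
  nβε_le : 1110 * (n * β * (1 / 2 ^ β) : ℝ) ≤ 1

/-- The logarithmic error bound for the candidate `k`, up to the contribution of the hat density.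
The last term is not uniform in the parameters: it is large for `p` close to one, and is controlled
only on average over `k`. -/
noncomputable def logErr (β n : ℕ) (p ζ : ℝ) (k : ℕ) : ℝ :=
  210 * (n * β * (1 / 2 ^ β)) + 3.22 * ζ + 125 * (1 / 2 ^ β) * (((n - k : ℕ) : ℝ) * -Real.log (1 - p))

lemma log_factorial_le (j : ℕ) : Real.log j.factorial ≤ j * Real.log j := by
  rcases Nat.eq_zero_or_pos j with rfl | hj
  · simp
  rw [← Real.log_pow]
  apply Real.log_le_log (by exact_mod_cast j.factorial_pos)
  exact_mod_cast Nat.factorial_le_pow j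

lemma log_binomialMass {n k : ℕ} (hk : k ≤ n) {p : ℝ} (hp : 0 < p) (hp1 : p < 1) :
    Real.log (binomialMass n p k) = Real.log n.factorial - Real.log k.factorial
      - Real.log (n - k).factorial + k * Real.log p + ((n - k : ℕ) : ℝ) * Real.log (1 - p) := by
  have hz : 0 < 1 - p := by linarith
  have hc : (0 : ℝ) < n.choose k := by exact_mod_cast Nat.choose_pos hk
  have h1 : (0 : ℝ) < k.factorial := by exact_mod_cast k.factorial_pos
  have h2 : (0 : ℝ) < (n - k).factorial := by exact_mod_cast (n - k).factorial_pos
  have h3 : Real.log n.factorial = Real.log (n.choose k) + Real.log k.factorial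
      + Real.log (n - k).factorial := by
    rw [← Real.log_mul hc.ne' h1.ne', ← Real.log_mul (by positivity) h2.ne']
    congr 1
    exact_mod_cast (Nat.choose_mul_factorial_mul_factorial hk).symm
  rw [binomialMass, Real.log_mul (by positivity) (by positivity), Real.log_mul (by positivity)
    (by positivity), Real.log_pow, Real.log_pow, h3]
  ring

lemma binomialMass_pos {n k : ℕ} (hk : k ≤ n) {p : ℝ} (hp : 0 < p) (hp1 : p < 1) :
    0 < binomialMass n p k := by
  have hz : 0 < 1 - p := by linarith
  have hc : (0 : ℝ) < n.choose k := by exact_mod_cast Nat.choose_pos hk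
  unfold binomialMass
  positivity

/-- Error of the computed logarithm of the acceptance ratio at a point where the hat has the value
`H` and the computed `1 / H` is `y`; the extra `2 β ε` accounts for the logarithm of `v`. -/
theorem abs_logRatio_sub_le {β n t : ℕ} {p α ζ g : ℝ} {rnd : ℝ → ℝ}
    (P : SmallParams β n p α ζ) (hr : IsRoundToNearest β rnd) (hg : 0 < g + 1 / 2)
    (hζ : IsLanczosErrorBound t g ζ) {k : ℕ} (hk : k ≤ n) {H y : ℝ} (hH : 0 < H)
    (hbH : binomialMass n p k ≤ α * H) (hy : |y * H - 1| ≤ 1 / 2) :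
    |logRatio β rnd t g n p α k y - Real.log (binomialMass n p k * y / α)| + 2 * β * (1 / 2 ^ β) ≤
      logErr β n p ζ k + 125 * (1 / 2 ^ β) * max 0 (Real.log H) := by
  have hβ6 : 6 ≤ β := by linarith [P.β_ge]
  have hβ1 : 1 ≤ β := by linarith [P.β_ge]
  have hz : 0 < 1 - p := by linarith [P.p_lt_one]
  have hb := binomialMass_pos hk P.p_pos P.p_lt_one
  have hy0 : 0 < y := by
    have := (abs_le.1 hy).1
    have h5 : 0 < y * H := by linarith
    exact pos_of_mul_pos_left h5 hH.le
  have hkn : (k : ℝ) ≤ n := by exact_mod_cast hk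
  have hnk : ((n - k : ℕ) : ℝ) = n - k := by push_cast [hk]; ring
  have hk0 : (0 : ℝ) ≤ k := by positivity
  have hn1 : (1 : ℝ) ≤ n := by exact_mod_cast P.n_pos
  have hβ14 : (14 : ℝ) ≤ β := by exact_mod_cast P.β_ge
  have hβn : (14 : ℝ) ≤ n * β := by nlinarith
  have hββn : (β : ℝ) ≤ n * β := by nlinarith
  have f1 := abs_logFactorial_sub_log_factorial_le hβ6 hg hζ P.ζ_le n
  have f2 := abs_logFactorial_sub_log_factorial_le hβ6 hg hζ P.ζ_le k
  have f3 := abs_logFactorial_sub_log_factorial_le hβ6 hg hζ P.ζ_le (n - k)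
  have l1 := abs_agmLog_sub_log_le hβ6 P.p_pos
  have l2 := abs_agmLog_sub_log_le hβ6 hz
  have l3 := abs_agmLog_sub_log_le hβ6 hy0
  have l4 := abs_agmLog_sub_log_le hβ6 P.α_pos
  have hζ0 : 0 ≤ ζ := by
    have := hζ 0
    exact le_trans (by positivity) this
  have hn! : Real.log n.factorial ≤ 0.35 * (n * β) := by
    refine (log_factorial_le n).trans ?_
    have := mul_le_mul_of_nonneg_left P.log_n_le (by positivity : (0 : ℝ) ≤ n)
    linarith
  have hfact : ∀ j : ℕ, j ≤ n → 0 ≤ Real.log j.factorial ∧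
      Real.log j.factorial ≤ Real.log n.factorial := fun j hj =>
    ⟨Real.log_nonneg (by exact_mod_cast j.factorial_pos), Real.log_le_log
      (by exact_mod_cast j.factorial_pos) (by exact_mod_cast Nat.factorial_le hj)⟩
  obtain ⟨hk1, hk2⟩ := hfact k hk
  obtain ⟨hm1, hm2⟩ := hfact (n - k) (Nat.sub_le _ _)
  have hc0 : 0 ≤ Real.log n.factorial - Real.log k.factorial - Real.log (n - k).factorial := by
    have hc : (1 : ℝ) ≤ n.choose k := by exact_mod_cast Nat.choose_pos hk
    have h1 : (0 : ℝ) < k.factorial := by exact_mod_cast k.factorial_pos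
    have h2 : (0 : ℝ) < (n - k).factorial := by exact_mod_cast (n - k).factorial_pos
    have h3 : Real.log n.factorial = Real.log (n.choose k) + Real.log k.factorial
        + Real.log (n - k).factorial := by
      rw [← Real.log_mul (by positivity) h1.ne', ← Real.log_mul (by positivity) h2.ne']
      congr 1
      exact_mod_cast (Nat.choose_mul_factorial_mul_factorial hk).symm
    linarith [Real.log_nonneg hc]
  have hlp : Real.log p ≤ 0 := (Real.log_neg P.p_pos P.p_lt_one).le
  have hlz : Real.log (1 - p) ≤ 0 := (Real.log_neg hz (by linarith [P.p_pos])).le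
  have hK0 : 0 ≤ k * -Real.log p := mul_nonneg hk0 (by linarith)
  have hK : k * -Real.log p ≤ 0.7 * (n * β) := by
    calc k * -Real.log p ≤ n * (0.7 * β) := by
          apply mul_le_mul hkn P.neg_log_p_le (by linarith) (by linarith)
      _ = _ := by ring
  have hJ0 : 0 ≤ ((n - k : ℕ) : ℝ) * -Real.log (1 - p) := mul_nonneg (by positivity) (by linarith)
  have hlogb := log_binomialMass hk P.p_pos P.p_lt_one
  have hlogH : Real.log (binomialMass n p k) ≤ Real.log α + Real.log H := by
    rw [← Real.log_mul P.α_pos.ne' hH.ne']; exact Real.log_le_log hb hbH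
  have hyH : |Real.log y + Real.log H| ≤ 0.7 := by
    rw [← Real.log_mul hy0.ne' hH.ne']
    have hlog2 := Real.log_two_lt_d9
    obtain ⟨h1, h2⟩ := abs_le.1 hy
    have h3 : 0 < y * H := by positivity
    rw [abs_le]
    constructor
    · have : Real.log (1 / 2) ≤ Real.log (y * H) := Real.log_le_log (by norm_num) (by linarith)
      rw [one_div, Real.log_inv] at this
      linarith
    · have := Real.log_le_sub_one_of_pos h3
      linarith
  have hα0 := P.log_α_nonneg
  have hα1 := P.log_α_le
  have htot : Real.log (binomialMass n p k * y / α) =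
      Real.log n.factorial - Real.log k.factorial - Real.log (n - k).factorial
        + k * Real.log p + ((n - k : ℕ) : ℝ) * Real.log (1 - p) + Real.log y - Real.log α := by
    rw [Real.log_div (by positivity) P.α_pos.ne', Real.log_mul hb.ne' hy0.ne', hlogb]
  rw [htot]
  -- All summands and partial sums are at most `M = 3 n β + 2 J + Hp`. The terms `k log p` and the
  -- factorials are `O(n β)`, but `J` and `Hp` admit no bound in terms of `n` and `β`.
  have m1 := abs_flMul_sub_le hr hβ1 hk0 l1
  have m2 := abs_flMul_sub_le hr hβ1 (k := ((n - k : ℕ) : ℝ)) (by positivity) l2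
  have hw := P.nβε_le
  have hε : (0 : ℝ) < 1 / 2 ^ β := by positivity
  unfold logErr logRatio
  simp only
  rw [abs_of_nonpos hlp] at m1
  rw [abs_of_nonpos hlz] at m2
  set ε : ℝ := 1 / 2 ^ β with hεdef
  set K := (k : ℝ) * -Real.log p with hKdef
  set J := ((n - k : ℕ) : ℝ) * -Real.log (1 - p) with hJdef
  set Hp := max 0 (Real.log H) with hHp
  have hHp0 : 0 ≤ Hp := le_max_left _ _
  have hHp1 : Real.log H ≤ Hp := le_max_right _ _
  have eK : (k : ℝ) * Real.log p = -K := by rw [hKdef]; ring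
  have eJ : ((n - k : ℕ) : ℝ) * Real.log (1 - p) = -J := by rw [hJdef]; ring
  rw [eK] at m1 hlogb ⊢
  rw [eJ] at m2 hlogb ⊢
  obtain ⟨w, hwdef⟩ : ∃ w : ℝ, w = n * β * ε := ⟨_, rfl⟩
  rw [← hwdef] at hw ⊢
  have hw0 : 0 ≤ w := by rw [hwdef]; positivity
  have hεw : 14 * ε ≤ w := by
    rw [hwdef]; exact mul_le_mul_of_nonneg_right hβn hε.le
  have hβε : (β : ℝ) * ε ≤ w := by
    rw [hwdef]; exact mul_le_mul_of_nonneg_right hββn hε.le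
  have hnb : (n : ℝ) * (β * ε) = w := by rw [hwdef]; ring
  have hkb : (k : ℝ) * (β * ε) ≤ w := by rw [← hnb]; gcongr
  obtain ⟨bε, hbε⟩ : ∃ x : ℝ, x = β * ε := ⟨_, rfl⟩
  have e2 : 2 * (β : ℝ) * ε = 2 * bε := by rw [hbε]; ring
  rw [e2] at f1 f2 f3 l1 l2 l3 l4 m1 m2 ⊢
  rw [← hbε] at hβε hnb hkb
  have hbε0 : 0 ≤ bε := by rw [hbε]; positivity
  have m1' : |flMul rnd k (agmLog β p) - -K| ≤ 2 * (k * bε) + 5 * (ε * K) + 0.1 * w := by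
    refine m1.trans ?_
    have : 5 * ε * (k * (-Real.log p + 2 * bε)) = 5 * (ε * K) + 10 * ε * (k * bε) := by
      rw [hKdef]; ring
    rw [this]
    have : ε * (k * bε) ≤ 0.001 * w := by
      have h1 : ε ≤ 0.001 := by linarith only [hεw, hw]
      have := mul_le_mul h1 hkb (by positivity) (by norm_num)
      exact this
    linarith only [this, hw0]
  have m2' : |flMul rnd ((n - k : ℕ) : ℝ) (agmLog β (1 - p)) - -J| ≤
      2 * ((n - k : ℕ) * bε) + 5 * (ε * J) + 0.1 * w := by
    refine m2.trans ?_
    have : 5 * ε * (((n - k : ℕ) : ℝ) * (-Real.log (1 - p) + 2 * bε)) =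
        5 * (ε * J) + 10 * ε * (((n - k : ℕ) : ℝ) * bε) := by
      rw [hJdef]; ring
    rw [this]
    have : ε * (((n - k : ℕ) : ℝ) * bε) ≤ 0.001 * w := by
      have h1 : ε ≤ 0.001 := by linarith only [hεw, hw]
      have h2 : ((n - k : ℕ) : ℝ) * bε ≤ w := by
        rw [← hnb]; exact mul_le_mul_of_nonneg_right (by linarith only [hk0, hnk]) hbε0
      have := mul_le_mul h1 h2 (by positivity) (by norm_num)
      exact this
    linarith only [this, hw0]
  have ek : ((n - k : ℕ) : ℝ) * bε = w - k * bε := by rw [hnk, sub_mul, hnb]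
  rw [ek] at m2'
  have hkb0 : 0 ≤ (k : ℝ) * bε := by positivity
  have f1' : |logFactorial β t g n - Real.log n.factorial| ≤ 6 * w + 15 / 14 * ζ := by
    refine f1.trans ?_; linarith only [hnb, hβε]
  have f2' : |logFactorial β t g k - Real.log k.factorial| ≤ 2 * (k * bε) + 4 * w + 15 / 14 * ζ := by
    refine f2.trans ?_; linarith only [hβε]
  have f3' : |logFactorial β t g (n - k) - Real.log (n - k).factorial| ≤
      2 * (w - k * bε) + 4 * w + 15 / 14 * ζ := by
    refine f3.trans ?_; rw [← ek]; linarith only [hβε]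
  have hζ1 := P.ζ_le
  set L1 := Real.log n.factorial
  set L2 := Real.log k.factorial
  set L3 := Real.log (n - k).factorial
  obtain ⟨M, hM⟩ : ∃ M : ℝ, M = 3 * (n * β) + 2 * J + Hp := ⟨_, rfl⟩
  have hεK : ε * K ≤ 0.7 * w := by
    have := mul_le_mul_of_nonneg_left hK hε.le
    rw [hwdef]; linarith only [this]
  have hε1 : ε ≤ 0.001 := by linarith only [hεw, hw]
  have hεJ : ε * J ≤ 0.001 * J := mul_le_mul_of_nonneg_right hε1 hJ0
  have hεM : ε * M = 3 * w + 2 * (ε * J) + ε * Hp := by rw [hM, hwdef]; ring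
  have hεM1 : ε * M ≤ 0.001 * M := by
    have : 0 ≤ M := by rw [hM]; positivity
    exact mul_le_mul_of_nonneg_right hε1 this
  have hεJ0 : 0 ≤ ε * J := by positivity
  have hεK0 : 0 ≤ ε * K := by positivity
  have hεM0 : 0 ≤ ε * M := by rw [hεM]; positivity
  have hM42 : 42 ≤ M := by rw [hM]; linarith only [hβn, hJ0, hHp0]
  have hMJ : 2 * J ≤ M := by rw [hM]; linarith only [hβn, hHp0]
  obtain ⟨hyH1, hyH2⟩ := abs_le.1 hyH
  have hly1 : Real.log y ≤ 0.7 + K + J + Real.log α := by linarith only [hyH2, hlogH, hlogb, hc0]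
  have hly2 : -Real.log y ≤ 0.7 + Hp := by linarith only [hyH1, hHp1]
  have A : ∀ {a b : ℝ}, -b ≤ a → a ≤ b → |a| ≤ b := fun h1 h2 => abs_le.2 ⟨h1, h2⟩
  have hεHp : 0 ≤ ε * Hp := by positivity
  have hnβ0 : 0 ≤ (n : ℝ) * β := by positivity
  have hL1 : 0 ≤ L1 := hk1.trans hk2
  have hM' : 3 * (n * β) + 2 * J + Hp ≤ M := hM.ge
  have hα2 : Real.log α ≤ n * β := hα1.trans hββn
  have key := abs_flSum_sub_le hr hβ1 f1' f2' f3' m1' m2' l3 l4 (M := M)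
    (A (by linarith only [hL1, hM42]) (by linarith only [hn!, hM', hJ0, hHp0, hnβ0]))
    (A (by linarith only [hk1, hM42]) (by linarith only [hn!, hM', hJ0, hHp0, hk2, hnβ0]))
    (A (by linarith only [hm1, hM42]) (by linarith only [hn!, hM', hJ0, hHp0, hm2, hnβ0]))
    (A (by linarith only [hK, hM', hJ0, hHp0, hnβ0]) (by linarith only [hK0, hM42]))
    (A (by linarith only [hM', hJ0, hHp0, hnβ0]) (by linarith only [hJ0, hM42]))
    (A (by linarith only [hly2, hM', hJ0, hnβ0, hβn])
      (by linarith only [hly1, hM', hK, hα2, hHp0, hJ0, hβn]))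
    (A (by linarith only [hα0, hM42]) (by linarith only [hα2, hM', hJ0, hHp0, hnβ0]))
    (A (by linarith only [hk2, hM42]) (by linarith only [hn!, hM', hJ0, hHp0, hk1, hnβ0]))
    (A (by linarith only [hc0, hM42]) (by linarith only [hn!, hM', hJ0, hHp0, hk1, hm1, hnβ0]))
    (A (by linarith only [hc0, hK, hM', hJ0, hHp0, hnβ0])
      (by linarith only [hn!, hK0, hM', hJ0, hHp0, hk1, hm1, hnβ0]))
    (A (by linarith only [hc0, hK, hM', hJ0, hHp0, hnβ0])
      (by linarith only [hn!, hK0, hM', hJ0, hHp0, hk1, hm1, hnβ0]))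
    (A (by linarith only [hc0, hK, hM', hJ0, hHp0, hnβ0, hly2, hβn])
      (by linarith only [hn!, hK0, hM', hJ0, hHp0, hk1, hm1, hnβ0, hly1, hα2, hK, hβn]))
    (by linarith only [hw, hw0, hζ1, hεM1, hM42, hεK, hεJ, hMJ, hβε, hkb, hkb0])
  refine (add_le_add key le_rfl).trans ?_
  linarith only [hεM, hεK, hβε, hw0, hζ0, hεJ0, hεHp]

/-! ### The quantile transform of the hat distribution -/

section Quantile
variable {n : ℕ} {p α : ℝ} {h : ℝ → ℝ}

/-- The probability measure with density `h`. -/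
noncomputable def hatMeasure (h : ℝ → ℝ) : Measure ℝ :=
  volume.withDensity fun x => ENNReal.ofReal (h x)

lemma IsHat.integrable (H : IsHat n p α h) : Integrable h :=
  of_not_not fun hn => by have := H.integral_eq_one; rw [integral_undef hn] at this; norm_num at this

lemma IsHat.isProbabilityMeasure (H : IsHat n p α h) : IsProbabilityMeasure (hatMeasure h) := by
  constructor
  rw [hatMeasure, withDensity_apply _ MeasurableSet.univ, Measure.restrict_univ,
    ← ofReal_integral_eq_lintegral_ofReal H.integrable (Eventually.of_forall H.nonneg),
    H.integral_eq_one, ENNReal.ofReal_one]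

lemma IsHat.integral_Iic_eq_cdf (H : IsHat n p α h) (x : ℝ) :
    ∫ y in Set.Iic x, h y = ProbabilityTheory.cdf (hatMeasure h) x := by
  have := H.isProbabilityMeasure
  rw [ProbabilityTheory.cdf_eq_real, measureReal_def, hatMeasure,
    withDensity_apply _ measurableSet_Iic,
    ← ofReal_integral_eq_lintegral_ofReal H.integrable.integrableOn
      (Eventually.of_forall H.nonneg),
    ENNReal.toReal_ofReal (setIntegral_nonneg measurableSet_Iic fun x _ => H.nonneg x)]

/-- The Galois connection between the quantile function and the distribution function. -/
lemma IsHat.hatInverse_le_iff (H : IsHat n p α h) {u : ℝ}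
    (hu : u ∈ Set.Ioo (-(1 / 2) : ℝ) (1 / 2)) (a : ℝ) :
    hatInverse h u ≤ a ↔ u + 1 / 2 ≤ ProbabilityTheory.cdf (hatMeasure h) a := by
  have hp := H.isProbabilityMeasure
  unfold hatInverse
  simp_rw [H.integral_Iic_eq_cdf]
  set F := ProbabilityTheory.cdf (hatMeasure h)
  have hmono : Monotone F := ProbabilityTheory.monotone_cdf _
  obtain ⟨hu1, hu2⟩ := hu
  have hne : {x | u + 1 / 2 ≤ F x}.Nonempty := by
    obtain ⟨x, hx⟩ := ((ProbabilityTheory.tendsto_cdf_atTop (hatMeasure h)).eventually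
      (lt_mem_nhds (by linarith : u + 1 / 2 < 1))).exists
    exact ⟨x, hx.le⟩
  have hbdd : BddBelow {x | u + 1 / 2 ≤ F x} := by
    obtain ⟨b, hb⟩ := ((ProbabilityTheory.tendsto_cdf_atBot (hatMeasure h)).eventually
      (gt_mem_nhds (by linarith : 0 < u + 1 / 2))).exists
    refine ⟨b, fun x hx => ?_⟩
    by_contra! hxb
    have h1 := hmono hxb.le
    have h2 : u + 1 / 2 ≤ F x := hx
    linarith
  refine ⟨fun hle => le_trans ?_ (hmono hle), fun h => csInf_le hbdd h⟩
  set x := sInf {x | u + 1 / 2 ≤ F x}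
  have ht : Tendsto F (nhdsWithin x (Set.Ioi x)) (nhds (F x)) :=
    (F.right_continuous x).tendsto.mono_left (nhdsWithin_mono _ Set.Ioi_subset_Ici_self)
  refine ge_of_tendsto ht ?_
  filter_upwards [self_mem_nhdsWithin] with y hy
  obtain ⟨z, hz, hzy⟩ := exists_lt_of_csInf_lt hne (show x < y from hy)
  exact le_trans hz (hmono hzy.le)

/-- The quantile function transports the uniform distribution to the hat distribution. -/
lemma IsHat.map_quantile (H : IsHat n p α h) {X : ℝ → ℝ} (hX : Measurable X)
    (hXe : ∀ u ∈ Set.Ioo (-(1 / 2) : ℝ) (1 / 2), X u = hatInverse h u) :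
    (volume.restrict (Set.Ioo (-(1 / 2) : ℝ) (1 / 2))).map X = hatMeasure h := by
  have hp := H.isProbabilityMeasure
  have hfin : IsFiniteMeasure ((volume.restrict (Set.Ioo (-(1 / 2) : ℝ) (1 / 2))).map X) := by
    infer_instance
  refine Measure.ext_of_Iic _ _ fun a => ?_
  rw [Measure.map_apply hX measurableSet_Iic, Measure.restrict_apply (hX measurableSet_Iic),
    ← ProbabilityTheory.ofReal_cdf]
  set F := ProbabilityTheory.cdf (hatMeasure h)
  have hF1 : F a ≤ 1 := ProbabilityTheory.cdf_le_one _ _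
  have e1 : X ⁻¹' Set.Iic a ∩ Set.Ioo (-(1 / 2) : ℝ) (1 / 2) =
      Set.Iic (F a - 1 / 2) ∩ Set.Ioo (-(1 / 2) : ℝ) (1 / 2) := by
    ext u
    simp only [Set.mem_inter_iff, Set.mem_preimage, Set.mem_Iic, and_congr_left_iff]
    intro hu
    rw [hXe u hu, H.hatInverse_le_iff hu]
    constructor <;> intro h <;> linarith
  rw [e1]
  have e2 : (Set.Iic (F a - 1 / 2) ∩ Set.Ioo (-(1 / 2) : ℝ) (1 / 2) : Set ℝ) =ᵐ[volume]
      (Set.Iic (F a - 1 / 2) ∩ Set.Ioc (-(1 / 2) : ℝ) (1 / 2) : Set ℝ) :=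
    (ae_eq_refl _).inter Ioo_ae_eq_Ioc
  rw [measure_congr e2]
  have e3 : Set.Iic (F a - 1 / 2) ∩ Set.Ioc (-(1 / 2) : ℝ) (1 / 2) =
      Set.Ioc (-(1 / 2)) (F a - 1 / 2) := by
    ext u
    simp only [Set.mem_inter_iff, Set.mem_Iic, Set.mem_Ioc]
    constructor
    · rintro ⟨h1, h2, h3⟩; exact ⟨h2, h1⟩
    · rintro ⟨h1, h2⟩; exact ⟨h2, h1, by linarith⟩
  rw [e3, Real.volume_Ioc]
  congr 1
  ring

lemma sum_binomialMass (n : ℕ) (p : ℝ) : ∑ k ∈ Finset.range (n + 1), binomialMass n p k = 1 := by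
  have := add_pow p (1 - p) n
  rw [add_sub_cancel, one_pow] at this
  rw [this]
  refine Finset.sum_congr rfl fun k _ => ?_
  unfold binomialMass
  ring

lemma IsHat.α_pos (H : IsHat n p α h) (hp : 0 < p) (hp1 : p < 1) : 0 < α := by
  have h1 := H.dominates 0 (Nat.zero_le n) 0 (by simp)
  have h2 := binomialMass_pos (Nat.zero_le n) hp hp1
  exact pos_of_mul_pos_left (h2.trans_le h1) (H.nonneg 0)

lemma IsHat.mul_sub_le_integral (H : IsHat n p α h) (hα : 0 < α) {k : ℕ} (hk : k ≤ n) {a b : ℝ}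
    (hab : a ≤ b) (ha : (k : ℝ) ≤ a) (hb : b ≤ k + 1) :
    binomialMass n p k / α * (b - a) ≤ ∫ x in a..b, h x := by
  have h1 : ∫ _ in a..b, binomialMass n p k / α = binomialMass n p k / α * (b - a) := by
    rw [intervalIntegral.integral_const, smul_eq_mul, mul_comm]
  rw [← h1]
  refine intervalIntegral.integral_mono_on_of_le_Ioo hab (by simp)
    H.integrable.intervalIntegrable fun x hx => ?_
  rw [div_le_iff₀ hα, mul_comm]
  exact H.dominates k hk x ⟨ha.trans hx.1.le, hx.2.trans_le hb⟩

/-- A hat of the binomial distribution has rejection rate at least one. -/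
lemma IsHat.one_le_α (H : IsHat n p α h) (hp : 0 < p) (hp1 : p < 1) : 1 ≤ α := by
  have hα := H.α_pos hp hp1
  have h1 : ∑ k ∈ Finset.range (n + 1), binomialMass n p k / α ≤
      ∑ k ∈ Finset.range (n + 1), ∫ x in (k : ℝ)..((k + 1 : ℕ) : ℝ), h x := by
    refine Finset.sum_le_sum fun k hk => ?_
    have := H.mul_sub_le_integral hα (k := k) (by simpa [Nat.lt_succ_iff] using hk)
      (a := k) (b := k + 1) (by linarith) le_rfl le_rfl
    simpa using this
  rw [intervalIntegral.sum_integral_adjacent_intervals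
    (fun k _ => H.integrable.intervalIntegrable), ← Finset.sum_div, sum_binomialMass] at h1
  have h2 : ∫ x in ((0 : ℕ) : ℝ)..((n + 1 : ℕ) : ℝ), h x ≤ 1 := by
    rw [← H.integral_eq_one, intervalIntegral.integral_of_le (Nat.cast_le.2 (Nat.zero_le _))]
    exact setIntegral_le_integral H.integrable (Eventually.of_forall H.nonneg)
  exact (div_le_one hα).1 (h1.trans h2)

/-- A rounding constant cannot be small: the quantile function takes the value `1 + ε`, which is
the midpoint of two adjacent machine numbers. -/
lemma two_thirds_le_roundingConstant (H : IsHat n p α h) (hn : 1 ≤ n) (hp : 0 < p) (hp1 : p < 1)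
    {invE hatE : ArithExpr} (hE : ComputesHat h invE hatE) {c : ℝ}
    (hc : IsRoundingConstant invE hatE c) {β : ℕ} (hβ : 1 ≤ β) {rnd : ℝ → ℝ}
    (hr : IsRoundToNearest β rnd) : 2 / 3 ≤ c := by
  have hα := H.α_pos hp hp1
  have hb := binomialMass_pos hn hp hp1
  have hpm := H.isProbabilityMeasure
  have hε : (0 : ℝ) < 1 / 2 ^ β := by positivity
  have hε1 : (1 : ℝ) / 2 ^ β ≤ 1 / 2 := by
    apply one_div_le_one_div_of_le (by norm_num)
    calc (2 : ℝ) = 2 ^ 1 := by norm_num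
      _ ≤ 2 ^ β := pow_le_pow_right₀ (by norm_num) hβ
  obtain ⟨F, hF⟩ : ∃ F, F = ProbabilityTheory.cdf (hatMeasure h) := ⟨_, rfl⟩
  have hmono : Monotone F := hF ▸ ProbabilityTheory.monotone_cdf _
  have hstrict : ∀ a b : ℝ, 1 ≤ a → a < b → b ≤ 2 → F a < F b := by
    intro a b ha hab hb2
    have h1 := H.mul_sub_le_integral hα hn hab.le (by simpa using ha) (by norm_num; linarith)
    have h2 : 0 < binomialMass n p 1 / α * (b - a) := by
      have : 0 < b - a := by linarith
      positivity
    rw [← intervalIntegral.integral_Iic_sub_Iic H.integrable.integrableOn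
      H.integrable.integrableOn, H.integral_Iic_eq_cdf, H.integral_Iic_eq_cdf, ← hF] at h1
    linarith
  set ε : ℝ := 1 / 2 ^ β
  set x₀ : ℝ := 1 + ε with hx₀
  have hF0 : 0 < F x₀ := by
    have h1 : 0 ≤ F 1 := hF ▸ ProbabilityTheory.cdf_nonneg _ _
    exact h1.trans_lt (hstrict 1 x₀ le_rfl (by linarith) (by linarith))
  have hF1 : F x₀ < 1 := by
    have h1 : F 2 ≤ 1 := hF ▸ ProbabilityTheory.cdf_le_one _ _
    exact (hstrict x₀ 2 (by linarith) (by linarith) le_rfl).trans_le h1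
  have hu : F x₀ - 1 / 2 ∈ Set.Ioo (-(1 / 2) : ℝ) (1 / 2) := ⟨by linarith, by linarith⟩
  have hinv : hatInverse h (F x₀ - 1 / 2) = x₀ := by
    refine le_antisymm ?_ (le_of_forall_lt fun a ha => ?_)
    · rw [H.hatInverse_le_iff hu, ← hF]; linarith
    · by_contra! hle
      rw [H.hatInverse_le_iff hu, ← hF] at hle
      have h2 := hstrict (max 1 a) x₀ (le_max_left _ _) (max_lt (by linarith) ha) (by linarith)
      have h3 := hmono (le_max_right 1 a)
      linarith
  have hex : invE.exact (F x₀ - 1 / 2) = x₀ := (hE _ hu).1.trans hinv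
  have hround := (hc β hβ rnd hr _ hu).1
  have hx₀1 : 0 < x₀ := by linarith
  rw [hex, abs_of_pos hx₀1, max_eq_right (by linarith)] at hround
  rcases computed_mem_or_abs_exact_eq hr invE (F x₀ - 1 / 2) with hm | hm
  · have hgap := machineNumber_gap hβ hm
    have h1 : ε ≤ c * ε * x₀ := hgap.trans hround
    have h2 : 1 ≤ c * x₀ := by
      by_contra! hlt
      have := mul_lt_mul_of_pos_right hlt hε
      linarith
    have hc0 : 0 ≤ c := by
      by_contra! hlt
      nlinarith
    nlinarith
  · exfalso
    rw [hex, abs_of_pos hx₀1] at hm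
    have := abs_le.2 ⟨hu.1.le, hu.2.le⟩
    linarith
end Quantile

/-! ### The return probabilities of one iteration -/

section ReturnProb

/-- The factor `H ^ η` from the logarithm of the hat density is at most `1 + η H`. Against the hat
distribution the excess `η H` integrates to `η`, although `H` may be unbounded. -/
lemma exp_mul_max_log_le {η H : ℝ} (hη : 0 ≤ η) (hη1 : η ≤ 1) (hH : 0 < H) :
    Real.exp (η * max 0 (Real.log H)) ≤ 1 + η * H := by
  rcases le_total (Real.log H) 0 with h | h
  · rw [max_eq_left h, mul_zero, Real.exp_zero]
    have := mul_nonneg hη hH.le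
    linarith
  · rw [max_eq_right h]
    have := convexOn_exp.2 (Set.mem_univ 0) (Set.mem_univ (Real.log H)) (sub_nonneg.2 hη1) hη
      (by ring)
    simp only [smul_eq_mul, mul_zero, zero_add, Real.exp_zero, mul_one, Real.exp_log hH] at this
    linarith

lemma logErr_nonneg {β n : ℕ} {p α ζ : ℝ} (P : SmallParams β n p α ζ) (hζ : 0 ≤ ζ) (k : ℕ) :
    0 ≤ logErr β n p ζ k := by
  have h1 : Real.log (1 - p) ≤ 0 :=
    Real.log_nonpos (by linarith [P.p_lt_one]) (by linarith [P.p_pos])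
  have h2 : 0 ≤ -Real.log (1 - p) := by linarith
  unfold logErr
  positivity

lemma IsLanczosErrorBound.nonneg {t : ℕ} {g ζ : ℝ} (h : IsLanczosErrorBound t g ζ) : 0 ≤ ζ :=
  le_trans (by positivity) (h 0)

variable {β n t : ℕ} {p α ζ g c : ℝ} {h rnd : ℝ → ℝ} {invE hatE : ArithExpr}

/-- If `v` is accepted, it is at most the exact acceptance ratio times the relative errors. -/
lemma le_of_accepted (P : SmallParams β n p α ζ) (hr : IsRoundToNearest β rnd)
    (hg : 0 < g + 1 / 2) (hζ : IsLanczosErrorBound t g ζ) {k : ℕ} (hk : k ≤ n) {H y v q : ℝ}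
    (hq : q ≤ 1 / 2) (hη : 125 * (1 / 2 ^ β : ℝ) ≤ 1) (hH : 0 < H) (hy : |y * H - 1| ≤ q)
    (hv : 0 < v) (hv1 : v ≤ 1) (hacc : agmLog β v ≤ logRatio β rnd t g n p α k y) :
    v ≤ binomialMass n p k / (α * H) * ((1 + q) * Real.exp (logErr β n p ζ k) *
      (1 + 125 * (1 / 2 ^ β) * H)) := by
  have hα := P.α_pos
  have hb := binomialMass_pos hk P.p_pos P.p_lt_one
  have hE := logErr_nonneg P hζ.nonneg k
  have hq0 : 0 ≤ q := (abs_nonneg _).trans hy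
  set η : ℝ := 125 * (1 / 2 ^ β) with hηdef
  have hη0 : 0 ≤ η := by positivity
  rcases le_total (α * H) (binomialMass n p k) with hle | hle
  · have h1 : 1 ≤ binomialMass n p k / (α * H) := (one_le_div (by positivity)).2 hle
    have h2 : 1 ≤ Real.exp (logErr β n p ζ k) := Real.one_le_exp hE
    have h3 : 1 ≤ 1 + η * H := by have := mul_nonneg hη0 hH.le; linarith
    have h4 : 1 ≤ (1 + q) * Real.exp (logErr β n p ζ k) :=
      one_le_mul_of_one_le_of_one_le (by linarith) h2
    exact hv1.trans (one_le_mul_of_one_le_of_one_le h1 (one_le_mul_of_one_le_of_one_le h4 h3))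
  · have hmain := abs_logRatio_sub_le P hr hg hζ hk hH hle (hy.trans hq)
    have hlv := abs_agmLog_sub_log_le (β := β) (by linarith [P.β_ge]) hv
    obtain ⟨hy1, hy2⟩ := abs_le.1 hy
    have hy0 : 0 < y := by
      have h5 : 0 < y * H := by linarith
      exact pos_of_mul_pos_left h5 hH.le
    have h1 : Real.log v ≤ Real.log (binomialMass n p k * y / α) + logErr β n p ζ k
        + η * max 0 (Real.log H) := by
      have h2 := (abs_le.1 hlv).1
      have h3 := le_abs_self (logRatio β rnd t g n p α k y -
        Real.log (binomialMass n p k * y / α))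
      linarith
    have h4 : v ≤ binomialMass n p k * y / α * Real.exp (logErr β n p ζ k) *
        Real.exp (η * max 0 (Real.log H)) := by
      rw [← Real.exp_log hv]
      refine (Real.exp_le_exp.2 h1).trans (le_of_eq ?_)
      rw [Real.exp_add, Real.exp_add, Real.exp_log (by positivity)]
    have h5 := exp_mul_max_log_le hη0 hη hH
    have h6 : binomialMass n p k * y / α ≤ binomialMass n p k / (α * H) * (1 + q) := by
      rw [div_mul_eq_mul_div, div_le_div_iff₀ hα (by positivity)]
      have : y * H ≤ 1 + q := by linarith
      have := mul_le_mul_of_nonneg_left this (by positivity : 0 ≤ binomialMass n p k * α)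
      linarith
    calc v ≤ _ := h4
      _ ≤ (binomialMass n p k / (α * H) * (1 + q)) * Real.exp (logErr β n p ζ k) *
          (1 + η * H) := by gcongr
      _ = _ := by ring

/-- If `v` is at most the exact acceptance ratio divided by the relative errors, it is accepted. -/
lemma accepted_of_le (P : SmallParams β n p α ζ) (hr : IsRoundToNearest β rnd)
    (hg : 0 < g + 1 / 2) (hζ : IsLanczosErrorBound t g ζ) {k : ℕ} (hk : k ≤ n) {H y v q : ℝ}
    (hq : q ≤ 1 / 2) (hH : 0 < H) (hy : |y * H - 1| ≤ q) (hbH : binomialMass n p k ≤ α * H)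
    (hv : 0 < v) (hv1 : v ≤ binomialMass n p k / (α * H) * ((1 - q) *
      Real.exp (-logErr β n p ζ k) * (1 - 125 * (1 / 2 ^ β) * H))) :
    v ≤ 1 ∧ agmLog β v ≤ logRatio β rnd t g n p α k y := by
  have hα := P.α_pos
  have hb := binomialMass_pos hk P.p_pos P.p_lt_one
  have hE := logErr_nonneg P hζ.nonneg k
  have hq0 : 0 ≤ q := (abs_nonneg _).trans hy
  have hq1 : 0 < 1 - q := by linarith
  set η : ℝ := 125 * (1 / 2 ^ β) with hηdef
  have hη0 : 0 ≤ η := by positivity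
  have hexp : 0 < Real.exp (-logErr β n p ζ k) := Real.exp_pos _
  have hpos : 0 < 1 - η * H := by
    by_contra! hle
    have : binomialMass n p k / (α * H) * ((1 - q) *
      Real.exp (-logErr β n p ζ k) * (1 - η * H)) ≤ 0 :=
      mul_nonpos_of_nonneg_of_nonpos (by positivity)
        (mul_nonpos_of_nonneg_of_nonpos (by positivity) hle)
    linarith
  obtain ⟨hy1, hy2⟩ := abs_le.1 hy
  have hy0 : 0 < y := by
    have h5 : 0 < y * H := by linarith
    exact pos_of_mul_pos_left h5 hH.le
  constructor
  · refine hv1.trans ?_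
    have h1 : binomialMass n p k / (α * H) ≤ 1 := (div_le_one (by positivity)).2 hbH
    have h2 : Real.exp (-logErr β n p ζ k) ≤ 1 := Real.exp_le_one_iff.2 (by linarith)
    have h3 : 1 - η * H ≤ 1 := by have := mul_nonneg hη0 hH.le; linarith
    refine mul_le_one₀ h1 (by positivity) (mul_le_one₀ (mul_le_one₀ (by linarith) hexp.le h2)
      hpos.le h3)
  · have hmain := abs_logRatio_sub_le P hr hg hζ hk hH hbH (hy.trans hq)
    have hlv := abs_agmLog_sub_log_le (β := β) (by linarith [P.β_ge]) hv
    have h1 : 1 - η * H ≤ Real.exp (-(η * max 0 (Real.log H))) := by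
      have h2 : max 0 (Real.log H) ≤ H :=
        max_le hH.le ((Real.log_le_sub_one_of_pos hH).trans (by linarith))
      have h3 := Real.add_one_le_exp (-(η * max 0 (Real.log H)))
      have h4 := mul_le_mul_of_nonneg_left h2 hη0
      linarith
    have h6 : binomialMass n p k / (α * H) * (1 - q) ≤ binomialMass n p k * y / α := by
      rw [div_mul_eq_mul_div, div_le_div_iff₀ (by positivity) hα]
      have : 1 - q ≤ y * H := by linarith
      have := mul_le_mul_of_nonneg_left this (by positivity : 0 ≤ binomialMass n p k * α)
      linarith
    have h7 : v ≤ binomialMass n p k * y / α * Real.exp (-logErr β n p ζ k) *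
        Real.exp (-(η * max 0 (Real.log H))) := by
      calc v ≤ _ := hv1
        _ = (binomialMass n p k / (α * H) * (1 - q)) * Real.exp (-logErr β n p ζ k) *
          (1 - η * H) := by ring
        _ ≤ _ := by gcongr
    have h8 := Real.log_le_log hv h7
    rw [Real.log_mul (by positivity) (Real.exp_pos _).ne', Real.log_mul (by positivity)
      (Real.exp_pos _).ne', Real.log_exp, Real.log_exp] at h8
    have h2 := (abs_le.1 hlv).2
    have h3 := neg_abs_le (logRatio β rnd t g n p α k y -
      Real.log (binomialMass n p k * y / α))
    linarith

/-- The area below a function of the quantile is an integral against the hat distribution. -/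
lemma IsHat.volume_below (H : IsHat n p α h) {X : ℝ → ℝ} (hX : Measurable X)
    (hXe : ∀ u ∈ Set.Ioo (-(1 / 2) : ℝ) (1 / 2), X u = hatInverse h u) {A : Set ℝ}
    (hA : MeasurableSet A) {φ : ℝ → ℝ} (hφ : Measurable φ) :
    volume {w : ℝ × ℝ | w.1 ∈ Set.Ioo (-(1 / 2) : ℝ) (1 / 2) ∧ X w.1 ∈ A ∧
      w.2 ∈ Set.Ioc 0 (φ (X w.1))} = ∫⁻ x in A, ENNReal.ofReal (h x * φ x) := by
  have hset : MeasurableSet {w : ℝ × ℝ | w.1 ∈ Set.Ioo (-(1 / 2) : ℝ) (1 / 2) ∧ X w.1 ∈ A ∧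
      w.2 ∈ Set.Ioc 0 (φ (X w.1))} := by
    refine (measurable_fst measurableSet_Ioo).inter (((hX.comp measurable_fst) hA).inter ?_)
    exact (measurableSet_lt measurable_const measurable_snd).inter
      (measurableSet_le measurable_snd (hφ.comp (hX.comp measurable_fst)))
  have hG : Measurable (A.indicator fun x => ENNReal.ofReal (φ x)) :=
    (hφ.ennreal_ofReal).indicator hA
  rw [Measure.volume_eq_prod, Measure.prod_apply hset]
  have e1 : ∀ u : ℝ, volume (Prod.mk u ⁻¹' {w : ℝ × ℝ | w.1 ∈ Set.Ioo (-(1 / 2) : ℝ) (1 / 2) ∧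
      X w.1 ∈ A ∧ w.2 ∈ Set.Ioc 0 (φ (X w.1))}) =
      (Set.Ioo (-(1 / 2) : ℝ) (1 / 2)).indicator
        (fun u => A.indicator (fun x => ENNReal.ofReal (φ x)) (X u)) u := by
    intro u
    by_cases hu : u ∈ Set.Ioo (-(1 / 2) : ℝ) (1 / 2)
    · by_cases huA : X u ∈ A
      · rw [Set.indicator_of_mem hu, Set.indicator_of_mem huA]
        have : Prod.mk u ⁻¹' {w : ℝ × ℝ | w.1 ∈ Set.Ioo (-(1 / 2) : ℝ) (1 / 2) ∧
            X w.1 ∈ A ∧ w.2 ∈ Set.Ioc 0 (φ (X w.1))} = Set.Ioc 0 (φ (X u)) := by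
          ext v
          simp only [Set.mem_preimage, Set.mem_ofPred_eq, hu, huA, true_and]
        rw [this, Real.volume_Ioc, sub_zero]
      · rw [Set.indicator_of_mem hu, Set.indicator_of_notMem huA]
        have : Prod.mk u ⁻¹' {w : ℝ × ℝ | w.1 ∈ Set.Ioo (-(1 / 2) : ℝ) (1 / 2) ∧
            X w.1 ∈ A ∧ w.2 ∈ Set.Ioc 0 (φ (X w.1))} = ∅ := by
          ext v
          simp only [Set.mem_preimage, Set.mem_ofPred_eq, huA, false_and, and_false,
            Set.mem_empty_iff_false]
        rw [this, measure_empty]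
    · rw [Set.indicator_of_notMem hu]
      have : Prod.mk u ⁻¹' {w : ℝ × ℝ | w.1 ∈ Set.Ioo (-(1 / 2) : ℝ) (1 / 2) ∧
          X w.1 ∈ A ∧ w.2 ∈ Set.Ioc 0 (φ (X w.1))} = ∅ := by
        ext v
        simp only [Set.mem_preimage, Set.mem_ofPred_eq, hu, false_and, Set.mem_empty_iff_false]
      rw [this, measure_empty]
  simp_rw [e1]
  rw [lintegral_indicator measurableSet_Ioo, ← lintegral_map hG hX, H.map_quantile hX hXe,
    hatMeasure, lintegral_withDensity_eq_lintegral_mul _ H.measurable.ennreal_ofReal hG,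
    ← lintegral_indicator hA]
  refine lintegral_congr fun x => ?_
  rw [Pi.mul_apply]
  by_cases hx : x ∈ A
  · rw [Set.indicator_of_mem hx, Set.indicator_of_mem hx, ENNReal.ofReal_mul (H.nonneg x)]
  · rw [Set.indicator_of_notMem hx, Set.indicator_of_notMem hx, mul_zero]

/-- Almost surely the hat density is positive at the sampled quantile. -/
lemma IsHat.volume_density_eq_zero (H : IsHat n p α h) {X : ℝ → ℝ} (hX : Measurable X)
    (hXe : ∀ u ∈ Set.Ioo (-(1 / 2) : ℝ) (1 / 2), X u = hatInverse h u) :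
    volume ({u | h (X u) = 0} ∩ Set.Ioo (-(1 / 2) : ℝ) (1 / 2)) = 0 := by
  have hm : MeasurableSet {x | h x = 0} := H.measurable (measurableSet_singleton 0)
  have h1 := congrArg (fun μ => μ {x | h x = 0}) (H.map_quantile hX hXe)
  beta_reduce at h1
  rw [Measure.map_apply hX hm, Measure.restrict_apply (hX hm)] at h1
  refine h1.trans ?_
  rw [hatMeasure, withDensity_apply _ hm]
  refine (setLIntegral_congr_fun hm fun x hx => ?_).trans (lintegral_zero)
  have : h x = 0 := hx
  simp [this]

lemma abs_computed_hat_mul_sub_one_le (hE : ComputesHat h invE hatE)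
    (hc : IsRoundingConstant invE hatE c) (hβ : 1 ≤ β) (hr : IsRoundToNearest β rnd) {u : ℝ}
    (hu : u ∈ Set.Ioo (-(1 / 2) : ℝ) (1 / 2)) (hpos : 0 < h (invE.exact u)) :
    |hatE.computed rnd u * h (invE.exact u) - 1| ≤ c * (1 / 2 ^ β) := by
  have h1 := (hc β hβ rnd hr u hu).2
  rw [(hE u hu).2, ← (hE u hu).1, abs_of_pos (one_div_pos.2 hpos)] at h1
  have h2 : hatE.computed rnd u * h (invE.exact u) - 1 =
      (hatE.computed rnd u - 1 / h (invE.exact u)) * h (invE.exact u) := by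
    field_simp
  rw [h2, abs_mul, abs_of_pos hpos]
  calc _ ≤ c * (1 / 2 ^ β) * (1 / h (invE.exact u)) * h (invE.exact u) := by gcongr
    _ = _ := by field_simp

/-- If the computed quantile lies in `[k, k + 1)`, the exact one lies in a slightly larger
interval. -/
lemma mem_Icc_of_floor_eq {x x' q : ℝ} {k : ℕ} (hq0 : 0 ≤ q) (hq : q ≤ 1 / 2)
    (hx : |x' - x| ≤ q * max 1 |x|) (hk : ⌊x'⌋ = (k : ℤ)) :
    x ∈ Set.Icc (k - q * max 1 (k : ℝ)) ((k + 1) / (1 - q)) := by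
  rw [Int.floor_eq_iff] at hk
  push_cast at hk
  obtain ⟨h1, h2⟩ := hk
  obtain ⟨h3, h4⟩ := abs_le.1 hx
  have hk0 : (0 : ℝ) ≤ k := by positivity
  constructor
  · by_contra! hlt
    have hm1 : (1 : ℝ) ≤ max 1 (k : ℝ) := le_max_left _ _
    have hm2 : (k : ℝ) ≤ max 1 (k : ℝ) := le_max_right _ _
    rcases le_total (max 1 |x|) (max 1 (k : ℝ)) with h5 | h5
    · have := mul_le_mul_of_nonneg_left h5 hq0
      linarith
    · have hxk : x < k := by nlinarith
      rcases le_total 1 |x| with h6 | h6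
      · rw [max_eq_right h6] at h4 h5
        have h7 : x ≤ 0 := by
          by_contra! h8
          rw [abs_of_pos h8] at h5
          linarith
        rw [abs_of_nonpos h7] at h4 h6
        nlinarith
      · rw [max_eq_left h6] at h4 h5
        have : q * 1 ≤ q * max 1 (k : ℝ) := by gcongr
        linarith
  · rw [le_div_iff₀ (by linarith)]
    by_contra! hlt
    have h5 : (k : ℝ) + 1 < x := by nlinarith
    rw [abs_of_pos (by linarith), max_eq_right (by linarith)] at h3
    linarith

/-- On a slightly smaller interval the computed and the exact quantile have the same integer part.
The lower end `q` matters only for `k = 0`, where `[0, q)` may be rounded to negative numbers. -/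
lemma floor_eq_of_mem_Ico {x x' q : ℝ} {k : ℕ} (hq0 : 0 ≤ q) (hq : q ≤ 1 / 2)
    (hx : |x' - x| ≤ q * max 1 |x|)
    (hxk : x ∈ Set.Ico (max ((k : ℝ) / (1 - q)) q) ((k + 1) * (1 - q))) :
    ⌊x'⌋ = (k : ℤ) ∧ x ∈ Set.Ico (k : ℝ) (k + 1) := by
  obtain ⟨h1, h2⟩ := hxk
  have h3 := (le_max_left _ _).trans h1
  have h4 := (le_max_right _ _).trans h1
  have hk0 : (0 : ℝ) ≤ k := by positivity
  rw [div_le_iff₀ (by linarith)] at h3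
  have hx0 : 0 ≤ x := hq0.trans h4
  obtain ⟨h5, h6⟩ := abs_le.1 hx
  rw [abs_of_nonneg hx0] at h5 h6
  have h7 : (k : ℝ) ≤ x := by nlinarith
  have h8 : x < k + 1 := by nlinarith
  refine ⟨?_, h7, h8⟩
  rw [Int.floor_eq_iff]
  push_cast
  constructor
  · rcases le_total 1 x with h9 | h9
    · rw [max_eq_right h9] at h5
      linarith
    · rw [max_eq_left h9] at h5
      have hk1 : k = 0 ∨ 1 ≤ k := by omega
      rcases hk1 with rfl | hk1
      · push_cast; linarith
      · have : (1 : ℝ) ≤ k := by exact_mod_cast hk1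
        have hx1 : x = 1 := le_antisymm h9 (this.trans h7)
        rw [hx1] at h3 h5
        linarith
  · have h9 : max 1 x ≤ k + 1 := max_le (by linarith) h8.le
    have := mul_le_mul_of_nonneg_left h9 hq0
    linarith

lemma volume_returnSet_le_one (k : Fin (n + 1)) :
    volume (returnSet β rnd t g n p α invE hatE k) ≤ 1 := by
  have : returnSet β rnd t g n p α invE hatE k ⊆
      Set.Icc (-(1 / 2) : ℝ) (1 / 2) ×ˢ Set.Icc (0 : ℝ) 1 := fun w hw => ⟨hw.1, hw.2.1⟩
  refine (measure_mono this).trans (le_of_eq ?_)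
  rw [Measure.volume_eq_prod, Measure.prod_prod, Real.volume_Icc, Real.volume_Icc]
  norm_num

/-- No measurability of the return sets is needed: they lie in the measurable disjoint sets on which
the candidate is `k`. -/
lemma sum_returnProb_le_one (hr : IsRoundToNearest β rnd) :
    ∑ k, returnProb β rnd t g n p α invE hatE k ≤ 1 := by
  let V : Fin (n + 1) → Set (ℝ × ℝ) := fun k =>
    ({u | ⌊invE.computed rnd u⌋ = ((k : ℕ) : ℤ)} ∩ Set.Icc (-(1 / 2) : ℝ) (1 / 2)) ×ˢ
      Set.Icc (0 : ℝ) 1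
  have hV : ∀ k, MeasurableSet (V k) := fun k =>
    (((measurable_computed hr invE).floor (measurableSet_singleton ((k : ℕ) : ℤ))).inter
      measurableSet_Icc).prod measurableSet_Icc
  have hdisj : Pairwise (Function.onFun Disjoint V) := by
    intro i j hij
    rw [Function.onFun, Set.disjoint_left]
    rintro w ⟨⟨h1, _⟩, _⟩ ⟨⟨h2, _⟩, _⟩
    have h1' : ⌊invE.computed rnd w.1⌋ = ((i : ℕ) : ℤ) := h1
    have h2' : ⌊invE.computed rnd w.1⌋ = ((j : ℕ) : ℤ) := h2
    exact hij (Fin.ext (by exact_mod_cast h1'.symm.trans h2'))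
  have hU := measure_iUnion (μ := (volume : Measure (ℝ × ℝ))) hdisj hV
  have h1 : volume (⋃ k, V k) ≤ 1 := by
    have : (⋃ k, V k) ⊆ Set.Icc (-(1 / 2) : ℝ) (1 / 2) ×ˢ Set.Icc (0 : ℝ) 1 := by
      refine Set.iUnion_subset fun k w hw => ⟨hw.1.2, hw.2⟩
    refine (measure_mono this).trans (le_of_eq ?_)
    rw [Measure.volume_eq_prod, Measure.prod_prod, Real.volume_Icc, Real.volume_Icc]
    norm_num
  rw [hU, tsum_fintype] at h1
  have h2 : ∑ k, volume (returnSet β rnd t g n p α invE hatE k) ≤ 1 := by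
    refine (Finset.sum_le_sum fun k _ => measure_mono fun w hw => ?_).trans h1
    exact ⟨⟨hw.2.2.1, hw.1⟩, hw.2.1⟩
  unfold returnProb
  rw [← ENNReal.toReal_sum fun k _ => ((volume_returnSet_le_one k).trans_lt ENNReal.one_lt_top).ne]
  exact ENNReal.toReal_le_of_le_ofReal zero_le_one (by simpa using h2)

/-- Upper bound on the probability that one iteration returns `k`. The last factor is the length of
the interval of exact quantiles that can produce the candidate `k`, plus the excess due to large
values of the hat density. -/
theorem returnProb_le (P : SmallParams β n p α ζ) (H : IsHat n p α h)
    (hE : ComputesHat h invE hatE) (hc : IsRoundingConstant invE hatE c)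
    (hr : IsRoundToNearest β rnd) (hg : 0 < g + 1 / 2) (hζ : IsLanczosErrorBound t g ζ)
    (hη : 125 * (1 / 2 ^ β : ℝ) ≤ 1) {q : ℝ} (hqdef : q = c * (1 / 2 ^ β)) (hq0 : 0 ≤ q)
    (hq : q ≤ 1 / 2) (k : Fin (n + 1)) :
    returnProb β rnd t g n p α invE hatE k ≤ binomialMass n p k / α *
      ((1 + q) * Real.exp (logErr β n p ζ k) *
        ((k + 1) / (1 - q) - k + q * max 1 (k : ℝ) + 125 * (1 / 2 ^ β))) := by
  have hk : (k : ℕ) ≤ n := Nat.lt_succ_iff.1 k.2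
  have hα := P.α_pos
  have hb := binomialMass_pos hk P.p_pos P.p_lt_one
  have hβ1 : 1 ≤ β := by linarith [P.β_ge]
  have hX := measurable_exact invE
  have hXe : ∀ u ∈ Set.Ioo (-(1 / 2) : ℝ) (1 / 2), invE.exact u = hatInverse h u :=
    fun u hu => (hE u hu).1
  set η : ℝ := 125 * (1 / 2 ^ β) with hηdef
  have hη0 : 0 ≤ η := by positivity
  set A : Set ℝ := Set.Icc ((k : ℝ) - q * max 1 ((k : ℕ) : ℝ)) (((k : ℕ) + 1) / (1 - q)) with hA
  set Q : ℝ := (1 + q) * Real.exp (logErr β n p ζ k) with hQ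
  have hQ0 : 0 ≤ Q := by positivity
  let φ : ℝ → ℝ := fun x => binomialMass n p k / (α * h x) * (Q * (1 + η * h x))
  have hφ : Measurable φ := by
    have := H.measurable
    fun_prop
  -- the exceptional sets are null: endpoints of the square, `v = 0`, and a vanishing hat density
  have hsub : returnSet β rnd t g n p α invE hatE k ⊆
      ({w : ℝ × ℝ | w.1 ∈ Set.Ioo (-(1 / 2) : ℝ) (1 / 2) ∧ invE.exact w.1 ∈ A ∧
        w.2 ∈ Set.Ioc 0 (φ (invE.exact w.1))} ∪ (Set.univ ×ˢ {0})) ∪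
      ((({u | h (invE.exact u) = 0} ∩ Set.Ioo (-(1 / 2) : ℝ) (1 / 2)) ∪ {-(1 / 2), 1 / 2}) ×ˢ
        Set.univ) := by
    rintro ⟨u, v⟩ ⟨hu, hv, hfl, hacc⟩
    simp only at hu hv hfl hacc
    by_cases hu' : u ∈ Set.Ioo (-(1 / 2) : ℝ) (1 / 2)
    swap
    · right
      refine ⟨Or.inr ?_, trivial⟩
      by_contra hne
      simp only [Set.mem_insert_iff, Set.mem_singleton_iff, not_or] at hne
      exact hu' ⟨lt_of_le_of_ne hu.1 (Ne.symm hne.1), lt_of_le_of_ne hu.2 hne.2⟩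
    rcases (H.nonneg (invE.exact u)).eq_or_lt with h0 | hpos
    · right
      exact ⟨Or.inl ⟨h0.symm, hu'⟩, trivial⟩
    left
    rcases hv.1.eq_or_lt with hv0 | hvpos
    · right
      exact ⟨trivial, hv0.symm⟩
    left
    refine ⟨hu', ?_, hvpos, ?_⟩
    · have h1 := (hc β hβ1 rnd hr u hu').1
      rw [← hqdef] at h1
      exact mem_Icc_of_floor_eq hq0 hq h1 hfl
    · have h1 := abs_computed_hat_mul_sub_one_le hE hc hβ1 hr hu' hpos
      rw [← hqdef] at h1
      exact le_of_accepted P hr hg hζ hk hq hη hpos h1 hvpos hv.2 hacc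
  have hnull1 : volume ((Set.univ : Set ℝ) ×ˢ ({0} : Set ℝ)) = 0 := by
    rw [Measure.volume_eq_prod, Measure.prod_prod, Real.volume_singleton, mul_zero]
  have hnull2 : volume ((({u | h (invE.exact u) = 0} ∩ Set.Ioo (-(1 / 2) : ℝ) (1 / 2)) ∪
      {-(1 / 2), 1 / 2}) ×ˢ (Set.univ : Set ℝ)) = 0 := by
    rw [Measure.volume_eq_prod, Measure.prod_prod, measure_union_null
      (H.volume_density_eq_zero hX hXe) ((Set.toFinite _).measure_zero _), zero_mul]
  have hone : Integrable (fun _ : ℝ => (1 : ℝ)) (volume.restrict A) :=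
    integrableOn_const (by rw [hA]; simp)
  have hint : IntegrableOn (fun x => binomialMass n p k / α * (Q * (1 + η * h x))) A :=
    ((hone.add
      (H.integrable.integrableOn.const_mul η)).const_mul Q).const_mul _
  have hvol : volume (returnSet β rnd t g n p α invE hatE k) ≤
      ENNReal.ofReal (∫ x in A, binomialMass n p k / α * (Q * (1 + η * h x))) := by
    refine (measure_mono hsub).trans ((measure_union_le _ _).trans ?_)
    rw [hnull2, add_zero]
    refine (measure_union_le _ _).trans ?_
    rw [hnull1, add_zero, H.volume_below hX hXe measurableSet_Icc hφ,
      ofReal_integral_eq_lintegral_ofReal hint (Eventually.of_forall fun x => by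
        have := H.nonneg x
        positivity)]
    refine lintegral_mono fun x => ENNReal.ofReal_le_ofReal ?_
    have h0 := H.nonneg x
    rcases h0.eq_or_lt with h1 | h1
    · rw [← h1, zero_mul]; positivity
    · refine le_of_eq ?_
      simp only [φ]
      field_simp
  have hIA : ∫ x in A, binomialMass n p k / α * (Q * (1 + η * h x)) ≤
      binomialMass n p k / α * (Q * (((k : ℕ) + 1) / (1 - q) - (k : ℕ) + q * max 1 ((k : ℕ) : ℝ)
        + η)) := by
    rw [integral_const_mul, integral_const_mul, integral_add hone
      (H.integrable.integrableOn.const_mul η), integral_const_mul]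
    have h1 : ∫ x in A, h x ≤ 1 := by
      rw [← H.integral_eq_one]
      exact setIntegral_le_integral H.integrable (Eventually.of_forall H.nonneg)
    have h2 : ∫ _ in A, (1 : ℝ) = ((k : ℕ) + 1) / (1 - q) - (k : ℕ) + q * max 1 ((k : ℕ) : ℝ) := by
      have hle : ((k : ℕ) : ℝ) - q * max 1 ((k : ℕ) : ℝ) ≤ ((k : ℕ) + 1) / (1 - q) := by
        rw [le_div_iff₀ (by linarith)]
        have h3 : 0 ≤ q * max 1 ((k : ℕ) : ℝ) := by positivity
        have h4 : (0 : ℝ) ≤ (k : ℕ) := by positivity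
        nlinarith
      rw [setIntegral_const, smul_eq_mul, mul_one, hA, Real.volume_real_Icc_of_le hle]
      ring
    rw [h2]
    gcongr
    nlinarith
  have hrhs : 0 ≤ ∫ x in A, binomialMass n p k / α * (Q * (1 + η * h x)) :=
    integral_nonneg fun x => by
      have := H.nonneg x
      simp only [Pi.zero_apply]
      positivity
  unfold returnProb
  exact (ENNReal.toReal_le_of_le_ofReal hrhs hvol).trans hIA

/-- Lower bound on the probability that one iteration returns `k`. The last factor is the length of
an interval of exact quantiles that always produce the candidate `k`, less the loss due to large
values of the hat density. -/
theorem le_returnProb (P : SmallParams β n p α ζ) (H : IsHat n p α h)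
    (hE : ComputesHat h invE hatE) (hc : IsRoundingConstant invE hatE c)
    (hr : IsRoundToNearest β rnd) (hg : 0 < g + 1 / 2) (hζ : IsLanczosErrorBound t g ζ)
    {q : ℝ} (hqdef : q = c * (1 / 2 ^ β)) (hq0 : 0 ≤ q)
    (hq : q ≤ 1 / 2) (k : Fin (n + 1)) :
    binomialMass n p k / α * ((1 - q) * Real.exp (-logErr β n p ζ k) *
        ((k + 1) * (1 - q) - max ((k : ℝ) / (1 - q)) q - 125 * (1 / 2 ^ β))) ≤
      returnProb β rnd t g n p α invE hatE k := by
  have hk : (k : ℕ) ≤ n := Nat.lt_succ_iff.1 k.2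
  have hα := P.α_pos
  have hb := binomialMass_pos hk P.p_pos P.p_lt_one
  have hβ1 : 1 ≤ β := by linarith [P.β_ge]
  have hX := measurable_exact invE
  have hXe : ∀ u ∈ Set.Ioo (-(1 / 2) : ℝ) (1 / 2), invE.exact u = hatInverse h u :=
    fun u hu => (hE u hu).1
  set η : ℝ := 125 * (1 / 2 ^ β) with hηdef
  have hη0 : 0 ≤ η := by positivity
  set A : Set ℝ := Set.Ico (max (((k : ℕ) : ℝ) / (1 - q)) q) (((k : ℕ) + 1) * (1 - q)) with hA
  set Q : ℝ := (1 - q) * Real.exp (-logErr β n p ζ k) with hQ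
  have hQ0 : 0 ≤ Q := mul_nonneg (by linarith) (Real.exp_pos _).le
  let φ : ℝ → ℝ := fun x => binomialMass n p k / (α * h x) * (Q * (1 - η * h x))
  have hφ : Measurable φ := by
    have := H.measurable
    fun_prop
  have hdom : ∀ x ∈ Set.Ico ((k : ℕ) : ℝ) ((k : ℕ) + 1),
      binomialMass n p k ≤ α * h x ∧ 0 < h x := fun x hx => by
    have h1 := H.dominates k hk x hx
    exact ⟨h1, pos_of_mul_pos_right (hb.trans_le h1) hα.le⟩
  have hAk : ∀ x ∈ A, x ∈ Set.Ico ((k : ℕ) : ℝ) ((k : ℕ) + 1) := fun x hx =>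
    (floor_eq_of_mem_Ico (x' := x) hq0 hq (by simpa using hq0) hx).2
  have hsub : {w : ℝ × ℝ | w.1 ∈ Set.Ioo (-(1 / 2) : ℝ) (1 / 2) ∧ invE.exact w.1 ∈ A ∧
        w.2 ∈ Set.Ioc 0 (φ (invE.exact w.1))} ⊆ returnSet β rnd t g n p α invE hatE k := by
    rintro ⟨u, v⟩ ⟨hu, hxA, hv0, hv1⟩
    simp only at hu hxA hv0 hv1
    obtain ⟨h1, hpos⟩ := hdom _ (hAk _ hxA)
    have h2 := (hc β hβ1 rnd hr u hu).1
    rw [← hqdef] at h2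
    have h3 := abs_computed_hat_mul_sub_one_le hE hc hβ1 hr hu hpos
    rw [← hqdef] at h3
    obtain ⟨h4, h5⟩ := accepted_of_le P hr hg hζ hk hq hpos h3 h1 hv0 hv1
    exact ⟨Set.Ioo_subset_Icc_self hu, ⟨hv0.le, h4⟩, (floor_eq_of_mem_Ico hq0 hq h2 hxA).1, h5⟩
  have hone : Integrable (fun _ : ℝ => (1 : ℝ)) (volume.restrict A) :=
    integrableOn_const (by rw [hA]; simp)
  have hint : IntegrableOn (fun x => binomialMass n p k / α * (Q * (1 - η * h x))) A :=
    ((hone.sub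
      (H.integrable.integrableOn.const_mul η)).const_mul Q).const_mul _
  have hvol : ENNReal.ofReal (∫ x in A, binomialMass n p k / α * (Q * (1 - η * h x))) ≤
      volume (returnSet β rnd t g n p α invE hatE k) := by
    refine le_trans ?_ (measure_mono hsub)
    rw [H.volume_below hX hXe measurableSet_Ico hφ]
    have e1 : ∫⁻ x in A, ENNReal.ofReal (h x * φ x) =
        ∫⁻ x in A, ENNReal.ofReal (binomialMass n p k / α * (Q * (1 - η * h x))) := by
      refine setLIntegral_congr_fun measurableSet_Ico fun x hx => ?_
      have h1 := (hdom x (hAk x hx)).2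
      simp only [φ]
      congr 1
      field_simp
    rw [e1]
    refine ENNReal.ofReal_le_of_le_toReal ?_
    rw [integral_eq_lintegral_pos_part_sub_lintegral_neg_part hint]
    exact sub_le_self _ ENNReal.toReal_nonneg
  have hfin := ((volume_returnSet_le_one (β := β) (rnd := rnd) (t := t) (g := g) (p := p) (α := α)
    (invE := invE) (hatE := hatE) k).trans_lt ENNReal.one_lt_top).ne
  have h0 := (ENNReal.ofReal_le_iff_le_toReal hfin).1 hvol
  refine le_trans ?_ h0
  rw [integral_const_mul, integral_const_mul, integral_sub hone
      (H.integrable.integrableOn.const_mul η), integral_const_mul]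
  have h1 : ∫ x in A, h x ≤ 1 := by
    rw [← H.integral_eq_one]
    exact setIntegral_le_integral H.integrable (Eventually.of_forall H.nonneg)
  have h2 : ((k : ℕ) + 1) * (1 - q) - max (((k : ℕ) : ℝ) / (1 - q)) q ≤ ∫ _ in A, (1 : ℝ) := by
    rw [setIntegral_const, smul_eq_mul, mul_one, hA, measureReal_def, Real.volume_Ico]
    rw [ENNReal.toReal_ofReal']
    exact le_max_left _ _
  gcongr
  nlinarith
end ReturnProb

/-! ### Binomial sums -/

lemma sum_choose_mul_pow (n : ℕ) (x y : ℝ) :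
    ∑ k ∈ Finset.range (n + 1), (n.choose k : ℝ) * x ^ k * y ^ (n - k) = (x + y) ^ n := by
  rw [add_pow]
  exact Finset.sum_congr rfl fun k _ => by ring

lemma sum_mul_choose_mul_pow (n : ℕ) (x y : ℝ) :
    ∑ k ∈ Finset.range (n + 1), (k : ℝ) * ((n.choose k : ℝ) * x ^ k * y ^ (n - k)) =
      n * x * (x + y) ^ (n - 1) := by
  rcases n with _ | m
  · simp
  rw [Finset.sum_range_succ', Nat.cast_zero, zero_mul, add_zero, Nat.add_sub_cancel,
    ← sum_choose_mul_pow, Finset.mul_sum]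
  refine Finset.sum_congr rfl fun k _ => ?_
  have h1 : ((m + 1 : ℕ) : ℝ) * (m.choose k) = ((m + 1).choose (k + 1)) * ((k + 1 : ℕ) : ℝ) := by
    exact_mod_cast Nat.add_one_mul_choose_eq m k
  rw [Nat.add_sub_add_right, pow_succ]
  calc _ = (((m + 1).choose (k + 1)) * ((k + 1 : ℕ) : ℝ)) * (x ^ k * x * y ^ (m - k)) := by ring
    _ = _ := by rw [← h1]; ring

lemma sum_mul_binomialMass (n : ℕ) (p : ℝ) :
    ∑ k ∈ Finset.range (n + 1), (k : ℝ) * binomialMass n p k = n * p := by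
  have := sum_mul_choose_mul_pow n p (1 - p)
  rw [add_sub_cancel, one_pow, mul_one] at this
  exact this

/-- The inequality `z ^ (1 - η) ≤ z + η (1 - z)`. With `z = 1 - p` it says that weighting the binomial
mass by `(1 - p) ^ (-η (n - k))` raises its total to at most `(1 + η) ^ n`, however close `p` is to
one. -/
lemma mul_exp_neg_log_le {z η : ℝ} (hz : 0 < z) (hη : 0 ≤ η) (hη1 : η ≤ 1) :
    z * Real.exp (η * -Real.log z) ≤ z + η * (1 - z) := by
  have h := convexOn_exp.2 (Set.mem_univ (Real.log z)) (Set.mem_univ 0) (sub_nonneg.2 hη1) hη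
    (by ring)
  simp only [smul_eq_mul, mul_zero, add_zero, Real.exp_zero, mul_one, Real.exp_log hz] at h
  calc z * Real.exp (η * -Real.log z) = Real.exp ((1 - η) * Real.log z) := by
        conv_lhs => rw [← Real.exp_log hz]
        rw [← Real.exp_add, Real.log_exp]
        congr 1
        ring
    _ ≤ _ := by linarith

lemma mul_neg_log_le_one {z : ℝ} (hz : 0 < z) : z * -Real.log z ≤ 1 := by
  have h := Real.log_le_sub_one_of_pos (inv_pos.2 hz)
  rw [Real.log_inv] at h
  calc z * -Real.log z ≤ z * (z⁻¹ - 1) := by gcongr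
    _ = 1 - z := by field_simp
    _ ≤ 1 := by linarith

/-! ### Total variation after rejection -/

section TV
variable {ι : Type*} [Fintype ι]

lemma statDist_le_one {P Q : ι → ℝ} (hP : ∀ i, 0 ≤ P i) (hQ : ∀ i, 0 ≤ Q i)
    (hP1 : ∑ i, P i ≤ 1) (hQ1 : ∑ i, Q i ≤ 1) : statDist P Q ≤ 1 := by
  have h : ∑ i, |P i - Q i| ≤ ∑ i, (P i + Q i) := Finset.sum_le_sum fun i _ => by
    rw [abs_le]; constructor <;> linarith [hP i, hQ i]
  rw [Finset.sum_add_distrib] at h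
  unfold statDist
  linarith

lemma statDist_eq_sum_posPart {P Q : ι → ℝ} (h : ∑ i, P i = ∑ i, Q i) :
    statDist P Q = ∑ i, max 0 (P i - Q i) := by
  have h1 : ∀ i, |P i - Q i| = 2 * max 0 (P i - Q i) - (P i - Q i) := fun i => by
    rcases le_total 0 (P i - Q i) with h | h
    · rw [abs_of_nonneg h, max_eq_right h]; ring
    · rw [abs_of_nonpos h, max_eq_left h]; ring
  unfold statDist
  simp_rw [h1]
  rw [Finset.sum_sub_distrib, Finset.sum_sub_distrib, ← Finset.mul_sum, h]
  ring

lemma statDist_comm (P Q : ι → ℝ) : statDist P Q = statDist Q P := by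
  simp only [statDist, abs_sub_comm]

/-- Normalizing weights `R` that approximate a probability `b` does not cost a second-order term:
the distance is at most the larger of the total gain and the total loss. -/
lemma statDist_normalize_le {b R U L : ι → ℝ} {D : ℝ} (hb : ∑ i, b i = 1)
    (hR0 : ∀ i, 0 ≤ R i) (hS : 0 < ∑ i, R i) (hU : ∀ i, R i ≤ U i) (hbU : ∀ i, b i ≤ U i)
    (hL : ∀ i, L i ≤ R i) (hLb : ∀ i, L i ≤ b i) (hUD : ∑ i, U i ≤ 1 + D)
    (hLD : 1 - D ≤ ∑ i, L i) : statDist b (fun i => R i / ∑ j, R j) ≤ D := by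
  have hQ : ∑ i, R i / ∑ j, R j = 1 := by rw [← Finset.sum_div, div_self hS.ne']
  rcases le_total (∑ j, R j) 1 with h | h
  · rw [statDist_eq_sum_posPart (hb.trans hQ.symm)]
    have : ∑ i, max 0 (b i - R i / ∑ j, R j) ≤ ∑ i, (b i - L i) := by
      refine Finset.sum_le_sum fun i _ => max_le (by linarith [hLb i]) ?_
      have h1 : R i ≤ R i / ∑ j, R j := by
        rw [le_div_iff₀ hS]; nlinarith [hR0 i]
      linarith [hL i]
    rw [Finset.sum_sub_distrib] at this
    linarith
  · rw [statDist_comm, statDist_eq_sum_posPart (hQ.trans hb.symm)]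
    have : ∑ i, max 0 (R i / ∑ j, R j - b i) ≤ ∑ i, (U i - b i) := by
      refine Finset.sum_le_sum fun i _ => max_le (by linarith [hbU i]) ?_
      have h1 : R i / ∑ j, R j ≤ R i := div_le_self (hR0 i) h
      linarith [hU i]
    rw [Finset.sum_sub_distrib] at this
    linarith
end TV

/-! ### Elementary inequalities for a single trial -/

lemma exp_le_one_add_of_le {x y : ℝ} (hx0 : 0 ≤ x) (hx : x ≤ 0.48 * y) (hy : y ≤ 1) :
    Real.exp x ≤ 1 + y := by
  have h := Real.abs_exp_sub_one_sub_id_le (x := x) (by rw [abs_of_nonneg hx0]; linarith)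
  have h1 := (abs_le.1 h).2
  nlinarith

/-- If `r₀` and `r₁` are the weights of the two outcomes of a single trial, the normalized weight of
zero exceeds `1 - p` by at most `(3 p + 2) q + σ`. The bound leaves no room for the sum of
the gains of both outcomes, so the two weights are compared with each other. -/
lemma single_trial_zero_excess {p q σ δ η r₀ r₁ : ℝ} (hp : 0 < p) (hp1 : p < 1) (hq : 0 ≤ q)
    (hσ : 0 ≤ σ) (hδ : 0 ≤ δ) (hη : 0 ≤ η) (hησ : 100 * η ≤ σ)
    (hD : (3 * p + 2) * q + σ < 1) (hexp : 2 * δ + η ≤ 0.44 * σ) (hr₀ : 0 ≤ r₀) (hr₁ : 0 ≤ r₁)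
    (h₀ : r₀ ≤ (1 - p + η) * ((1 + q) * Real.exp δ * ((1 + q - q ^ 2) / (1 - q) + η)))
    (h₁ : p * (Real.exp (-δ) * (1 - 4 * q + 2 * q ^ 2 - η)) ≤ r₁) :
    (p - ((3 * p + 2) * q + σ)) * r₀ ≤ (1 - p + ((3 * p + 2) * q + σ)) * r₁ := by
  have hT0 : 0 ≤ (3 * p + 2) * q := by positivity
  -- if the bound exceeds `p`, there is nothing to prove
  rcases le_total p ((3 * p + 2) * q + σ) with hpD | hpD
  · have h1 : (p - ((3 * p + 2) * q + σ)) * r₀ ≤ 0 :=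
      mul_nonpos_of_nonpos_of_nonneg (by linarith) hr₀
    have h2 : 0 ≤ (1 - p + ((3 * p + 2) * q + σ)) * r₁ := mul_nonneg (by linarith) hr₁
    linarith
  have hq5 : q ≤ 1 / 5 := by nlinarith
  obtain ⟨N, hN⟩ : ∃ N, N = 1 + 2 * q - q ^ 3 := ⟨_, rfl⟩
  obtain ⟨M, hM⟩ : ∃ M, M = 1 - 5 * q + 6 * q ^ 2 - 2 * q ^ 3 := ⟨_, rfl⟩
  have hq3 : q ^ 3 ≤ q ^ 2 / 5 := by nlinarith [sq_nonneg q]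
  have hq30 : 0 ≤ q ^ 3 := by positivity
  have hN1 : 1 ≤ N := by rw [hN]; linarith [mul_le_mul_of_nonneg_left hq5 hq]
  have hN2 : N ≤ 1.4 := by rw [hN]; linarith
  have hM2 : 0.2 ≤ M := by rw [hM]; nlinarith
  have hT : (p - (3 * p + 2) * q) * ((1 - p) * N) ≤ (1 - p + (3 * p + 2) * q) * (p * M) := by
    have e : (1 - p + (3 * p + 2) * q) * (p * M) - (p - (3 * p + 2) * q) * ((1 - p) * N) =
      q * (p ^ 2 * ((1 - 3 * q) * (7 - 6 * q + q ^ 2))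
        - p * (4 + 2 * q - 11 * q ^ 2 + 5 * q ^ 3) + 2 * N) := by
      rw [hN, hM]; ring
    have h1 : 0 ≤ p ^ 2 * ((1 - 3 * q) * (7 - 6 * q + q ^ 2))
        - p * (4 + 2 * q - 11 * q ^ 2 + 5 * q ^ 3) + 2 * N := by
      have h2 : 0.4 * 5.8 ≤ (1 - 3 * q) * (7 - 6 * q + q ^ 2) :=
        mul_le_mul (by linarith) (by linarith [sq_nonneg q]) (by norm_num) (by linarith)
      have h3 : 4 + 2 * q - 11 * q ^ 2 + 5 * q ^ 3 ≤ 4.1 := by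
        linarith [sq_nonneg (q - 0.1)]
      have h4 := mul_le_mul_of_nonneg_left h2 (sq_nonneg p)
      have h5 := mul_le_mul_of_nonneg_left h3 hp.le
      linarith [sq_nonneg (p - 0.9)]
    have h2 := mul_nonneg hq h1
    linarith
  have hF : Real.exp (2 * δ + η) ≤ 1 + 0.64 * σ := by
    have h := Real.abs_exp_sub_one_sub_id_le (x := 2 * δ + η)
      (by rw [abs_of_nonneg (by linarith)]; linarith)
    have h1 := (abs_le.1 h).2
    nlinarith
  have hδη : Real.exp δ * (1 + η) ≤ Real.exp (-δ) * (1 + 0.64 * σ) := by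
    have h1 : 1 + η ≤ Real.exp η := by linarith [Real.add_one_le_exp η]
    have h2 : Real.exp δ * Real.exp η = Real.exp (-δ) * Real.exp (2 * δ + η) := by
      rw [← Real.exp_add, ← Real.exp_add]; congr 1; ring
    calc Real.exp δ * (1 + η) ≤ Real.exp δ * Real.exp η := by gcongr
      _ = Real.exp (-δ) * Real.exp (2 * δ + η) := h2
      _ ≤ _ := by gcongr
  obtain ⟨D, hDdef⟩ : ∃ D, D = (3 * p + 2) * q + σ := ⟨_, rfl⟩
  rw [← hDdef] at hpD hD ⊢
  have hq1 : 0 < 1 - q := by linarith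
  have hx : (1 + q) * ((1 + q - q ^ 2) / (1 - q) + η) ≤ N / (1 - q) * (1 + η) := by
    have e : N / (1 - q) = (1 + q) * ((1 + q - q ^ 2) / (1 - q)) := by
      rw [hN]; field_simp; ring
    have h1 : 1 ≤ (1 + q - q ^ 2) / (1 - q) := by
      rw [le_div_iff₀ hq1]; nlinarith
    rw [e]
    have h2 : η ≤ (1 + q - q ^ 2) / (1 - q) * η := le_mul_of_one_le_left hη h1
    have h3 : (1 + q) * η ≤ (1 + q) * ((1 + q - q ^ 2) / (1 - q) * η) := by gcongr
    linarith
  have hr0' : r₀ ≤ (1 - p + η) * (N / (1 - q) * (Real.exp (-δ) * (1 + 0.64 * σ))) := by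
    refine h₀.trans ?_
    have hz : 0 ≤ 1 - p + η := by linarith
    refine mul_le_mul_of_nonneg_left ?_ hz
    calc _ = Real.exp δ * ((1 + q) * ((1 + q - q ^ 2) / (1 - q) + η)) := by ring
      _ ≤ Real.exp δ * (N / (1 - q) * (1 + η)) := by gcongr
      _ = N / (1 - q) * (Real.exp δ * (1 + η)) := by ring
      _ ≤ _ := by gcongr
  have hcore : (p - D) * ((1 - p + η) * (N * (1 + 0.64 * σ))) ≤
      (1 - p + D) * (p * (M - η)) := by
    have e1 : (p - D) * ((1 - p + η) * (N * (1 + 0.64 * σ))) =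
        (p - (3 * p + 2) * q) * ((1 - p) * N) - σ * ((1 - p) * N) * (1 - 0.64 * (p - D))
          + η * ((p - D) * N * (1 + 0.64 * σ)) := by
      rw [hDdef]; ring
    have e2 : (1 - p + D) * (p * (M - η)) = (1 - p + (3 * p + 2) * q) * (p * M) + σ * (p * M)
        - η * ((1 - p + D) * p) := by
      rw [hDdef]; ring
    have hD0 : 0 ≤ D := by rw [hDdef]; linarith
    have hσ1 : σ ≤ 1 := by linarith
    have h1 : η * ((p - D) * N * (1 + 0.64 * σ)) ≤ η * 2.3 := by
      refine mul_le_mul_of_nonneg_left ?_ hη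
      calc (p - D) * N * (1 + 0.64 * σ) ≤ 1 * 1.4 * (1 + 0.64 * 1) := by gcongr; linarith
        _ ≤ 2.3 := by norm_num
    have h2 : η * ((1 - p + D) * p) ≤ η * 1 := by
      exact mul_le_mul_of_nonneg_left
        (mul_le_one₀ (by linarith only [hpD]) hp.le hp1.le) hη
    have h3 : σ * ((1 - p) * 0.36) ≤ σ * ((1 - p) * N) * (1 - 0.64 * (p - D)) := by
      rw [mul_assoc]
      refine mul_le_mul_of_nonneg_left ?_ hσ
      have h4 : 1 * 0.36 ≤ N * (1 - 0.64 * (p - D)) := by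
        apply mul_le_mul hN1 _ (by norm_num) (by linarith)
        linarith
      have := mul_le_mul_of_nonneg_left h4 (sub_nonneg.2 hp1.le)
      linarith
    have h5 : σ * (p * 0.2) ≤ σ * (p * M) := by gcongr
    have h6 : σ * p ≤ σ * 1 := mul_le_mul_of_nonneg_left hp1.le hσ
    rw [e1, e2]
    linarith only [hT, h1, h2, h3, h5, h6, hησ, hσ]
  have hz0 : 0 ≤ 1 - p + D := by
    have : 0 ≤ D := by rw [hDdef]; linarith
    linarith
  have hMη : Real.exp (-δ) * (M - η) / (1 - q) ≤ Real.exp (-δ) * (1 - 4 * q + 2 * q ^ 2 - η) := by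
    rw [mul_div_assoc]
    refine mul_le_mul_of_nonneg_left ?_ (Real.exp_pos _).le
    rw [div_le_iff₀ hq1, hM]
    linarith only [mul_nonneg hq hη]
  calc (p - D) * r₀ ≤ (p - D) * ((1 - p + η) * (N / (1 - q) * (Real.exp (-δ) * (1 + 0.64 * σ)))) :=
        mul_le_mul_of_nonneg_left hr0' (by linarith)
    _ = (p - D) * ((1 - p + η) * (N * (1 + 0.64 * σ))) * (Real.exp (-δ) / (1 - q)) := by
        field_simp
    _ ≤ (1 - p + D) * (p * (M - η)) * (Real.exp (-δ) / (1 - q)) := by gcongr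
    _ = (1 - p + D) * (p * (Real.exp (-δ) * (M - η) / (1 - q))) := by ring
    _ ≤ (1 - p + D) * (p * (Real.exp (-δ) * (1 - 4 * q + 2 * q ^ 2 - η))) := by gcongr
    _ ≤ _ := by gcongr

/-- The counterpart of `single_trial_zero_excess` for the other outcome: the normalized weight of one
exceeds `p` by at most `(3 p + 2) q + σ`. -/
lemma single_trial_one_excess {p q σ δ η μ r₀ r₁ : ℝ} (hp : 0 < p) (hp1 : p < 1) (hq : 0 ≤ q)
    (hσ : 0 ≤ σ) (hδ : 0 ≤ δ) (hη : 0 ≤ η) (hησ : 100 * η ≤ σ) (hμ0 : 0 ≤ μ)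
    (hD : (3 * p + 2) * q + σ < 1)
    (hexp : (3 * p + 2) * q + σ ≤ 1 - p → 2 * δ + μ + η ≤ 0.48 * σ) (hr₀ : 0 ≤ r₀) (hr₁ : 0 ≤ r₁)
    (h₁ : r₁ ≤ p * ((1 + q) * Real.exp δ * ((1 + 2 * q - q ^ 2) / (1 - q) + η)))
    (h₀ : (1 - p) * ((1 - q) * Real.exp (-(δ + μ)) * (1 - 2 * q - η)) ≤ r₀) :
    (1 - p - ((3 * p + 2) * q + σ)) * r₁ ≤ (p + ((3 * p + 2) * q + σ)) * r₀ := by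
  have hT0 : 0 ≤ (3 * p + 2) * q := by positivity
  rcases le_total (1 - p) ((3 * p + 2) * q + σ) with hpD | hpD
  · have h1 : (1 - p - ((3 * p + 2) * q + σ)) * r₁ ≤ 0 :=
      mul_nonpos_of_nonpos_of_nonneg (by linarith) hr₁
    have h2 : 0 ≤ (p + ((3 * p + 2) * q + σ)) * r₀ := mul_nonneg (by linarith) hr₀
    linarith
  have hσ1 : σ ≤ 1 := by linarith
  have hq2 : 2 * q + σ < 1 := by nlinarith [mul_nonneg hp.le hq]
  have hq1 : 0 < 1 - q := by linarith
  obtain ⟨N, hN⟩ : ∃ N, N = (1 + q) * (1 + 2 * q - q ^ 2) := ⟨_, rfl⟩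
  have hqq : 0 ≤ q ^ 2 := sq_nonneg q
  have hN1 : 1 ≤ N := by rw [hN]; nlinarith
  have hpq : p * (1 + 3 * q) ≤ 1 - 2 * q := by nlinarith
  have hpN1 : p * (1 + 3 * q - 2 * q ^ 2) ≤ (1 - q) ^ 2 := by
    have h1 : (1 + 3 * q) * (p * (1 + 3 * q - 2 * q ^ 2)) ≤ (1 + 3 * q) * (1 - q) ^ 2 := by
      have h2 : p * (1 + 3 * q) * (1 + 3 * q - 2 * q ^ 2) ≤
          (1 - 2 * q) * (1 + 3 * q - 2 * q ^ 2) := by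
        apply mul_le_mul_of_nonneg_right hpq; nlinarith
      nlinarith [pow_nonneg hq 3]
    exact le_of_mul_le_mul_left h1 (by linarith)
  have hpN2 : p * N ≤ (p + (3 * p + 2) * q) * (1 - q) ^ 2 := by
    have e : (p + (3 * p + 2) * q) * (1 - q) ^ 2 - p * N =
        2 * q * ((1 - q) ^ 2 - p * (1 + 3 * q - 2 * q ^ 2)) := by
      rw [hN]; ring
    have := mul_nonneg (by positivity : 0 ≤ 2 * q) (sub_nonneg.2 hpN1)
    linarith
  have hpN3 : p * N ≤ (1 - q) ^ 2 := by
    refine hpN2.trans ?_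
    have : p + (3 * p + 2) * q ≤ 1 := by linarith
    nlinarith [sq_nonneg (1 - q)]
  have hF := exp_le_one_add_of_le (by linarith) (hexp hpD) hσ1
  have hδη : Real.exp δ * (1 + η) ≤ Real.exp (-(δ + μ)) * (1 + σ) := by
    have h1 : 1 + η ≤ Real.exp η := by linarith [Real.add_one_le_exp η]
    have h2 : Real.exp δ * Real.exp η = Real.exp (-(δ + μ)) * Real.exp (2 * δ + μ + η) := by
      rw [← Real.exp_add, ← Real.exp_add]; congr 1; ring
    calc Real.exp δ * (1 + η) ≤ Real.exp δ * Real.exp η := by gcongr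
      _ = Real.exp (-(δ + μ)) * Real.exp (2 * δ + μ + η) := h2
      _ ≤ _ := by gcongr
  obtain ⟨D, hDdef⟩ : ∃ D, D = (3 * p + 2) * q + σ := ⟨_, rfl⟩
  rw [← hDdef] at hpD ⊢
  have hx : (1 + q) * ((1 + 2 * q - q ^ 2) / (1 - q) + η) ≤ N / (1 - q) * (1 + η) := by
    have e : N / (1 - q) = (1 + q) * ((1 + 2 * q - q ^ 2) / (1 - q)) := by
      rw [hN]; ring
    have h1 : 1 ≤ (1 + 2 * q - q ^ 2) / (1 - q) := by
      rw [le_div_iff₀ hq1]; nlinarith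
    rw [e]
    have h2 : η ≤ (1 + 2 * q - q ^ 2) / (1 - q) * η := le_mul_of_one_le_left hη h1
    have h3 : (1 + q) * η ≤ (1 + q) * ((1 + 2 * q - q ^ 2) / (1 - q) * η) := by gcongr
    linarith
  have hr1' : r₁ ≤ p * (N / (1 - q) * (Real.exp (-(δ + μ)) * (1 + σ))) := by
    refine h₁.trans (mul_le_mul_of_nonneg_left ?_ hp.le)
    calc _ = Real.exp δ * ((1 + q) * ((1 + 2 * q - q ^ 2) / (1 - q) + η)) := by ring
      _ ≤ Real.exp δ * (N / (1 - q) * (1 + η)) := by gcongr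
      _ = N / (1 - q) * (Real.exp δ * (1 + η)) := by ring
      _ ≤ _ := by gcongr
  have hzD : 1 - p - D ≤ (1 - p) * (1 - 2 * q - η) := by
    rw [hDdef]; nlinarith [mul_nonneg hp.le hq, mul_nonneg hp.le hη]
  have hcore : p * N * (1 + σ) ≤ (p + D) * (1 - q) ^ 2 := by
    have := mul_le_mul_of_nonneg_left hpN3 hσ
    rw [hDdef]; nlinarith
  have hpD0 : 0 ≤ p + D := by rw [hDdef]; linarith
  calc (1 - p - D) * r₁ ≤ (1 - p - D) * (p * (N / (1 - q) * (Real.exp (-(δ + μ)) * (1 + σ)))) :=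
        mul_le_mul_of_nonneg_left hr1' (by linarith)
    _ = (1 - p - D) * ((p * N * (1 + σ)) * (Real.exp (-(δ + μ)) / (1 - q))) := by ring
    _ ≤ ((1 - p) * (1 - 2 * q - η)) * (((p + D) * (1 - q) ^ 2) *
        (Real.exp (-(δ + μ)) / (1 - q))) := by
      gcongr
      linarith
    _ = (p + D) * ((1 - p) * ((1 - q) * Real.exp (-(δ + μ)) * (1 - 2 * q - η))) := by
        field_simp
    _ ≤ _ := by gcongr

/-! ### The output distribution of the sampler -/

section Main
variable {β n t : ℕ} {p α ζ g c : ℝ} {h rnd : ℝ → ℝ} {invE hatE : ArithExpr}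

lemma returnProb_nonneg (k : Fin (n + 1)) : 0 ≤ returnProb β rnd t g n p α invE hatE k :=
  ENNReal.toReal_nonneg

/-- The rejection loop normalizes the return probabilities. -/
lemma binSamp_eq_div (hr : IsRoundToNearest β rnd)
    (hS : 0 < ∑ j, returnProb β rnd t g n p α invE hatE j) (k : Fin (n + 1)) :
    binSamp β rnd t g n p α invE hatE k = returnProb β rnd t g n p α invE hatE k /
      ∑ j, returnProb β rnd t g n p α invE hatE j := by
  have h1 := sum_returnProb_le_one (t := t) (g := g) (n := n) (p := p) (α := α) (invE := invE)
    (hatE := hatE) hr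
  unfold binSamp
  rw [tsum_mul_right, tsum_geometric_of_lt_one (by linarith) (by linarith), sub_sub_cancel,
    div_eq_inv_mul]

lemma binSamp_nonneg_and_sum_le_one (hr : IsRoundToNearest β rnd) :
    (∀ k, 0 ≤ binSamp β rnd t g n p α invE hatE k) ∧
      ∑ k, binSamp β rnd t g n p α invE hatE k ≤ 1 := by
  rcases (Finset.sum_nonneg fun k _ => returnProb_nonneg (β := β) (rnd := rnd) (t := t) (g := g)
    (n := n) (p := p) (α := α) (invE := invE) (hatE := hatE) k).eq_or_lt with h0 | hS
  · have h1 : ∀ k, returnProb β rnd t g n p α invE hatE k = 0 := fun k =>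
      (Finset.sum_eq_zero_iff_of_nonneg fun k _ => returnProb_nonneg k).1 h0.symm k
        (Finset.mem_univ k)
    have h2 : ∀ k, binSamp β rnd t g n p α invE hatE k = 0 := fun k => by
      simp [binSamp, h1]
    simp [h2]
  · simp_rw [binSamp_eq_div hr hS]
    refine ⟨fun k => div_nonneg (returnProb_nonneg k) hS.le, ?_⟩
    rw [← Finset.sum_div, div_self hS.ne']

lemma sum_fin_binomialMass (n : ℕ) (p : ℝ) : ∑ k : Fin (n + 1), binomialMass n p k = 1 := by
  rw [Fin.sum_univ_eq_sum_range (binomialMass n p) (n + 1), sum_binomialMass]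

/-- Normalized weights close to the binomial mass, for at least two trials. The relative error of
the weight of `k` grows with `k` and `n - k`; averaging it over the binomial distribution gives the
factor `n p` in place of `n`. Two trials are needed to absorb terms in `q` alone into `2 q n`. -/
lemma statDist_weights_le {q σ δ η Λ : ℝ} (hn : 2 ≤ n) (hp : 0 < p) (hp1 : p < 1)
    (hΛ : Λ = -Real.log (1 - p)) (hq : 0 ≤ q) (hδ : 0 ≤ δ) (hη : 0 ≤ η)
    (hησ : 100 * η ≤ σ) (hδσ : δ + η * n ≤ 0.24 * σ)
    (hD : q * ((3 * p + 2) * n) + σ < 1) {R : Fin (n + 1) → ℝ} (hR0 : ∀ k, 0 ≤ R k)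
    (hS : 0 < ∑ k, R k)
    (hU : ∀ k : Fin (n + 1), R k ≤ binomialMass n p k * ((1 + q) * Real.exp (δ + η * ((n - k : ℕ) * Λ)) *
      ((k + 1) / (1 - q) - k + q * max 1 (k : ℝ) + η)))
    (hL : ∀ k : Fin (n + 1), binomialMass n p k * ((1 - q) * Real.exp (-(δ + η * ((n - k : ℕ) * Λ))) *
      ((k + 1) * (1 - q) - max ((k : ℝ) / (1 - q)) q - η)) ≤ R k) :
    statDist (fun k : Fin (n + 1) => binomialMass n p k) (fun k => R k / ∑ j, R j) ≤
      q * ((3 * p + 2) * n) + σ := by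
  have hz : 0 < 1 - p := by linarith
  have hn2 : (2 : ℝ) ≤ n := by exact_mod_cast hn
  have hΛ0 : 0 ≤ Λ := by
    rw [hΛ]; linarith [Real.log_nonpos hz.le (by linarith : 1 - p ≤ 1)]
  have hσ : 0 ≤ σ := by linarith
  have hnp : 0 < n * p := by positivity
  have hqn : 0 ≤ q * (n * p) := by positivity
  have hq2n : q * 4 ≤ q * (2 * n) := by gcongr; linarith
  have hD' : 3 * (q * (n * p)) + q * (2 * n) + σ < 1 := by linarith
  have hq4 : q ≤ 1 / 4 := by linarith
  have hq1 : 0 < 1 - q := by linarith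
  have hη1 : η ≤ 1 := by linarith
  have hinv : ∀ x : ℝ, 0 ≤ x → x / (1 - q) ≤ x + 4 / 3 * q * x := fun x hx => by
    rw [div_le_iff₀ hq1]
    nlinarith [mul_nonneg (mul_nonneg hq hx) (by linarith : 0 ≤ 1 / 4 - q)]
  have hb : ∀ k : Fin (n + 1), 0 < binomialMass n p k := fun k =>
    binomialMass_pos (Nat.lt_succ_iff.1 k.2) hp hp1
  have hE : ∀ k : Fin (n + 1), 0 ≤ δ + η * ((n - k : ℕ) * Λ) := fun k => by positivity
  set ρ : ℝ := 7 / 3 * q with hρ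
  have hρ0 : 0 ≤ ρ := by positivity
  have hmax : ∀ k : Fin (n + 1), max 1 (((k : ℕ) : ℝ)) ≤ (k : ℕ) + 1 := fun k =>
    max_le (by linarith [(Nat.cast_nonneg (k : ℕ) : (0 : ℝ) ≤ _)]) (by linarith)
  refine statDist_normalize_le
    (U := fun k : Fin (n + 1) => binomialMass n p k * ((1 + q) * Real.exp (δ + η * ((n - k : ℕ) * Λ)) *
      (1 + ρ * (k + 1) + η)))
    (L := fun k : Fin (n + 1) => binomialMass n p k * (1 - (q + (δ + η * ((n - k : ℕ) * Λ)) +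
      (ρ * k + 2 * q + η)))) (sum_fin_binomialMass n p) hR0 hS ?_ ?_ ?_ ?_ ?_ ?_
  · intro k
    have hk0 : (0 : ℝ) ≤ (k : ℕ) := Nat.cast_nonneg _
    refine (hU k).trans (mul_le_mul_of_nonneg_left (mul_le_mul_of_nonneg_left ?_ (by positivity))
      (hb k).le)
    have h1 := hinv ((k : ℕ) + 1) (by positivity)
    have h2 := mul_le_mul_of_nonneg_left (hmax k) hq
    rw [hρ]
    linarith
  · intro k
    have hk0 : (0 : ℝ) ≤ (k : ℕ) := Nat.cast_nonneg _
    refine le_mul_of_one_le_right (hb k).le ?_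
    have h1 : 1 ≤ Real.exp (δ + η * ((n - k : ℕ) * Λ)) := Real.one_le_exp (hE k)
    have h2 : 0 ≤ ρ * ((k : ℕ) + 1) := by positivity
    exact one_le_mul_of_one_le_of_one_le (one_le_mul_of_one_le_of_one_le (by linarith) h1)
      (by linarith)
  · intro k
    have hk0 : (0 : ℝ) ≤ (k : ℕ) := Nat.cast_nonneg _
    obtain ⟨E, hEdef⟩ : ∃ E, E = δ + η * ((n - k : ℕ) * Λ) := ⟨_, rfl⟩
    obtain ⟨s, hs⟩ : ∃ s, s = ρ * ((k : ℕ) : ℝ) + 2 * q + η := ⟨_, rfl⟩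
    have hE0 : 0 ≤ E := hEdef ▸ hE k
    have hs0 : 0 ≤ s := by rw [hs]; positivity
    have hLk := hL k
    rw [← hEdef] at hLk ⊢
    rw [← hs]
    by_cases hneg : 1 - (q + E + s) ≤ 0
    · exact (mul_nonpos_of_nonneg_of_nonpos (hb k).le hneg).trans (hR0 k)
    push Not at hneg
    refine le_trans (mul_le_mul_of_nonneg_left ?_ (hb k).le) hLk
    have h1 := hinv ((k : ℕ)) hk0
    have h2 : 1 - s ≤ ((k : ℕ) + 1) * (1 - q) - max (((k : ℕ) : ℝ) / (1 - q)) q - η := by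
      have : max (((k : ℕ) : ℝ) / (1 - q)) q ≤ (k : ℕ) + 4 / 3 * q * (k : ℕ) + q :=
        max_le (by linarith) (by linarith [mul_nonneg hq hk0])
      rw [hs, hρ]
      linarith
    have h3 : 1 - E ≤ Real.exp (-E) := by linarith [Real.add_one_le_exp (-E)]
    have h4 : 0 ≤ q * E := mul_nonneg hq hE0
    have h5 : 1 - (q + E) ≤ (1 - q) * Real.exp (-E) :=
      le_trans (by linarith) (mul_le_mul_of_nonneg_left h3 hq1.le)
    calc 1 - (q + E + s) ≤ (1 - (q + E)) * (1 - s) := by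
          linarith [mul_nonneg (add_nonneg hq hE0) hs0]
      _ ≤ _ := mul_le_mul h5 h2 (by linarith) (mul_nonneg hq1.le (Real.exp_pos _).le)
  · intro k
    have hk0 : (0 : ℝ) ≤ (k : ℕ) := Nat.cast_nonneg _
    have h1 : 0 ≤ ρ * ((k : ℕ) : ℝ) := by positivity
    exact mul_le_of_le_one_right (hb k).le (by linarith [hE k])
  · obtain ⟨y, hy⟩ : ∃ y, y = (1 - p) * Real.exp (η * Λ) := ⟨_, rfl⟩
    have hy0 : 0 < y := by rw [hy]; positivity
    have hy1 : p + y ≤ 1 + η := by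
      have h1 := mul_exp_neg_log_le hz hη hη1
      rw [← hΛ, ← hy] at h1
      nlinarith
    have hterm : ∀ k : Fin (n + 1), binomialMass n p k * ((1 + q) *
        Real.exp (δ + η * ((n - k : ℕ) * Λ)) * (1 + ρ * (k + 1) + η)) =
        (1 + q) * Real.exp δ * ((1 + ρ + η) * ((n.choose k : ℝ) * p ^ (k : ℕ) * y ^ (n - (k : ℕ))) +
          ρ * (((k : ℕ) : ℝ) * ((n.choose k : ℝ) * p ^ (k : ℕ) * y ^ (n - (k : ℕ))))) := fun k => by
      have h1 : Real.exp (δ + η * ((n - k : ℕ) * Λ)) =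
          Real.exp δ * Real.exp (η * Λ) ^ (n - (k : ℕ)) := by
        rw [Real.exp_add, ← Real.exp_nat_mul]
        congr 2
        ring
      rw [h1, hy, mul_pow, binomialMass]
      ring
    rw [Finset.sum_congr rfl fun k _ => hterm k, ← Finset.mul_sum, Finset.sum_add_distrib,
      ← Finset.mul_sum, ← Finset.mul_sum,
      Fin.sum_univ_eq_sum_range (fun k => (n.choose k : ℝ) * p ^ k * y ^ (n - k)) (n + 1),
      Fin.sum_univ_eq_sum_range (fun k => (k : ℝ) * ((n.choose k : ℝ) * p ^ k * y ^ (n - k)))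
        (n + 1), sum_choose_mul_pow, sum_mul_choose_mul_pow]
    have hpow : (p + y) ^ n ≤ Real.exp (η * n) := by
      calc (p + y) ^ n ≤ (Real.exp η) ^ n := by
            gcongr; linarith [Real.add_one_le_exp η]
        _ = _ := by rw [← Real.exp_nat_mul, mul_comm]
    have hpow2 : (p + y) ^ (n - 1) ≤ Real.exp (η * n) := by
      calc (p + y) ^ (n - 1) ≤ (Real.exp η) ^ (n - 1) := by
            gcongr; linarith [Real.add_one_le_exp η]
        _ ≤ (Real.exp η) ^ n := pow_le_pow_right₀ (Real.one_le_exp hη) (Nat.sub_le _ _)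
        _ = _ := by rw [← Real.exp_nat_mul, mul_comm]
    have hexp : Real.exp δ * Real.exp (η * n) ≤ 1 + 0.4 * σ := by
      rw [← Real.exp_add]
      have hx0 : 0 ≤ δ + η * n := by positivity
      have h := Real.abs_exp_sub_one_sub_id_le (x := δ + η * n)
        (by rw [abs_of_nonneg hx0]; linarith)
      have h1 := (abs_le.1 h).2
      nlinarith
    have hA : (1 + q) * ((1 + ρ + η) + ρ * (n * p)) ≤
        1 + q * ((3 * p + 2) * n) + 1.25 * η := by
      have h1 : q * (q * (n * p)) ≤ 1 / 4 * (q * (n * p)) := by gcongr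
      have h2 : q * q ≤ 1 / 4 * q := by gcongr
      have h3 : q * η ≤ 1 / 4 * η := by gcongr
      rw [hρ]
      linarith
    have hT0 : 0 ≤ q * ((3 * p + 2) * n) := by positivity
    calc _ ≤ (1 + q) * Real.exp δ * ((1 + ρ + η) * Real.exp (η * n) +
          ρ * (n * p * Real.exp (η * n))) := by gcongr
      _ = ((1 + q) * ((1 + ρ + η) + ρ * (n * p))) * (Real.exp δ * Real.exp (η * n)) := by ring
      _ ≤ (1 + q * ((3 * p + 2) * n) + 1.25 * η) * (1 + 0.4 * σ) := by gcongr
      _ ≤ 1 + (q * ((3 * p + 2) * n) + σ) := by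
        have h1 : (q * ((3 * p + 2) * n)) * σ ≤ 1 * σ := by gcongr; linarith
        have h2 : η * σ ≤ η * 1 := by gcongr; linarith
        linarith
  · have hterm : ∀ k : Fin (n + 1), binomialMass n p k * (1 - (q + (δ + η * ((n - k : ℕ) * Λ)) +
        (ρ * k + 2 * q + η))) = (1 - 3 * q - δ - η - η * n * Λ) * binomialMass n p k +
          (η * Λ - ρ) * (((k : ℕ) : ℝ) * binomialMass n p k) := fun k => by
      have : ((n - (k : ℕ) : ℕ) : ℝ) = n - (k : ℕ) := by
        push_cast [Nat.lt_succ_iff.1 k.2]; ring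
      rw [this]
      ring
    rw [Finset.sum_congr rfl fun k _ => hterm k, Finset.sum_add_distrib,
      ← Finset.mul_sum, ← Finset.mul_sum, sum_fin_binomialMass,
      Fin.sum_univ_eq_sum_range (fun k => (k : ℝ) * binomialMass n p k) (n + 1),
      sum_mul_binomialMass]
    have h1 := mul_neg_log_le_one hz
    rw [← hΛ] at h1
    have h2 := mul_le_mul_of_nonneg_left h1 (by positivity : 0 ≤ η * n)
    rw [hρ]
    linarith

/-- Normalized weights for a single trial, where the terms in `q` alone are not dominated by the
bound and the two outcomes are compared directly. -/
lemma statDist_weights_one_le {q σ δ η Λ : ℝ} (hp : 0 < p) (hp1 : p < 1)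
    (hΛ : Λ = -Real.log (1 - p)) (hq : 0 ≤ q) (hδ : 0 ≤ δ) (hη : 0 ≤ η)
    (hησ : 100 * η ≤ σ) (hδσ : 2 * δ + η ≤ 0.44 * σ)
    (hΛσ : (3 * p + 2) * q + σ ≤ 1 - p → 2 * δ + η * Λ + η ≤ 0.48 * σ)
    (hD : (3 * p + 2) * q + σ < 1) {R : Fin 2 → ℝ} (hR0 : ∀ k, 0 ≤ R k)
    (hS : 0 < ∑ k, R k)
    (hU : ∀ k : Fin 2, R k ≤ binomialMass 1 p k * ((1 + q) * Real.exp (δ + η * ((1 - k : ℕ) * Λ)) *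
      ((k + 1) / (1 - q) - k + q * max 1 (k : ℝ) + η)))
    (hL : ∀ k : Fin 2, binomialMass 1 p k * ((1 - q) * Real.exp (-(δ + η * ((1 - k : ℕ) * Λ))) *
      ((k + 1) * (1 - q) - max ((k : ℝ) / (1 - q)) q - η)) ≤ R k) :
    statDist (fun k : Fin 2 => binomialMass 1 p k) (fun k => R k / ∑ j, R j) ≤
      (3 * p + 2) * q + σ := by
  have hz : 0 < 1 - p := by linarith
  have hσ : 0 ≤ σ := by linarith
  have hΛ0 : 0 ≤ Λ := by
    rw [hΛ]; linarith [Real.log_nonpos hz.le (by linarith : 1 - p ≤ 1)]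
  have hq2 : 2 * q + σ < 1 := by nlinarith [mul_nonneg hp.le hq]
  have hq1 : 0 < 1 - q := by linarith
  have hU0 := hU 0
  have hU1 := hU 1
  have hL0 := hL 0
  have hL1 := hL 1
  simp only [binomialMass, Fin.isValue, Fin.coe_ofNat_eq_mod, Nat.zero_mod, Nat.choose_zero_right,
    Nat.cast_one, pow_zero, mul_one, Nat.sub_zero, pow_one, one_mul, Nat.cast_zero, zero_add,
    sub_zero, zero_le_one, sup_of_le_left, zero_div, Nat.mod_succ, Nat.choose_self, Nat.sub_self,
    zero_mul, mul_zero, add_zero, max_self] at hU0 hU1 hL0 hL1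
  rw [max_eq_right hq] at hL0
  have h1q : 1 ≤ 1 / (1 - q) := by rw [le_div_iff₀ hq1]; linarith
  rw [max_eq_left (by linarith)] at hL1
  have hr0 : R 0 ≤ (1 - p + η) * ((1 + q) * Real.exp δ * ((1 + q - q ^ 2) / (1 - q) + η)) := by
    have h1 := mul_exp_neg_log_le hz hη (by linarith)
    rw [← hΛ] at h1
    have e : (1 + q - q ^ 2) / (1 - q) = 1 / (1 - q) + q := by field_simp; ring
    rw [Real.exp_add] at hU0
    calc R 0 ≤ ((1 - p) * Real.exp (η * Λ)) * ((1 + q) * Real.exp δ *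
          ((1 + q - q ^ 2) / (1 - q) + η)) := by rw [e]; linarith
      _ ≤ _ := by
        gcongr
        · rw [e]; positivity
        · nlinarith
  have hr1 : R 1 ≤ p * ((1 + q) * Real.exp δ * ((1 + 2 * q - q ^ 2) / (1 - q) + η)) := by
    have e : (1 + 2 * q - q ^ 2) / (1 - q) = (1 + 1) / (1 - q) - 1 + q := by field_simp; ring
    rw [e]
    linarith
  have hl1 : p * (Real.exp (-δ) * (1 - 4 * q + 2 * q ^ 2 - η)) ≤ R 1 := by
    refine le_trans ?_ hL1
    have e : (1 - q) * Real.exp (-δ) * ((1 + 1) * (1 - q) - 1 / (1 - q) - η) =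
        Real.exp (-δ) * (1 - 4 * q + 2 * q ^ 2 - η + q * η) := by
      field_simp; ring
    rw [e]
    gcongr
    linarith [mul_nonneg hq hη]
  have hl0 : (1 - p) * ((1 - q) * Real.exp (-(δ + η * Λ)) * (1 - 2 * q - η)) ≤ R 0 := by
    refine le_trans (le_of_eq ?_) hL0
    ring
  have k1 := single_trial_zero_excess hp hp1 hq hσ hδ hη hησ hD hδσ (hR0 0) (hR0 1) hr0 hl1
  have k2 := single_trial_one_excess hp hp1 hq hσ hδ hη hησ (by positivity) hD hΛσ (hR0 0) (hR0 1)
    hr1 hl0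
  rw [Fin.sum_univ_two] at hS
  unfold statDist
  rw [Fin.sum_univ_two, Fin.sum_univ_two]
  simp only [binomialMass, Fin.isValue, Fin.coe_ofNat_eq_mod, Nat.zero_mod, Nat.choose_zero_right,
    Nat.cast_one, pow_zero, mul_one, Nat.sub_zero, pow_one, one_mul, Nat.mod_succ, Nat.choose_self,
    Nat.sub_self]
  obtain ⟨x, hx⟩ : ∃ x, x = R 0 / (R 0 + R 1) := ⟨_, rfl⟩
  have hx1 : R 1 / (R 0 + R 1) = 1 - x := by rw [hx]; field_simp; ring
  rw [hx1, ← hx]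
  have hxu : x ≤ 1 - p + ((3 * p + 2) * q + σ) := by
    rw [hx, div_le_iff₀ hS]; linarith
  have hxl : 1 - p - ((3 * p + 2) * q + σ) ≤ x := by
    rw [hx, le_div_iff₀ hS]; linarith
  have h1 : |1 - p - x| ≤ (3 * p + 2) * q + σ := abs_le.2 ⟨by linarith, by linarith⟩
  have h2 : |p - (1 - x)| = |1 - p - x| := by
    rw [← abs_neg]; congr 1; ring
  rw [h2]
  linarith

/-- The parameters are in the asymptotic regime as soon as the claimed bound is below one. In
particular `1110 β ε < 1` forces `β ≥ 14`, and `(2 / 3) α ε < 1` bounds `log α`. -/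
lemma smallParams_of_bound_lt_one (hn : 1 ≤ n) (hp : 0 < p) (hp1 : p < 1) (hα : 1 ≤ α)
    (hc : 2 / 3 ≤ c) (hζ : 0 ≤ ζ)
    (hβ : max (2 * ⌈Real.logb 2 n⌉) ⌈-Real.logb 2 p⌉ ≤ (β : ℤ))
    (hD : (1110 * β + 3 * c * p + c + α * c) * n * (1 / 2 ^ β) + 15 * ζ < 1) :
    SmallParams β n p α ζ := by
  have hε : (0 : ℝ) < 1 / 2 ^ β := by positivity
  have hn1 : (1 : ℝ) ≤ n := by exact_mod_cast hn
  have hl2 := Real.log_two_lt_d9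
  have hl2' := Real.log_two_gt_d9
  have hβn := (le_max_left _ _).trans hβ
  have hβp := (le_max_right _ _).trans hβ
  have hnε : 1 * (1 / 2 ^ β : ℝ) ≤ n * (1 / 2 ^ β) := by gcongr
  have hβ0 : (0 : ℝ) ≤ β := Nat.cast_nonneg β
  have hc0 : 0 < c := by linarith
  have e : (1110 * β + 3 * c * p + c + α * c) * n * (1 / 2 ^ β) =
      1110 * (n * β * (1 / 2 ^ β)) + (3 * c * p + c) * (n * (1 / 2 ^ β)) +
        α * c * (n * (1 / 2 ^ β)) := by ring
  rw [e] at hD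
  have p1 : 0 ≤ 1110 * (n * β * (1 / 2 ^ β) : ℝ) := by positivity
  have p2 : 0 ≤ (3 * c * p + c) * (n * (1 / 2 ^ β) : ℝ) := by positivity
  have p3 : 0 ≤ α * c * (n * (1 / 2 ^ β) : ℝ) := by positivity
  have hlogp : -Real.logb 2 p ≤ β := by
    have := (Int.le_ceil (-Real.logb 2 p)).trans (Int.cast_le.2 hβp)
    exact_mod_cast this
  have hlogn : 2 * Real.logb 2 n ≤ β := by
    have h1 : (2 * ⌈Real.logb 2 n⌉ : ℝ) ≤ β := by exact_mod_cast hβn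
    linarith [Int.le_ceil (Real.logb 2 n)]
  have hβ14 : 14 ≤ β := by
    by_contra! hlt
    have hβ1 : 1 ≤ β := by
      by_contra! h0
      have h00 : β = 0 := by omega
      rw [h00, Nat.cast_zero] at hlogp
      have := Real.logb_neg (b := 2) (by norm_num) hp hp1
      linarith
    have hw : 1110 * (β * (1 / 2 ^ β) : ℝ) < 1 := by
      have h1 : (β : ℝ) * (1 * (1 / 2 ^ β)) ≤ β * (n * (1 / 2 ^ β)) := by gcongr
      linarith
    clear hβ hβn hβp
    interval_cases β <;> norm_num at hw
  have hβ14' : (14 : ℝ) ≤ β := by exact_mod_cast hβ14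
  refine ⟨hβ14, hn, hp, hp1, ?_, ?_, by linarith, Real.log_nonneg hα, ?_, by linarith,
    by linarith⟩
  · rw [Real.logb, ← mul_div_assoc, div_le_iff₀ (by linarith)] at hlogn
    nlinarith
  · rw [Real.logb, ← neg_div, div_le_iff₀ (by linarith)] at hlogp
    nlinarith
  · have h1 : α * (2 / 3) * (1 / 2 ^ β : ℝ) ≤ α * c * (n * (1 / 2 ^ β)) := by
      have : (1 / 2 ^ β : ℝ) ≤ n * (1 / 2 ^ β) := by linarith
      gcongr
    have h2 : α ≤ 3 / 2 * 2 ^ β := by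
      have h3 : α * (2 / 3) * (1 / 2 ^ β : ℝ) < 1 := by linarith
      rw [mul_one_div, div_lt_one (by positivity)] at h3
      linarith
    have h4 := Real.log_le_log (by linarith) h2
    rw [Real.log_mul (by norm_num) (by positivity), Real.log_pow] at h4
    have h5 := Real.log_le_sub_one_of_pos (by norm_num : (0 : ℝ) < 3 / 2)
    nlinarith

/-- The bound of the theorem, without any lower-order term. -/
theorem statDist_binSamp_le (hn : 1 ≤ n) (hp : 0 < p) (hp1 : p < 1) (H : IsHat n p α h)
    (hE : ComputesHat h invE hatE) (hc : IsRoundingConstant invE hatE c) (hg : 0 < g + 1 / 2)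
    (hζ : IsLanczosErrorBound t g ζ)
    (hβ : max (2 * ⌈Real.logb 2 n⌉) ⌈-Real.logb 2 p⌉ ≤ (β : ℤ)) (hr : IsRoundToNearest β rnd) :
    statDist (fun k : Fin (n + 1) => binomialMass n p k) (binSamp β rnd t g n p α invE hatE) ≤
      (1110 * β + 3 * c * p + c + α * c) * n * (1 / 2 ^ β) + 15 * ζ := by
  -- precision zero is excluded by `⌈-log₂ p⌉ ≥ 1`
  have hβ1 : 1 ≤ β := by
    by_contra! h0
    have h00 : β = 0 := by omega
    have h1 := (le_max_right _ _).trans hβ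
    have h2 := (Int.le_ceil (-Real.logb 2 p)).trans (Int.cast_le.2 h1)
    rw [h00] at h2
    have := Real.logb_neg (b := 2) (by norm_num) hp hp1
    norm_num at h2
    linarith
  have hα := H.one_le_α hp hp1
  have hc23 := two_thirds_le_roundingConstant H hn hp hp1 hE hc hβ1 hr
  have hb0 : ∀ k : Fin (n + 1), 0 ≤ binomialMass n p k := fun k =>
    (binomialMass_pos (Nat.lt_succ_iff.1 k.2) hp hp1).le
  by_cases hD : (1110 * β + 3 * c * p + c + α * c) * n * (1 / 2 ^ β) + 15 * ζ < 1
  swap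
  · obtain ⟨h1, h2⟩ := binSamp_nonneg_and_sum_le_one (t := t) (g := g) (n := n) (p := p) (α := α)
      (invE := invE) (hatE := hatE) hr
    exact (statDist_le_one hb0 h1 (sum_fin_binomialMass n p).le h2).trans (not_lt.1 hD)
  have hζ0 := hζ.nonneg
  have P := smallParams_of_bound_lt_one hn hp hp1 hα hc23 hζ0 hβ hD
  have hn1 : (1 : ℝ) ≤ n := by exact_mod_cast hn
  have hβ14 : (14 : ℝ) ≤ β := by exact_mod_cast P.β_ge
  have hc0 : 0 < c := by linarith
  obtain ⟨ε, hεdef⟩ : ∃ ε : ℝ, ε = 1 / 2 ^ β := ⟨_, rfl⟩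
  have hε : 0 < ε := by rw [hεdef]; positivity
  -- relative error of the computed quantile and hat density
  obtain ⟨q, hq⟩ : ∃ q, q = c * ε := ⟨_, rfl⟩
  have hq0 : 0 ≤ q := by rw [hq]; positivity
  obtain ⟨w, hw⟩ : ∃ w, w = n * β * ε := ⟨_, rfl⟩
  obtain ⟨σ, hσ⟩ : ∃ σ, σ = 15 * ζ + 1110 * w := ⟨_, rfl⟩
  have hw0 : 0 ≤ w := by rw [hw]; positivity
  have hbound : q * ((3 * p + 2) * n) + σ ≤
      (1110 * β + 3 * c * p + c + α * c) * n * (1 / 2 ^ β) + 15 * ζ := by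
    -- `α ≥ 1`, so that `c + α c ≥ 2 c`
    have h1 : 1 * (c * n * ε) ≤ α * (c * n * ε) := by gcongr
    rw [← hεdef, hσ, hw, hq]
    linarith
  refine le_trans ?_ hbound
  have hD' := hbound.trans_lt hD
  have hqn : 0 ≤ q * (p * n) := by positivity
  have hqn1 : q * 1 ≤ q * n := by gcongr
  have hσ0 : 0 ≤ σ := by rw [hσ]; positivity
  have hq2 : 2 * q + σ < 1 := by linarith
  have hnε : n * ε * 14 ≤ w := by
    rw [hw]
    have : n * ε * 14 ≤ n * ε * β := by gcongr
    linarith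
  have hεn : 1 * ε ≤ n * ε := by gcongr
  obtain ⟨η, hη⟩ : ∃ η, η = 125 * ε := ⟨_, rfl⟩
  obtain ⟨δ, hδ⟩ : ∃ δ, δ = 210 * w + 3.22 * ζ := ⟨_, rfl⟩
  have hη0 : 0 ≤ η := by rw [hη]; positivity
  have hδ0 : 0 ≤ δ := by rw [hδ]; positivity
  have hηw : η * n ≤ 9 * w := by rw [hη]; linarith
  have hηw' : η ≤ 9 * w := by rw [hη]; linarith
  have hE' : ∀ k : Fin (n + 1), logErr β n p ζ k =
      δ + η * ((n - k : ℕ) * -Real.log (1 - p)) := fun k => by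
    rw [logErr, ← hεdef, hδ, hw, hη]
  -- the factor `α` makes the return probabilities comparable with `b_{n,p}`; normalizing cancels it
  set R : Fin (n + 1) → ℝ := fun k => returnProb β rnd t g n p α invE hatE k with hR
  have hα0 : 0 < α := P.α_pos
  have hU : ∀ k : Fin (n + 1), α * R k ≤ binomialMass n p k * ((1 + q) *
      Real.exp (δ + η * ((n - k : ℕ) * -Real.log (1 - p))) *
        ((k + 1) / (1 - q) - k + q * max 1 (k : ℝ) + η)) := fun k => by
    have h1 := returnProb_le P H hE hc hr hg hζ (by rw [← hεdef]; linarith)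
      (hεdef ▸ hq) hq0 (by linarith) k
    rw [hE', ← hεdef, ← hη, div_mul_eq_mul_div, le_div_iff₀ hα0] at h1
    linarith
  have hL : ∀ k : Fin (n + 1), binomialMass n p k * ((1 - q) *
      Real.exp (-(δ + η * ((n - k : ℕ) * -Real.log (1 - p)))) *
        ((k + 1) * (1 - q) - max ((k : ℝ) / (1 - q)) q - η)) ≤ α * R k := fun k => by
    have h1 := le_returnProb P H hE hc hr hg hζ (hεdef ▸ hq) hq0 (by linarith) k
    rw [hE', ← hεdef, ← hη, div_mul_eq_mul_div, div_le_iff₀ hα0] at h1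
    linarith
  have hR0 : ∀ k, 0 ≤ α * R k := fun k => mul_nonneg hα0.le (returnProb_nonneg k)
  have hS : 0 < ∑ k, α * R k := by
    refine Finset.sum_pos' (fun k _ => hR0 k) ⟨0, Finset.mem_univ _, lt_of_lt_of_le ?_ (hL 0)⟩
    have h1 := binomialMass_pos (Nat.zero_le n) hp hp1
    have h2 : 0 < 1 - q := by linarith
    simp only [Fin.coe_ofNat_eq_mod, Nat.zero_mod, Nat.cast_zero, zero_div, zero_add, one_mul,
      max_eq_right hq0]
    have h3 : 0 < 1 - q - q - η := by linarith
    positivity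
  have hSR : 0 < ∑ k, R k := by
    rw [← Finset.mul_sum] at hS
    exact pos_of_mul_pos_right hS hα0.le
  have hbin : binSamp β rnd t g n p α invE hatE = fun k => α * R k / ∑ j, α * R j := by
    funext k
    rw [binSamp_eq_div hr hSR, ← Finset.mul_sum, mul_div_mul_left _ _ hα0.ne']
  rw [hbin]
  rcases hn.eq_or_lt with rfl | hn2
  · have hT : q * ((3 * p + 2) * ((1 : ℕ) : ℝ)) + σ = (3 * p + 2) * q + σ := by
      push_cast; ring
    rw [hT] at hD' ⊢
    refine statDist_weights_one_le hp hp1 rfl hq0 hδ0 hη0 (by linarith) (by linarith) ?_ hD' hR0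
      hS hU hL
    -- when the bound is below `1 - p`, the latter exceeds `ε`, and `-log (1 - p)` is `O(β)`
    intro hz
    have hqp : 0 ≤ (3 * p + 2) * q := by positivity
    have hzε : ε ≤ 1 - p := by linarith
    have hlog : -Real.log (1 - p) ≤ 0.7 * β := by
      have h1 := Real.log_le_log hε hzε
      rw [hεdef, one_div, Real.log_inv, Real.log_pow] at h1
      have h2 := Real.log_two_lt_d9
      nlinarith
    have h3 : η * -Real.log (1 - p) ≤ 87.5 * w := by
      calc η * -Real.log (1 - p) ≤ η * (0.7 * β) := by gcongr
        _ = 87.5 * w := by rw [hη, hw]; push_cast; ring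
    linarith
  · exact statDist_weights_le hn2 hp hp1 rfl hq0 hδ0 hη0 (by linarith) (by linarith) hD' hR0 hS
      hU hL
end Main

theorem theorem1 :
    ∃ r : ℕ → ℝ, r =o[atTop] (fun β : ℕ => 1 / (2 : ℝ) ^ β) ∧
      ∀ (n : ℕ) (p : ℝ), 1 ≤ n → 0 < p → p < 1 →
      ∀ (α : ℝ) (h : ℝ → ℝ), IsHat n p α h →
      ∀ (invE hatE : ArithExpr), ComputesHat h invE hatE →
      ∀ c : ℝ, IsRoundingConstant invE hatE c →
      ∀ (t : ℕ) (g : ℝ), 0 < g + 1 / 2 →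
      ∀ ζ : ℝ, IsLanczosErrorBound t g ζ →
      ∀ β : ℕ, max (2 * ⌈Real.logb 2 n⌉) ⌈-Real.logb 2 p⌉ ≤ (β : ℤ) →
      ∀ rnd : ℝ → ℝ, IsRoundToNearest β rnd →
        statDist (fun k : Fin (n + 1) => binomialMass n p k)
            (binSamp β rnd t g n p α invE hatE) ≤
          (1110 * β + 3 * c * p + c + α * c) * n * (1 / 2 ^ β) + 15 * ζ + r β := by
  -- the explicit constants absorb all terms of higher order
  refine ⟨fun _ => 0, isLittleO_zero _ _, ?_⟩
  intro n p hn hp hp1 α h H invE hatE hE c hc t g hg ζ hζ β hβ rnd hr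
  rw [add_zero]
  exact statDist_binSamp_le hn hp hp1 H hE hc hg hζ hβ hr
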